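/- **Setting.** Let $\Omega=A^{\mathbb N}$ or $A^{\mathbb Z}$ be the full shift space over a measurable alphabet $A$, $\theta$ the left shift, $\nu$ a $\theta$-invariant probability measure on $\Omega$. Let $M$ be a compact metric space (for instance a compact manifold with its Riemannian distance), $T_a:M\to M$ ($a\in A$) maps with $(a,x)\mapsto T_a(x)$ measurable, $T_\omega=T_{\omega_0}$ and $T_\omega^n=T_{\theta^{n-1}\omega}\circ\cdots\circ T_{\theta\omega}\circ T_\omega$. Let $(\mu^\omega)_{\omega\in\Omega}$ be a measurable family of Borel probability measures on $M$ with $(T_\omega)_*\mu^\omega=\mu^{\theta\omega}$ for $\nu$-a.e. $\omega$ (so that $d\mathbb P=d\mu^\omega d\nu(\omega)$ is invariant under the skew product $S(\omega,x)=(\theta\omega,T_\omega x)$), and let $\mu=\int\mu^\omega\,d\nu(\omega)$. Let $\Omega_0\subset\Omega$ be a set of full $\nu$-measure with $\theta\Omega_0\subset\Omega_0$ such that for $\omega\in\Omega_0$ and $j,m\ge1$ the block $\omega_0\dots\omega_{j-1}$ repeated $m$ times is the initial block $\omega'_0\dots\omega'_{mj-1}$ of some $\omega'\in\Omega_0$ (e.g.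 $\Omega_0=\Omega$; or any forward invariant set of full measure if $A$ is countable and $\nu$ charges all cylinders). For each $\omega\in\Omega_0$ there are a family $\Gamma^u(\omega)$ of unstable leaves and a family $\Gamma^s(\omega)$ of pairwise disjoint stable leaves (subsets of $M$) such that $\gamma^u\cap\gamma^s$ is a single point for all $\gamma^u\in\Gamma^u(\omega)$, $\gamma^s\in\Gamma^s(\omega)$, the holonomy onto each $\gamma^u$ along the stable leaves is measurable, and $\mu^\omega=\int\mu^\omega_{\gamma^u}\,d\upsilon^\omega(\gamma^u)$ with probability measures $\mu^\omega_{\gamma^u}$ carried by $\gamma^u$ and a probability measure $\upsilon^\omega$ on $\Gamma^u(\omega)$. Let $R>0$. For $\omega\in\Omega_0$, $\gamma^u\in\Gamma^u(\omega)$, $n\ge1$ let finitely many points $y_k\in T^n_\omega\gamma^u$ be given, each on a leaf $\hat\gamma_k\in\Gamma^u(\theta^n\omega)$, and let $D_k$ be the disk of radius $R$ about $y_k$ for the intrinsic distance of $\hat\gamma_k$. The $n$-cylinders of $\gamma^u$ are the sets $\zeta=\varphi(D_k)$, where $\varphi:D_k\to\gamma^u$ is a continuous inverse branch of $T_\omega^n$.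 They are Borel sets and cover $\gamma^u$ up to a $\mu^\omega_{\gamma^u}$-null set; each meets at most $L$ of the others and itself in total, and $\mu^{\theta^n\omega}_{\hat\gamma_k}(D_k)\ge c$, with constants $L$ and $c>0$ independent of $\omega,\gamma^u,n,k$. **Assumptions.** Below $B_\rho(x)$ is the open ball, $x$ ranges over the support of $\mu$, "small $\rho$" means $0<\rho<\rho_0$ with a uniform $\rho_0>0$ (in (IX) $\rho_0$ may depend on $\omega$), and $\|G\|_{Lip}=\|G\|_\infty+\mathrm{Lip}(G)$. There are functions $\lambda,\delta,\Theta$ on $\mathbb N$ such that, for all $k,n\ge1$: (I) $\bigl|\int\!\int G\,(H\circ T^k_\omega)\,d\mu^\omega d\nu(\omega)-\mu(G)\mu(H)\bigr|\le\lambda(k)\|G\|_{Lip}\|H\|_\infty$ for $G$ Lipschitz and $H$ bounded measurable. (II) For $\nu$-a.e. $\omega$: $\bigl|\int G\,(H\circ T^k_\omega)\,d\mu^\omega-\mu^\omega(G)\mu^{\theta^k\omega}(H)\bigr|\le\lambda(k)\|G\|_{Lip}\|H\|_\infty$ for $G$ Lipschitz and $H$ bounded measurable and constant on each leaf of $\Gamma^s(\theta^k\omega)$.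 (III) For some $0<d_0<d_1$: $\rho^{d_1}\le\mu(B_\rho(x))\le\rho^{d_0}$ for small $\rho$. (IV) For some $u_0>0$ and $C_1$: $\mu^\omega_{\gamma^u}(B_\rho(x))\le C_1\rho^{u_0}$ for small $\rho$, all $\omega\in\Omega_0$, $\gamma^u\in\Gamma^u(\omega)$ and $\mu^\omega_{\gamma^u}$-a.e. $x$. (V) For every $\omega\in\Omega_0$ and every $n$-cylinder $\zeta=\varphi(D_k)$ of a leaf $\gamma^u$, $T_\omega^n|_\zeta$ has a Jacobian $J$, i.e. $\mu^{\theta^n\omega}_{\hat\gamma_k}(T_\omega^nE)=\int_EJ\,d\mu^\omega_{\gamma^u}$ for Borel $E\subset\zeta$, with $J(x)\le C\,\Theta(n)J(y)$ for $x,y\in\zeta$, where $C$ is a uniform constant, $\Theta$ is non-decreasing and $\Theta(n)=O(n^{\kappa'})$ with $\kappa'\ge0$. (VI) $\delta(n)=O(n^{-\kappa})$ with $\kappa>1$; for $\omega\in\Omega_0$, $\operatorname{diam}\zeta\le\delta(n)$ for every $n$-cylinder $\zeta$ and $\operatorname{diam}T_\omega^n\gamma^s\le\delta(n)$ for every $\gamma^s\in\Gamma^s(\omega)$.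 (VII) For some $\xi\ge\beta>0$ and $C$: $\mu^\omega(B_{\rho+r}(x)\setminus B_{\rho-r}(x))\le C\frac{r^\xi}{\rho^\beta}\mu(B_\rho(x))$ for $\nu$-a.e. $\omega$, small $\rho$ and $0<r<\rho$. (VIII) For some $K>0$: $\frac1K\mu^\omega(B_\rho(x))\le\mu(B_\rho(x))\le K\mu^\omega(B_\rho(x))$ for $\omega\in\Omega_0$ and small $\rho$. Assume moreover one of: (A) $\lambda(k)=O(k^{-p})$ with $p>1$, $\kappa\xi>1$, $\max\bigl\{\frac{d_1\beta}{\kappa\xi-1},\bigl(\frac\beta\xi+d_1\bigr)\frac1p\bigr\}<\min\{1,u_0\}$ and $\kappa u_0-2-\kappa'>1$; (B) $\delta$ decays faster than every power, $\lambda(k)=O(k^{-p})$ with $p>0$, and $\bigl(\frac\beta\xi+d_1\bigr)\frac1p<\min\{1,u_0\}$; (C) $\delta$ and $\lambda$ both decay faster than every power. **Theorem.** Let $\tau_B^\omega(y)=\inf\{j\ge1:T_\omega^jy\in B\}$. For $\nu$-a.e. $\omega$, $\mu^\omega$-a.e. $x$ and all $t>0$, $$\mu^\omega\Bigl(y:\tau^\omega_{B_\rho(x)}(y)>\frac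 t{\mu(B_\rho(x))}\Bigr)\longrightarrow e^{-t}\qquad(\rho\to0).$$ If moreover (IX) there are $\xi'\ge\beta'>0$ such that for $\nu$-a.e. $\omega$ there is a constant $C_\omega$ with $\mu^\omega(B_{\rho+r}(x)\setminus B_{\rho-r}(x))\le C_\omega\frac{r^{\xi'}}{\rho^{\beta'}}\mu^\omega(B_\rho(x))$ for small $\rho$ and $0<r<\rho$, then for $\nu$-a.e. $\omega$, $\mu^\omega$-a.e. $x$ and all $t>0$, with $\mu^\omega_B=\mu^\omega(\,\cdot\,|B)$, $$\mu^\omega_{B_\rho(x)}\Bigl(y:\tau^\omega_{B_\rho(x)}(y)>\frac t{\mu(B_\rho(x))}\Bigr)\longrightarrow e^{-t}\qquad(\rho\to0).$$ -/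

import Mathlib

open MeasureTheory ProbabilityTheory Filter Topology Set Asymptotics
open scoped ENNReal NNReal

namespace RandomMaps

section Shift

variable {ι A M : Type*} [AddMonoidWithOne ι]

/-- The left shift on the full shift space `ι → A`. The one-sided full shift is `ι = ℕ`, the
two-sided one is `ι = ℤ`. -/
def shift (ω : ι → A) : ι → A := fun i => ω (i + 1)

/-- The fibre map `T_ω`; it is the map attached to the symbol `ω₀`. -/
def fibreMap (T : A → M → M) (ω : ι → A) : M → M := T (ω 0)

/-- The cocycle `T_ω^n = T_{θ^{n-1}ω} ∘ ⋯ ∘ T_{θω} ∘ T_ω`. -/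
def iter (T : A → M → M) (ω : ι → A) : ℕ → M → M
  | 0 => id
  | n + 1 => fibreMap T (shift^[n] ω) ∘ iter T ω n

/-- `τ_B^ω(x) = inf {j ≥ 1 : T_ω^j x ∈ B}`, with value `⊤` if the orbit never enters `B`. -/
noncomputable def hittingTime (T : A → M → M) (ω : ι → A) (B : Set M) (x : M) : ℕ∞ :=
  ⨅ (j : ℕ) (_ : 1 ≤ j ∧ iter T ω j x ∈ B), (j : ℕ∞)

end Shift

section Leaves

variable {M : Type*} [MetricSpace M]

/-- The intrinsic distance of a leaf `γ`: the infimum of the lengths of the curves in `γ` joining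
two points (`⊤` if there is no such curve of finite length). -/
noncomputable def leafEDist (γ : Set M) (x y : M) : ℝ≥0∞ :=
  ⨅ (c : ℝ → M) (_ : ContinuousOn c (Icc 0 1) ∧ MapsTo c (Icc 0 1) γ ∧ c 0 = x ∧ c 1 = y),
    eVariationOn c (Icc 0 1)

/-- The disk `B_{R,γ}(y)` of radius `R` about `y` in the leaf `γ`. -/
def leafDisk (γ : Set M) (R : ℝ) (y : M) : Set M :=
  {z | z ∈ γ ∧ leafEDist γ y z < ENNReal.ofReal R}

/-- `φ` is an inverse branch of `f`, defined on `D` and with values in `γ`. -/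
def IsInverseBranch (f : M → M) (D γ : Set M) (φ : M → M) : Prop :=
  ContinuousOn φ D ∧ MapsTo φ D γ ∧ ∀ z ∈ D, f (φ z) = z

open Classical in
/-- The holonomy onto the unstable leaf `γ` along the stable leaves in `Γs`: a point `x` of a stable
leaf `s` is sent to the point of `γ ∩ s`; points on no stable leaf are left fixed. -/
noncomputable def holonomy (Γs : Set (Set M)) (γ : Set M) (x : M) : M :=
  if h : ∃ z, ∃ s ∈ Γs, x ∈ s ∧ z ∈ γ ∩ s then h.choose else x

end Leaves

/-- A random dynamical system over the full shift `ι → A` with fibre `M`, with its fibre measures and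
its families of stable and unstable leaves. The unstable leaves of the fibre over `ω` are the sets
`unst ω a`, `a : U`; the stable ones are the elements of `stab ω`. -/
structure System (ι A M U : Type*) [AddMonoidWithOne ι] [MeasurableSpace A]
    [MetricSpace M] [CompactSpace M] [MeasurableSpace M] [BorelSpace M]
    [MeasurableSpace U] where
  /-- the shift-invariant probability measure on the shift space -/
  ν : Measure (ι → A)
  prob_ν : IsProbabilityMeasure ν
  inv_ν : MeasurePreserving (shift : (ι → A) → ι → A) ν ν
  /-- the maps -/
  T : A → M → M
  meas_T : Measurable fun q : A × M => T q.1 q.2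
  /-- the fibre measures `μ^ω`, i.e. the disintegration over `ν` of the measure
  `dμ^ω dν(ω)` on `(ι → A) × M` -/
  μf : Kernel (ι → A) M
  prob_μf : IsMarkovKernel μf
  inv_μf : ∀ᵐ ω ∂ν, (μf ω).map (fibreMap T ω) = μf (shift ω)
  /-- the realisations for which the leaf structure is required: a set of full measure which is
  forward invariant and such that a finite block of one of its elements, repeated any
  number of times, is the initial block of an element (the whole shift space is such a set) -/
  good : Set (ι → A)
  ae_good : ∀ᵐ ω ∂ν, ω ∈ good
  shift_good : ∀ ω ∈ good, shift ω ∈ good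
  repeat_good : ∀ ω ∈ good, ∀ j : ℕ, 1 ≤ j → ∀ m : ℕ, ∃ ω' ∈ good,
    ∀ i : ℕ, i < m * j → ω' (i : ι) = ω ((i % j : ℕ) : ι)
  /-- unstable leaves -/
  unst : (ι → A) → U → Set M
  /-- stable leaves -/
  stab : (ι → A) → Set (Set M)
  stab_disjoint : ∀ ω ∈ good, (stab ω).PairwiseDisjoint id
  inter_single : ∀ ω ∈ good, ∀ a, ∀ s ∈ stab ω, ∃ z, unst ω a ∩ s = {z}
  meas_holonomy : ∀ ω ∈ good, ∀ a, Measurable (holonomy (stab ω) (unst ω a))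
  /-- the conditional measures of `μ^ω` on the unstable leaves -/
  μu : (ι → A) → Kernel U M
  prob_μu : ∀ ω ∈ good, IsMarkovKernel (μu ω)
  supp_μu : ∀ ω ∈ good, ∀ a, ∀ᵐ x ∂(μu ω a), x ∈ unst ω a
  /-- the transversal measure on the space of unstable leaves -/
  υ : (ι → A) → Measure U
  prob_υ : ∀ ω ∈ good, IsProbabilityMeasure (υ ω)
  decomp : ∀ ω ∈ good, μf ω = (υ ω).bind (μu ω)
  /-- the radius of the leaf disks -/
  R : ℝ
  R_pos : 0 < R
  /-- the centres `y_k ∈ T_ω^n γ^u`, each with the leaf over `θ^n ω` on which it lies -/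
  centres : (ι → A) → U → ℕ → Finset (U × M)
  centres_mem : ∀ ω ∈ good, ∀ a n, 1 ≤ n → ∀ b ∈ centres ω a n,
    b.2 ∈ iter T ω n '' unst ω a ∧ b.2 ∈ unst (shift^[n] ω) b.1

namespace System

variable {ι A M U : Type*} [AddMonoidWithOne ι] [MeasurableSpace A]
    [MetricSpace M] [CompactSpace M] [MeasurableSpace M] [BorelSpace M]
    [MeasurableSpace U] (S : System ι A M U)

/-- The marginal `μ = ∫ μ^ω dν(ω)` on `M`. -/
noncomputable def μ : Measure M := S.ν.bind S.μf

/-- The disk `B_{R,γ}(y)` about the centre `b = (γ, y)`, in the leaf of the fibre over `θ^n ω`. -/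
def disk (ω : ι → A) (n : ℕ) (b : U × M) : Set M :=
  leafDisk (S.unst (shift^[n] ω) b.1) S.R b.2

/-- `ζ` is the `n`-cylinder `φ(B_{R,γ}(y))` in the unstable leaf `a` of the fibre over `ω`, where
`b = (γ, y)` is one of the centres and `φ` an inverse branch of `T_ω^n`. -/
def IsCylinderOver (ω : ι → A) (a : U) (n : ℕ) (b : U × M) (ζ : Set M) : Prop :=
  b ∈ S.centres ω a n ∧
    ∃ φ : M → M, IsInverseBranch (iter S.T ω n) (S.disk ω n b) (S.unst ω a) φ ∧
      ζ = φ '' S.disk ω n b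

/-- The collection of the `n`-cylinders in the unstable leaf `a` of the fibre over `ω`. -/
def cylinders (ω : ι → A) (a : U) (n : ℕ) : Set (Set M) :=
  {ζ | ∃ b, S.IsCylinderOver ω a n b ζ}

/-- The cylinders are Borel sets, the `n`-cylinders in a leaf cover it (up to a null set) with a
bounded number of overlaps, and the disks have leaf measure bounded from below. -/
def CylinderStructure : Prop :=
  (∀ ω ∈ S.good, ∀ a n, 1 ≤ n →
    (∀ ζ ∈ S.cylinders ω a n, MeasurableSet ζ) ∧
    ∀ᵐ x ∂(S.μu ω a), ∃ ζ ∈ S.cylinders ω a n, x ∈ ζ) ∧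
  (∃ L : ℕ, ∀ ω ∈ S.good, ∀ a n, 1 ≤ n → ∀ ζ ∈ S.cylinders ω a n,
    {ζ' | ζ' ∈ S.cylinders ω a n ∧ (ζ ∩ ζ').Nonempty}.encard ≤ L) ∧
  (∃ c : ℝ, 0 < c ∧ ∀ ω ∈ S.good, ∀ a n, 1 ≤ n → ∀ b ∈ S.centres ω a n,
    ENNReal.ofReal c ≤ S.μu (shift^[n] ω) b.1 (S.disk ω n b))

/-- (I) Annealed decay of correlations at the rate `lam`. Here `K + L` is any upper bound of the
Lipschitz norm of `G`, and `C` any upper bound of the supremum norm of `H`. -/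
def AnnealedDecay (lam : ℕ → ℝ) : Prop :=
  ∀ k : ℕ, 1 ≤ k → ∀ (G H : M → ℝ) (K L C : ℝ≥0), LipschitzWith L G → (∀ x, |G x| ≤ K) →
    Measurable H → (∀ x, |H x| ≤ C) →
    |(∫ ω, ∫ x, G x * H (iter S.T ω k x) ∂(S.μf ω) ∂S.ν) - (∫ x, G x ∂S.μ) * ∫ x, H x ∂S.μ|
      ≤ lam k * (K + L) * C

/-- (II) Quenched decay of correlations at the rate `lam`, against functions `H` on the fibre over
`θ^k ω` that are constant on its stable leaves. -/
def QuenchedDecay (lam : ℕ → ℝ) : Prop :=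
  ∀ᵐ ω ∂S.ν, ∀ k : ℕ, 1 ≤ k → ∀ (G H : M → ℝ) (K L C : ℝ≥0),
    LipschitzWith L G → (∀ x, |G x| ≤ K) → Measurable H → (∀ x, |H x| ≤ C) →
    (∀ s ∈ S.stab (shift^[k] ω), ∀ x ∈ s, ∀ y ∈ s, H x = H y) →
    |(∫ x, G x * H (iter S.T ω k x) ∂(S.μf ω))
        - (∫ x, G x ∂(S.μf ω)) * ∫ x, H x ∂(S.μf (shift^[k] ω))|
      ≤ lam k * (K + L) * C

/-- (III) Dimension bounds. -/
def DimensionBounds (d₀ d₁ : ℝ) : Prop :=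
  ∃ ρ₀ : ℝ, 0 < ρ₀ ∧ ∀ x ∈ S.μ.support, ∀ ρ : ℝ, 0 < ρ → ρ < ρ₀ →
    ρ ^ d₁ ≤ S.μ.real (Metric.ball x ρ) ∧ S.μ.real (Metric.ball x ρ) ≤ ρ ^ d₀

/-- (IV) Regularity of the measures on unstable leaves. -/
def LeafBound (u₀ : ℝ) : Prop :=
  ∃ C₁ ρ₀ : ℝ, 0 < ρ₀ ∧ ∀ ω ∈ S.good, ∀ a, ∀ᵐ x ∂(S.μu ω a), ∀ ρ : ℝ, 0 < ρ → ρ < ρ₀ →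
    (S.μu ω a).real (Metric.ball x ρ) ≤ C₁ * ρ ^ u₀

/-- `J` is the Jacobian of `T_ω^n` on the subset `ζ` of the leaf `a` over `ω`, with respect to the
measures on the leaf `a` and on the leaf `a'` over `θ^n ω` that contains the image. -/
def IsJacobian (ω : ι → A) (a : U) (n : ℕ) (a' : U) (ζ : Set M) (J : M → ℝ≥0) : Prop :=
  Measurable J ∧ ∀ E : Set M, MeasurableSet E → E ⊆ ζ →
    S.μu (shift^[n] ω) a' (iter S.T ω n '' E) = ∫⁻ x in E, (J x : ℝ≥0∞) ∂(S.μu ω a)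

/-- (V) Distortion. -/
def Distortion (Θ : ℕ → ℝ) : Prop :=
  ∃ C : ℝ, ∀ ω ∈ S.good, ∀ a n, 1 ≤ n → ∀ b ζ, S.IsCylinderOver ω a n b ζ →
    ∃ J : M → ℝ≥0, S.IsJacobian ω a n b.1 ζ J ∧
      ∀ x ∈ ζ, ∀ y ∈ ζ, (J x : ℝ) ≤ C * Θ n * J y

/-- (VI) Contraction: `n`-cylinders in unstable leaves, and images under `T_ω^n` of stable leaves,
have diameter at most `δ n`. -/
def Contraction (δ : ℕ → ℝ) : Prop :=
  ∀ ω ∈ S.good, ∀ n, 1 ≤ n →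
    (∀ a, ∀ ζ ∈ S.cylinders ω a n, Metric.diam ζ ≤ δ n) ∧
    ∀ s ∈ S.stab ω, Metric.diam (iter S.T ω n '' s) ≤ δ n

/-- (VII) Annulus condition. -/
def AnnulusCondition (ξ β : ℝ) : Prop :=
  ∃ C ρ₀ : ℝ, 0 < ρ₀ ∧ ∀ᵐ ω ∂S.ν, ∀ x ∈ S.μ.support, ∀ ρ r : ℝ, 0 < r → r < ρ → ρ < ρ₀ →
    (S.μf ω).real (Metric.ball x (ρ + r) \ Metric.ball x (ρ - r))
      ≤ C * (r ^ ξ / ρ ^ β) * S.μ.real (Metric.ball x ρ)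

/-- (VIII) Comparability of the fibre measures with the marginal on small balls. -/
def Comparable : Prop :=
  ∃ K ρ₀ : ℝ, 0 < K ∧ 0 < ρ₀ ∧ ∀ ω ∈ S.good, ∀ x ∈ S.μ.support, ∀ ρ : ℝ, 0 < ρ → ρ < ρ₀ →
    K⁻¹ * (S.μf ω).real (Metric.ball x ρ) ≤ S.μ.real (Metric.ball x ρ) ∧
    S.μ.real (Metric.ball x ρ) ≤ K * (S.μf ω).real (Metric.ball x ρ)

/-- (IX) Random annulus condition. -/
def RandomAnnulusCondition : Prop :=
  ∃ ξ β : ℝ, 0 < β ∧ β ≤ ξ ∧ ∀ᵐ ω ∂S.ν, ∃ C ρ₀ : ℝ, 0 < ρ₀ ∧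
    ∀ x ∈ S.μ.support, ∀ ρ r : ℝ, 0 < r → r < ρ → ρ < ρ₀ →
      (S.μf ω).real (Metric.ball x (ρ + r) \ Metric.ball x (ρ - r))
        ≤ C * (r ^ ξ / ρ ^ β) * (S.μf ω).real (Metric.ball x ρ)

/-- The event `{y : τ_B^ω(y) > t / μ(B)}` for the ball `B = B_ρ(x)`. -/
def lateHits (ω : ι → A) (x : M) (ρ t : ℝ) : Set M :=
  {y | ENNReal.ofReal t / S.μ (Metric.ball x ρ)
    < (hittingTime S.T ω (Metric.ball x ρ) y : ℝ≥0∞)}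

end System

/-- `f(n) = O(n^{-q})`. -/
def PolyDecay (f : ℕ → ℝ) (q : ℝ) : Prop :=
  f =O[atTop] fun n : ℕ => (n : ℝ) ^ (-q)

/-- `f` decays faster than every power. -/
def SuperPolyDecay (f : ℕ → ℝ) : Prop := ∀ q : ℝ, PolyDecay f q

end RandomMaps

namespace RandomMaps

section Covering

variable {M : Type*} [MetricSpace M] [CompactSpace M]

/-- Maximal separated sets: a finite `s`-separated `s`-net of a subset of a compact space. -/
theorem exists_finset_net (X : Set M) {s : ℝ} (hs : 0 < s) :
    ∃ Z : Finset M, (∀ z ∈ Z, z ∈ X) ∧ (∀ z ∈ Z, ∀ w ∈ Z, z ≠ w → s < dist z w) ∧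
      ∀ x ∈ X, ∃ z ∈ Z, dist x z ≤ s := by
  lift s to ℝ≥0 using hs.le
  have hs' : (s / 2 : ℝ≥0) ≠ 0 := by
    have : s ≠ 0 := by rintro rfl; simp at hs
    simp [this]
  obtain ⟨N, -, hNf, hN⟩ := Metric.exists_finite_isCover_of_totallyBounded (s := X) hs'
    (isCompact_univ.totallyBounded.subset (subset_univ _))
  have hp : Metric.packingNumber s X ≠ ⊤ := by
    have h1 := Metric.packingNumber_two_mul_le_externalCoveringNumber (s / 2) X
    rw [mul_div_cancel₀ s two_ne_zero] at h1
    exact ((h1.trans hN.externalCoveringNumber_le_encard).trans_lt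
      (Set.encard_lt_top_iff.2 hNf)).ne
  have hfin : (Metric.maximalSeparatedSet s X).Finite := by
    rw [← Set.encard_lt_top_iff, Metric.encard_maximalSeparatedSet hp]
    exact lt_top_iff_ne_top.2 hp
  refine ⟨hfin.toFinset, fun z hz => ?_, fun z hz w hw hzw => ?_, fun x hx => ?_⟩
  · exact Metric.maximalSeparatedSet_subset (hfin.mem_toFinset.1 hz)
  · have : (s : ℝ≥0∞) < edist z w := Metric.isSeparated_maximalSeparatedSet
      (hfin.mem_toFinset.1 hz) (hfin.mem_toFinset.1 hw) hzw
    rw [edist_nndist, ENNReal.coe_lt_coe] at this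
    exact_mod_cast this
  · obtain ⟨z, hz, hxz⟩ := Metric.isCover_maximalSeparatedSet hp hx
    refine ⟨z, hfin.mem_toFinset.2 hz, ?_⟩
    have hxz' : edist x z ≤ s := hxz
    rw [edist_nndist, ENNReal.coe_le_coe] at hxz'
    exact_mod_cast hxz'

theorem disjoint_ball_of_separated {M : Type*} [MetricSpace M] {Z : Finset M} {s : ℝ}
    (hZ : ∀ z ∈ Z, ∀ w ∈ Z, z ≠ w → s < dist z w) :
    (Z : Set M).PairwiseDisjoint fun z => Metric.ball z (s / 2) := by
  intro z hz w hw hzw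
  exact Metric.ball_disjoint_ball (by linarith [hZ z hz w hw hzw])

variable [MeasurableSpace M] [BorelSpace M]

/-- A measure dominated by another one on balls centred in a set of full measure is dominated
by it. -/
theorem measure_le_of_ball_le {m₁ m₂ : Measure M} [IsFiniteMeasure m₁] [IsFiniteMeasure m₂]
    {X : Set M} (hX : MeasurableSet X) (hm : m₁ Xᶜ = 0) {C : ℝ≥0∞} (hC : C ≠ ∞) {ρ₀ : ℝ}
    (hρ₀ : 0 < ρ₀)
    (h : ∀ x ∈ X, ∀ ρ : ℝ, 0 < ρ → ρ < ρ₀ →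
      m₁ (Metric.ball x (4 * ρ)) ≤ C * m₂ (Metric.ball x ρ)) (E : Set M) :
    m₁ E ≤ C * m₂ E := by
  suffices H : ∀ E, MeasurableSet E → m₁ E ≤ C * m₂ E by
    calc m₁ E ≤ m₁ (toMeasurable m₂ E) := measure_mono (subset_toMeasurable _ _)
      _ ≤ C * m₂ (toMeasurable m₂ E) := H _ (measurableSet_toMeasurable _ _)
      _ = C * m₂ E := by rw [measure_toMeasurable]
  intro E hE
  have hK : ∀ K : Set M, IsCompact K → K ⊆ X → m₁ K ≤ C * m₂ K := by
    intro K hK hKX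
    have ht : Tendsto (fun r => C * m₂ (Metric.cthickening r K)) (𝓝[>] 0) (𝓝 (C * m₂ K)) :=
      ENNReal.Tendsto.const_mul ((tendsto_measure_cthickening_of_isCompact hK).mono_left
        nhdsWithin_le_nhds) (Or.inr hC)
    refine ge_of_tendsto ht ?_
    filter_upwards [Ioo_mem_nhdsGT hρ₀] with r hr
    obtain ⟨Z, hZK, hZs, hZc⟩ := exists_finset_net K (s := 2 * r) (by linarith [hr.1])
    have hsub : K ⊆ ⋃ z ∈ Z, Metric.ball z (4 * r) := by
      intro x hx
      obtain ⟨z, hz, hxz⟩ := hZc x hx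
      simp only [mem_iUnion, Metric.mem_ball, exists_prop]
      exact ⟨z, hz, by linarith [hr.1]⟩
    have hdisj := disjoint_ball_of_separated hZs
    rw [mul_div_cancel_left₀ r two_ne_zero] at hdisj
    calc m₁ K ≤ ∑ z ∈ Z, m₁ (Metric.ball z (4 * r)) :=
          (measure_mono hsub).trans (measure_biUnion_finset_le _ _)
      _ ≤ ∑ z ∈ Z, C * m₂ (Metric.ball z r) :=
          Finset.sum_le_sum fun z hz => h z (hKX (hZK z hz)) r hr.1 hr.2
      _ = C * m₂ (⋃ z ∈ Z, Metric.ball z r) := by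
          rw [← Finset.mul_sum, measure_biUnion_finset hdisj
            fun z _ => Metric.isOpen_ball.measurableSet]
      _ ≤ C * m₂ (Metric.cthickening r K) := by
          gcongr
          refine iUnion₂_subset fun z hz x hx => ?_
          exact Metric.mem_cthickening_of_dist_le x z r K (hZK z hz) (Metric.mem_ball.1 hx).le
  have h1 : m₁ E = m₁ (E ∩ X) := by
    refine le_antisymm ?_ (measure_mono inter_subset_left)
    calc m₁ E ≤ m₁ (E ∩ X ∪ Xᶜ) := measure_mono fun x hx => by
          by_cases hxX : x ∈ X
          · exact Or.inl ⟨hx, hxX⟩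
          · exact Or.inr hxX
      _ ≤ m₁ (E ∩ X) + m₁ Xᶜ := measure_union_le _ _
      _ = m₁ (E ∩ X) := by rw [hm, add_zero]
  rw [h1, (hE.inter hX).measure_eq_iSup_isCompact_of_ne_top (measure_ne_top _ _)]
  refine iSup₂_le fun K hKE => iSup_le fun hKc => ?_
  refine (hK K hKc (hKE.trans inter_subset_right)).trans ?_
  gcongr
  exact hKE.trans inter_subset_left

/-- Lebesgue differentiation along balls, for a measure that is doubling on its support. -/
theorem ae_tendsto_ball_integral_sub {m : Measure M} [IsFiniteMeasure m] {D : ℝ≥0} {ρ₀ : ℝ}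
    (hρ₀ : 0 < ρ₀) (hD : ∀ x ∈ m.support, ∀ ρ : ℝ, 0 < ρ → ρ < ρ₀ →
      m (Metric.ball x (4 * ρ)) ≤ D * m (Metric.ball x ρ)) {f : M → ℝ} (hf : Integrable f m) :
    ∀ᵐ x ∂m, Tendsto (fun ρ => (∫ y in Metric.ball x ρ, |f y - f x| ∂m) /
      m.real (Metric.ball x ρ)) (𝓝[>] 0) (𝓝 0) := by
  have hcl : ∀ x ∈ m.support, ∀ ρ ∈ Ioo 0 ρ₀,
      m (Metric.closedBall x (3 * ρ)) ≤ D * m (Metric.closedBall x ρ) := by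
    intro x hx ρ hρ
    calc m (Metric.closedBall x (3 * ρ)) ≤ m (Metric.ball x (4 * ρ)) :=
          measure_mono (Metric.closedBall_subset_ball (by linarith [hρ.1]))
      _ ≤ D * m (Metric.ball x ρ) := hD x hx ρ hρ.1 hρ.2
      _ ≤ _ := by gcongr; exact Metric.ball_subset_closedBall
  have hV : ∀ x, ∃ᶠ r in 𝓝[>] 0,
      m (Metric.closedBall x (3 * r)) ≤ D * m (Metric.closedBall x r) := by
    intro x
    refine Eventually.frequently ?_
    by_cases hx : x ∈ m.support
    · filter_upwards [Ioo_mem_nhdsGT hρ₀] with r hr using hcl x hx r hr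
    · obtain ⟨U, hU, hU0⟩ := Measure.notMem_support_iff_exists.1 hx
      obtain ⟨ε, hε, hεU⟩ := Metric.nhds_basis_closedBall.mem_iff.1 hU
      filter_upwards [Ioo_mem_nhdsGT (show (0 : ℝ) < ε / 3 by positivity)] with r hr
      have : m (Metric.closedBall x (3 * r)) = 0 := measure_mono_null
        ((Metric.closedBall_subset_closedBall (by linarith [hr.2])).trans hεU) hU0
      simp [this]
  let v := Vitali.vitaliFamily m D hV
  filter_upwards [v.ae_tendsto_average_norm_sub hf.locallyIntegrable,
    Measure.support_mem_ae (μ := m)]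
    with x hx hxs
  have h1 : Tendsto (fun ρ : ℝ => Metric.closedBall x ρ) (𝓝[>] 0) (v.filterAt x) := by
    rw [v.tendsto_filterAt_iff]
    constructor
    · filter_upwards [Ioo_mem_nhdsGT hρ₀] with r hr
      refine ⟨Metric.isClosed_closedBall, ?_, r, Subset.rfl, hcl x hxs r hr⟩
      exact ⟨x, Metric.ball_subset_interior_closedBall (Metric.mem_ball_self hr.1)⟩
    · intro ε hε
      filter_upwards [Ioo_mem_nhdsGT hε] with r hr
      exact Metric.closedBall_subset_closedBall hr.2.le
  have h2 := (hx.comp h1).const_mul (D : ℝ)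
  rw [mul_zero] at h2
  have hint : Integrable (fun y => |f y - f x|) m := (hf.sub (integrable_const _)).abs
  refine tendsto_of_tendsto_of_tendsto_of_le_of_le' tendsto_const_nhds h2 ?_ ?_
  · exact Eventually.of_forall fun ρ => div_nonneg (integral_nonneg fun _ => abs_nonneg _)
      measureReal_nonneg
  · filter_upwards [Ioo_mem_nhdsGT hρ₀] with r hr
    have hpos : 0 < m.real (Metric.ball x r) := by
      refine ENNReal.toReal_pos ?_ (measure_ne_top _ _)
      exact ((Measure.mem_support_iff_forall x).1 hxs _ (Metric.ball_mem_nhds x hr.1)).ne'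
    have hpos' : 0 < m.real (Metric.closedBall x r) := hpos.trans_le
      (measureReal_mono Metric.ball_subset_closedBall)
    have hdb : m.real (Metric.closedBall x r) ≤ D * m.real (Metric.ball x r) := by
      have : m (Metric.closedBall x r) ≤ D * m (Metric.ball x r) :=
        (measure_mono (Metric.closedBall_subset_ball (by linarith [hr.1]))).trans
          (hD x hxs r hr.1 hr.2)
      have h3 := ENNReal.toReal_mono (ENNReal.mul_ne_top ENNReal.coe_ne_top (measure_ne_top _ _))
        this
      rwa [ENNReal.toReal_mul, ENNReal.coe_toReal] at h3
    have hI : ∫ y in Metric.ball x r, |f y - f x| ∂m ≤ ∫ y in Metric.closedBall x r, |f y - f x| ∂m :=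
      setIntegral_mono_set hint.integrableOn (Eventually.of_forall fun _ => abs_nonneg _)
        Metric.ball_subset_closedBall.eventuallyLE
    have h0 : 0 ≤ ∫ y in Metric.closedBall x r, |f y - f x| ∂m :=
      integral_nonneg fun _ => abs_nonneg _
    simp only [Function.comp_apply, setAverage_eq, smul_eq_mul, Real.norm_eq_abs]
    rw [div_le_iff₀ hpos]
    calc _ ≤ ∫ y in Metric.closedBall x r, |f y - f x| ∂m := hI
      _ = m.real (Metric.closedBall x r) * ((m.real (Metric.closedBall x r))⁻¹ *
          ∫ y in Metric.closedBall x r, |f y - f x| ∂m) := by field_simp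
      _ ≤ (D * m.real (Metric.ball x r)) * ((m.real (Metric.closedBall x r))⁻¹ *
          ∫ y in Metric.closedBall x r, |f y - f x| ∂m) := by gcongr
      _ = _ := by ring

end Covering

/-- A choice of signs under which the off-diagonal terms of a quadratic form do not decrease it. -/
theorem exists_sign_sum_diag_le {α : Type*} [DecidableEq α] (s : Finset α) (I : α → α → ℝ) :
    ∃ σ : α → ℝ, (∀ i, σ i = 1 ∨ σ i = -1) ∧
      ∑ i ∈ s, I i i ≤ ∑ i ∈ s, ∑ j ∈ s, σ i * σ j * I i j := by
  induction s using Finset.induction_on with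
  | empty => exact ⟨fun _ => 1, fun _ => Or.inl rfl, by simp⟩
  | insert b s hb ih =>
    obtain ⟨σ, hσ, h⟩ := ih
    set X := ∑ i ∈ s, σ i * (I i b + I b i) with hX
    obtain ⟨e, he, heX⟩ : ∃ e : ℝ, (e = 1 ∨ e = -1) ∧ 0 ≤ e * X := by
      rcases le_total 0 X with h0 | h0
      · exact ⟨1, Or.inl rfl, by simpa using h0⟩
      · exact ⟨-1, Or.inr rfl, by simpa using h0⟩
    refine ⟨Function.update σ b e, fun i => ?_, ?_⟩
    · by_cases hi : i = b
      · subst hi; simpa using he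
      · simpa [hi] using hσ i
    · have hs : ∀ i ∈ s, Function.update σ b e i = σ i := fun i hi => by
        have : i ≠ b := fun h => hb (h ▸ hi)
        simp [this]
      have hee : e * e = 1 := by rcases he with rfl | rfl <;> norm_num
      have h1 : ∑ i ∈ insert b s, ∑ j ∈ insert b s,
          Function.update σ b e i * Function.update σ b e j * I i j
          = I b b + e * X + ∑ i ∈ s, ∑ j ∈ s, σ i * σ j * I i j := by
        rw [Finset.sum_insert hb, Finset.sum_insert hb]
        have h2 : ∑ i ∈ s, ∑ j ∈ insert b s,
            Function.update σ b e i * Function.update σ b e j * I i j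
            = ∑ i ∈ s, (σ i * e * I i b + ∑ j ∈ s, σ i * σ j * I i j) := by
          refine Finset.sum_congr rfl fun i hi => ?_
          rw [Finset.sum_insert hb, hs i hi, Function.update_self]
          congr 1
          exact Finset.sum_congr rfl fun j hj => by rw [hs j hj]
        have h3 : ∑ j ∈ s, Function.update σ b e b * Function.update σ b e j * I b j
            = ∑ j ∈ s, e * σ j * I b j :=
          Finset.sum_congr rfl fun j hj => by rw [hs j hj, Function.update_self]
        rw [h2, h3, Function.update_self, hee, Finset.sum_add_distrib, hX, Finset.mul_sum]
        have h4 : ∑ i ∈ s, e * (σ i * (I i b + I b i))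
            = ∑ i ∈ s, σ i * e * I i b + ∑ j ∈ s, e * σ j * I b j := by
          rw [← Finset.sum_add_distrib]
          exact Finset.sum_congr rfl fun i _ => by ring
        rw [h4]; ring
      rw [h1, Finset.sum_insert hb]
      linarith

section Ergodic

variable {X : Type*} [MeasurableSpace X] {P : Measure X} {S : X → X}

/-- The maximum of the ergodic sums of length at most `n`. -/
noncomputable def maxErgodicSum {X : Type*} (S : X → X) (g : X → ℝ) : ℕ → X → ℝ
  | 0, _ => 0
  | n + 1, x => max 0 (g x + maxErgodicSum S g n (S x))

theorem maxErgodicSum_nonneg {X : Type*} (S : X → X) (g : X → ℝ) (n : ℕ) (x : X) :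
    0 ≤ maxErgodicSum S g n x := by
  cases n with
  | zero => exact le_rfl
  | succ n => exact le_max_left _ _

theorem maxErgodicSum_le_succ {X : Type*} (S : X → X) (g : X → ℝ) (n : ℕ) (x : X) :
    maxErgodicSum S g n x ≤ maxErgodicSum S g (n + 1) x := by
  induction n generalizing x with
  | zero => exact maxErgodicSum_nonneg S g 1 x
  | succ n ih => exact max_le_max le_rfl (by linarith [ih (S x)])

theorem birkhoffSum_le_maxErgodicSum {X : Type*} (S : X → X) (g : X → ℝ) (n : ℕ) (x : X) :
    birkhoffSum S g n x ≤ maxErgodicSum S g n x := by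
  induction n generalizing x with
  | zero => simp [maxErgodicSum]
  | succ n ih =>
    rw [birkhoffSum_succ']
    exact (add_le_add le_rfl (ih (S x))).trans (le_max_right _ _)

theorem measurable_maxErgodicSum (hS : Measurable S) {g : X → ℝ} (hg : Measurable g) (n : ℕ) :
    Measurable (maxErgodicSum S g n) := by
  induction n with
  | zero => exact measurable_const
  | succ n ih => exact measurable_const.max (hg.add (ih.comp hS))

theorem integrable_maxErgodicSum (hS : MeasurePreserving S P P) {g : X → ℝ}
    (hg : Integrable g P) (n : ℕ) : Integrable (maxErgodicSum S g n) P := by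
  induction n with
  | zero => exact integrable_zero _ _ _
  | succ n ih => exact (integrable_zero _ _ _).sup (hg.add (hS.integrable_comp_of_integrable ih))

theorem maximal_ergodic_setIntegral_nonneg (hS : MeasurePreserving S P P) {g : X → ℝ}
    (hgm : Measurable g) (hg : Integrable g P) (n : ℕ) :
    0 ≤ ∫ x in {x | 0 < maxErgodicSum S g (n + 1) x}, g x ∂P := by
  set A := {x | 0 < maxErgodicSum S g (n + 1) x} with hA
  have hAm : MeasurableSet A :=
    measurableSet_lt measurable_const (measurable_maxErgodicSum hS.measurable hgm _)
  have hi := integrable_maxErgodicSum hS hg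
  have hiS : Integrable (fun x => maxErgodicSum S g n (S x)) P :=
    hS.integrable_comp_of_integrable (hi n)
  have h1 : ∫ x, maxErgodicSum S g (n + 1) x ∂P
      = ∫ x in A, maxErgodicSum S g (n + 1) x ∂P := by
    refine (setIntegral_eq_integral_of_forall_compl_eq_zero fun x hx => ?_).symm
    exact le_antisymm (not_lt.1 hx) (maxErgodicSum_nonneg _ _ _ _)
  have h2 : ∫ x in A, maxErgodicSum S g (n + 1) x ∂P
      = ∫ x in A, (g x + maxErgodicSum S g n (S x)) ∂P := by
    refine setIntegral_congr_fun hAm fun x hx => ?_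
    have hx' : 0 < max 0 (g x + maxErgodicSum S g n (S x)) := hx
    have : 0 < g x + maxErgodicSum S g n (S x) := by
      rcases lt_max_iff.1 hx' with h | h
      · exact absurd h (lt_irrefl _)
      · exact h
    exact max_eq_right this.le
  have h3 : ∫ x in A, (g x + maxErgodicSum S g n (S x)) ∂P
      = ∫ x in A, g x ∂P + ∫ x in A, maxErgodicSum S g n (S x) ∂P :=
    integral_add hg.integrableOn hiS.integrableOn
  have h4 : ∫ x in A, maxErgodicSum S g n (S x) ∂P ≤ ∫ x, maxErgodicSum S g n (S x) ∂P :=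
    setIntegral_le_integral hiS (Eventually.of_forall fun x => maxErgodicSum_nonneg _ _ _ _)
  have h5 : ∫ x, maxErgodicSum S g n (S x) ∂P = ∫ x, maxErgodicSum S g n x ∂P := by
    have := integral_map hS.measurable.aemeasurable
      (f := maxErgodicSum S g n) (μ := P)
      (measurable_maxErgodicSum hS.measurable hgm n).aestronglyMeasurable
    rw [hS.map_eq] at this
    exact this.symm
  have h6 : ∫ x, maxErgodicSum S g n x ∂P ≤ ∫ x, maxErgodicSum S g (n + 1) x ∂P :=
    integral_mono (hi n) (hi (n + 1)) (maxErgodicSum_le_succ S g n)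
  linarith

/-- The maximal ergodic inequality (weak type bound). -/
theorem maximal_ergodic_inequality [IsFiniteMeasure P] (hS : MeasurePreserving S P P) {f : X → ℝ}
    (hfm : Measurable f) (hf : Integrable f P) (hf0 : ∀ x, 0 ≤ f x) {s : ℝ} (hs : 0 < s) :
    P.real {x | ∃ N : ℕ, s * (N + 1) < birkhoffSum S f (N + 1) x} ≤ (∫ x, f x ∂P) / s := by
  set g : X → ℝ := fun x => f x - s with hg
  have hgm : Measurable g := hfm.sub_const s
  have hgi : Integrable g P := hf.sub (integrable_const s)
  set A : ℕ → Set X := fun n => {x | 0 < maxErgodicSum S g (n + 1) x} with hA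
  have hAm : ∀ n, MeasurableSet (A n) := fun n =>
    measurableSet_lt measurable_const (measurable_maxErgodicSum hS.measurable hgm _)
  have hmono : Monotone A := monotone_nat_of_le_succ fun n x hx =>
    lt_of_lt_of_le (show 0 < maxErgodicSum S g (n + 1) x from hx)
      (maxErgodicSum_le_succ S g (n + 1) x)
  have hbd : ∀ n, P.real (A n) ≤ (∫ x, f x ∂P) / s := by
    intro n
    have h0 := maximal_ergodic_setIntegral_nonneg hS hgm hgi n
    have h1 : ∫ x in A n, g x ∂P = ∫ x in A n, f x ∂P - P.real (A n) * s := by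
      rw [hg, integral_sub hf.integrableOn (integrable_const s), setIntegral_const, smul_eq_mul]
    have h2 : ∫ x in A n, f x ∂P ≤ ∫ x, f x ∂P :=
      setIntegral_le_integral hf (Eventually.of_forall hf0)
    rw [le_div_iff₀ hs]
    linarith [h1 ▸ h0]
  have hsub : {x | ∃ N : ℕ, s * (N + 1) < birkhoffSum S f (N + 1) x} ⊆ ⋃ n, A n := by
    rintro x ⟨N, hN⟩
    refine mem_iUnion.2 ⟨N, lt_of_lt_of_le ?_ (birkhoffSum_le_maxErgodicSum S g (N + 1) x)⟩
    have : birkhoffSum S g (N + 1) x = birkhoffSum S f (N + 1) x - (N + 1) * s := by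
      simp [birkhoffSum, hg, Finset.sum_sub_distrib]
    rw [this]; linarith
  have hlim : Tendsto (fun n => P.real (A n)) atTop (𝓝 (P.real (⋃ n, A n))) :=
    (ENNReal.tendsto_toReal (measure_ne_top _ _)).comp (tendsto_measure_iUnion_atTop hmono)
  exact (measureReal_mono hsub).trans (le_of_tendsto' hlim hbd)

theorem abs_birkhoffSum_le {Y : Type*} {S : Y → Y} {f : Y → ℝ} {K : ℝ} (hK : ∀ x, |f x| ≤ K)
    (n : ℕ) (x : Y) :
    |birkhoffSum S f n x| ≤ n * K := by
  rw [birkhoffSum]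
  refine (Finset.abs_sum_le_sum_abs _ _).trans ?_
  refine (Finset.sum_le_sum fun i _ => hK _).trans ?_
  simp

theorem abs_birkhoffAverage_le {Y : Type*} {S : Y → Y} {f : Y → ℝ} {K : ℝ} (hK : ∀ x, |f x| ≤ K)
    (n : ℕ) (x : Y) :
    |birkhoffAverage ℝ S f n x| ≤ K := by
  have hK0 : 0 ≤ K := (abs_nonneg _).trans (hK x)
  rcases Nat.eq_zero_or_pos n with rfl | hn
  · simpa using hK0
  have hn' : (0 : ℝ) < n := by exact_mod_cast hn
  rw [birkhoffAverage, smul_eq_mul, abs_mul, abs_of_pos (inv_pos.2 hn'), inv_mul_le_iff₀ hn']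
  exact abs_birkhoffSum_le hK n x

/-- Averaging a bounded function along the orbit changes its ergodic sums by a bounded amount. -/
theorem abs_birkhoffSum_birkhoffAverage_sub_le {Y : Type*} {S : Y → Y} {f : Y → ℝ} {K : ℝ}
    (hK : ∀ x, |f x| ≤ K) {m : ℕ} (hm : 0 < m) (N : ℕ) (x : Y) :
    |birkhoffSum S (birkhoffAverage ℝ S f m) N x - birkhoffSum S f N x| ≤ 2 * m * K := by
  have hm' : (0 : ℝ) < m := by exact_mod_cast hm
  have h1 : birkhoffSum S (birkhoffAverage ℝ S f m) N x
      = (m : ℝ)⁻¹ * ∑ k ∈ Finset.range m, birkhoffSum S f N (S^[k] x) := by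
    simp only [birkhoffSum, birkhoffAverage, smul_eq_mul]
    rw [← Finset.mul_sum, Finset.sum_comm]
    congr 1
    refine Finset.sum_congr rfl fun k _ => Finset.sum_congr rfl fun i _ => ?_
    rw [← Function.iterate_add_apply, ← Function.iterate_add_apply, add_comm]
  have h2 : ∀ k ∈ Finset.range m,
      |birkhoffSum S f N (S^[k] x) - birkhoffSum S f N x| ≤ 2 * m * K := by
    intro k hk
    have h3 : birkhoffSum S f N (S^[k] x) - birkhoffSum S f N x
        = birkhoffSum S f k (S^[N] x) - birkhoffSum S f k x := by
      have := birkhoffSum_add S f N k x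
      have h4 := birkhoffSum_add S f k N x
      rw [add_comm k N] at h4
      linarith
    have hK0 : 0 ≤ K := (abs_nonneg _).trans (hK x)
    have hkm : (k : ℝ) ≤ m := by exact_mod_cast (Finset.mem_range.1 hk).le
    have h5 := abs_birkhoffSum_le (S := S) hK k (S^[N] x)
    have h6 := abs_birkhoffSum_le (S := S) hK k x
    rw [h3]
    have h7 := abs_sub (birkhoffSum S f k (S^[N] x)) (birkhoffSum S f k x)
    nlinarith
  have h8 : birkhoffSum S (birkhoffAverage ℝ S f m) N x - birkhoffSum S f N x
      = (m : ℝ)⁻¹ * ∑ k ∈ Finset.range m, (birkhoffSum S f N (S^[k] x) - birkhoffSum S f N x) := by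
    rw [h1, Finset.sum_sub_distrib, Finset.sum_const, Finset.card_range, nsmul_eq_mul]
    field_simp
  rw [h8, abs_mul, abs_of_pos (inv_pos.2 hm'), inv_mul_le_iff₀ hm']
  refine (Finset.abs_sum_le_sum_abs _ _).trans ((Finset.sum_le_sum h2).trans ?_)
  simp

theorem measurable_birkhoffSum {f : X → ℝ} (hS : Measurable S) (hf : Measurable f) (n : ℕ) :
    Measurable (birkhoffSum S f n) :=
  Finset.measurable_sum _ fun i _ => hf.comp (hS.iterate i)

theorem measurable_birkhoffAverage {f : X → ℝ} (hS : Measurable S) (hf : Measurable f) (n : ℕ) :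
    Measurable (birkhoffAverage ℝ S f n) :=
  (measurable_birkhoffSum hS hf n).const_mul _

/-- Ergodic averages that converge in mean to a constant converge almost everywhere. -/
theorem ae_tendsto_birkhoffAverage [IsFiniteMeasure P] (hS : MeasurePreserving S P P)
    {f : X → ℝ} (hfm : Measurable f) {K : ℝ} (hK : ∀ x, |f x| ≤ K) (c : ℝ)
    (hL : Tendsto (fun n : ℕ => ∫ x, |birkhoffAverage ℝ S f n x - c| ∂P) atTop (𝓝 0)) :
    ∀ᵐ x ∂P, Tendsto (fun n : ℕ => birkhoffAverage ℝ S f n x) atTop (𝓝 c) := by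
  have key : ∀ s : ℝ, 0 < s →
      P.real {x | ∃ᶠ N : ℕ in atTop, 2 * s < |birkhoffAverage ℝ S f N x - c|} = 0 := by
    intro s hs
    refine le_antisymm ?_ measureReal_nonneg
    have hlim := hL.div_const s
    rw [zero_div] at hlim
    refine ge_of_tendsto hlim ?_
    filter_upwards [eventually_gt_atTop 0] with m hm
    set u : X → ℝ := fun x => |birkhoffAverage ℝ S f m x - c| with hu
    have hum : Measurable u :=
      ((measurable_birkhoffAverage hS.measurable hfm m).sub_const c).abs
    have hub : ∀ x, ‖u x‖ ≤ K + |c| := fun x => by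
      rw [hu, Real.norm_eq_abs, abs_abs]
      exact (abs_sub _ _).trans (add_le_add (abs_birkhoffAverage_le hK m x) le_rfl)
    have hui : Integrable u P := Integrable.of_bound hum.aestronglyMeasurable _
      (Eventually.of_forall hub)
    refine (measureReal_mono ?_).trans
      (maximal_ergodic_inequality hS hum hui (fun x => abs_nonneg _) hs)
    intro x hx
    have hev : ∀ᶠ N : ℕ in atTop, 2 * m * K / s < N :=
      tendsto_natCast_atTop_atTop.eventually_gt_atTop _
    obtain ⟨N, hN, hNs, hN0⟩ := (hx.and_eventually (hev.and (eventually_gt_atTop 0))).exists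
    obtain ⟨n, rfl⟩ : ∃ n, N = n + 1 := ⟨N - 1, by omega⟩
    refine ⟨n, ?_⟩
    have hNpos : (0 : ℝ) < ((n + 1 : ℕ) : ℝ) := by positivity
    have h1 := abs_birkhoffSum_birkhoffAverage_sub_le (S := S) hK hm (n + 1) x
    have h2 : 2 * m * K < s * ((n + 1 : ℕ) : ℝ) := by
      rw [div_lt_iff₀ hs] at hNs; linarith
    have h3 : 2 * s * ((n + 1 : ℕ) : ℝ) < |birkhoffSum S f (n + 1) x - ((n + 1 : ℕ) : ℝ) * c| := by
      have : birkhoffSum S f (n + 1) x - ((n + 1 : ℕ) : ℝ) * c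
          = ((n + 1 : ℕ) : ℝ) * (birkhoffAverage ℝ S f (n + 1) x - c) := by
        rw [birkhoffAverage, smul_eq_mul]; field_simp
      rw [this, abs_mul, abs_of_pos hNpos]
      nlinarith
    have h4 : |birkhoffSum S (birkhoffAverage ℝ S f m) (n + 1) x - ((n + 1 : ℕ) : ℝ) * c|
        ≤ birkhoffSum S u (n + 1) x := by
      have : birkhoffSum S (birkhoffAverage ℝ S f m) (n + 1) x - ((n + 1 : ℕ) : ℝ) * c
          = ∑ i ∈ Finset.range (n + 1), (birkhoffAverage ℝ S f m (S^[i] x) - c) := by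
        rw [Finset.sum_sub_distrib]; simp [birkhoffSum]
      rw [this]
      exact Finset.abs_sum_le_sum_abs _ _
    have h5 := abs_sub_abs_le_abs_sub (birkhoffSum S f (n + 1) x - ((n + 1 : ℕ) : ℝ) * c)
      (birkhoffSum S (birkhoffAverage ℝ S f m) (n + 1) x - ((n + 1 : ℕ) : ℝ) * c)
    rw [sub_sub_sub_cancel_right, abs_sub_comm (birkhoffSum S f (n + 1) x)
      (birkhoffSum S (birkhoffAverage ℝ S f m) (n + 1) x)] at h5
    push_cast at h2 h3 h4 h5 ⊢
    linarith
  have hall : ∀ᵐ x ∂P, ∀ j : ℕ,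
      ¬ ∃ᶠ N : ℕ in atTop, 2 * (1 / ((j : ℝ) + 1)) < |birkhoffAverage ℝ S f N x - c| := by
    refine ae_all_iff.2 fun j => ?_
    have h := key (1 / ((j : ℝ) + 1)) (by positivity)
    rw [measureReal_eq_zero_iff] at h
    rw [ae_iff]
    simpa only [not_not] using h
  filter_upwards [hall] with x hx
  rw [Metric.tendsto_atTop']
  intro ε hε
  obtain ⟨j, hj⟩ := exists_nat_one_div_lt (show 0 < ε / 2 by positivity)
  have h := not_frequently.1 (hx j)
  obtain ⟨N, hN⟩ := eventually_atTop.1 h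
  refine ⟨N, fun n hn => ?_⟩
  have := not_lt.1 (hN n hn.le)
  rw [Real.dist_eq]
  linarith

/-- Square-mean convergence of ergodic averages from decay of the autocovariances. -/
theorem tendsto_integral_sq_birkhoffAverage [IsProbabilityMeasure P] (hS : MeasurePreserving S P P)
    {f : X → ℝ} (hfm : Measurable f) {K : ℝ} (hK : ∀ x, |f x| ≤ K)
    (hcov : Tendsto (fun k : ℕ => ∫ x, f x * f (S^[k] x) ∂P) atTop (𝓝 ((∫ x, f x ∂P) ^ 2))) :
    Tendsto (fun n : ℕ => ∫ x, (birkhoffAverage ℝ S f n x - ∫ x, f x ∂P) ^ 2 ∂P) atTop (𝓝 0) := by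
  set c := ∫ x, f x ∂P with hc
  set Y : X → ℝ := fun x => f x - c with hY
  have hYm : Measurable Y := hfm.sub_const c
  have hYb : ∀ x, |Y x| ≤ K + |c| := fun x =>
    (abs_sub _ _).trans (add_le_add (hK x) le_rfl)
  have hbi : ∀ {g : X → ℝ} {L : ℝ}, Measurable g → (∀ x, |g x| ≤ L) → Integrable g P :=
    fun hg hL => Integrable.of_bound hg.aestronglyMeasurable _ (Eventually.of_forall hL)
  have hSk : ∀ k, Measurable (S^[k]) := hS.measurable.iterate
  have hint : ∀ k {g : X → ℝ}, Measurable g → ∫ x, g (S^[k] x) ∂P = ∫ x, g x ∂P := by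
    intro k g hg
    have h := integral_map (hSk k).aemeasurable (f := g) (μ := P) hg.aestronglyMeasurable
    rw [(hS.iterate k).map_eq] at h
    exact h.symm
  have hfi : Integrable f P := hbi hfm hK
  set C : ℕ → ℝ := fun k => ∫ x, Y x * Y (S^[k] x) ∂P with hC
  have hC0 : Tendsto C atTop (𝓝 0) := by
    have : ∀ k, C k = ∫ x, f x * f (S^[k] x) ∂P - c ^ 2 := by
      intro k
      have hfk : Integrable (fun x => f (S^[k] x)) P := hbi (hfm.comp (hSk k)) fun x => hK _
      have hffk : Integrable (fun x => f x * f (S^[k] x)) P := by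
        refine hbi (L := K * K) (hfm.mul (hfm.comp (hSk k))) fun x => ?_
        rw [abs_mul]
        exact mul_le_mul (hK _) (hK _) (abs_nonneg _) ((abs_nonneg _).trans (hK x))
      have h1 : ∀ x, Y x * Y (S^[k] x)
          = f x * f (S^[k] x) - c * f x - c * f (S^[k] x) + c ^ 2 := fun x => by
        simp only [hY]; ring
      simp only [hC, h1]
      have h2 : Integrable (fun x => f x * f (S^[k] x) - c * f x) P := hffk.sub (hfi.const_mul c)
      have h3 : Integrable (fun x => f x * f (S^[k] x) - c * f x - c * f (S^[k] x)) P :=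
        h2.sub (hfk.const_mul c)
      rw [integral_add h3 (integrable_const _), integral_sub h2 (hfk.const_mul c),
        integral_sub hffk (hfi.const_mul c), integral_const_mul, integral_const_mul, hint k hfm]
      simp only [integral_const, probReal_univ, one_smul, ← hc]
      ring
    have h2 := hcov.sub_const (c ^ 2)
    rw [sub_self] at h2
    exact h2.congr fun k => (this k).symm
  set e : ℕ → ℝ := fun n => C 0 + 2 * ∑ k ∈ Finset.range n, C (k + 1) with he
  set V : ℕ → ℝ := fun n => ∫ x, (birkhoffSum S Y n x) ^ 2 ∂P with hV
  have hTm : ∀ n, Measurable (birkhoffSum S Y n) := measurable_birkhoffSum hS.measurable hYm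
  have hTb : ∀ n x, |birkhoffSum S Y n x| ≤ n * (K + |c|) := abs_birkhoffSum_le hYb
  have hVs : ∀ n, V (n + 1) = V n + e n := by
    intro n
    have h1 : ∀ x, (birkhoffSum S Y (n + 1) x) ^ 2
        = Y x * Y x + 2 * (Y x * birkhoffSum S Y n (S x)) + (birkhoffSum S Y n (S x)) ^ 2 := by
      intro x; rw [birkhoffSum_succ']; ring
    have hm1 : Integrable (fun x => Y x * Y x) P := by
      refine hbi (L := (K + |c|) * (K + |c|)) (hYm.mul hYm) fun x => ?_
      rw [abs_mul]
      exact mul_le_mul (hYb _) (hYb _) (abs_nonneg _) ((abs_nonneg _).trans (hYb x))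
    have hYYk : ∀ k, Integrable (fun x => Y x * Y (S^[k] x)) P := fun k => by
      refine hbi (L := (K + |c|) * (K + |c|)) (hYm.mul (hYm.comp (hSk k))) fun x => ?_
      rw [abs_mul]
      exact mul_le_mul (hYb _) (hYb _) (abs_nonneg _) ((abs_nonneg _).trans (hYb x))
    have h2' : ∀ x, Y x * birkhoffSum S Y n (S x)
        = ∑ k ∈ Finset.range n, Y x * Y (S^[k + 1] x) := fun x => by
      rw [birkhoffSum, Finset.mul_sum]
      rfl
    have hm2 : Integrable (fun x => Y x * birkhoffSum S Y n (S x)) P := by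
      simp only [h2']
      exact integrable_finsetSum _ fun k _ => hYYk (k + 1)
    have hm3 : Integrable (fun x => (birkhoffSum S Y n (S x)) ^ 2) P := by
      refine hbi (L := (n * (K + |c|)) ^ 2) (((hTm n).comp hS.measurable).pow_const 2) fun x => ?_
      rw [abs_pow]
      exact pow_le_pow_left₀ (abs_nonneg _) (hTb n _) 2
    have h3 : ∫ x, Y x * birkhoffSum S Y n (S x) ∂P = ∑ k ∈ Finset.range n, C (k + 1) := by
      simp only [h2']
      exact integral_finsetSum _ fun k _ => hYYk (k + 1)
    have h4 : ∫ x, (birkhoffSum S Y n (S x)) ^ 2 ∂P = V n :=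
      hint 1 (g := fun x => (birkhoffSum S Y n x) ^ 2) ((hTm n).pow_const 2)
    have h5 : V (n + 1) = ∫ x, (Y x * Y x + 2 * (Y x * birkhoffSum S Y n (S x))
        + (birkhoffSum S Y n (S x)) ^ 2) ∂P := by simp only [hV, h1]
    have hm4 : Integrable (fun x => Y x * Y x + 2 * (Y x * birkhoffSum S Y n (S x))) P :=
      hm1.add (hm2.const_mul 2)
    rw [h5, integral_add hm4 hm3, integral_add hm1 (hm2.const_mul 2),
      integral_const_mul, h3, h4]
    have h6 : C 0 = ∫ x, Y x * Y x ∂P := rfl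
    rw [← h6]; simp only [he]; ring
  have hVn : ∀ n, V n = ∑ i ∈ Finset.range n, e i := by
    intro n
    induction n with
    | zero => simp [hV]
    | succ n ih => rw [hVs, ih, Finset.sum_range_succ]
  have hC1 : Tendsto (fun n : ℕ => (n : ℝ)⁻¹ * ∑ k ∈ Finset.range n, C (k + 1)) atTop (𝓝 0) :=
    ((tendsto_add_atTop_iff_nat 1).2 hC0).cesaro
  have hinv : Tendsto (fun n : ℕ => (n : ℝ)⁻¹) atTop (𝓝 0) := tendsto_inv_atTop_nhds_zero_nat
  have hen : Tendsto (fun n : ℕ => |e n| / ((n : ℝ) + 1)) atTop (𝓝 0) := by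
    have h1 : Tendsto (fun n : ℕ => (n : ℝ)⁻¹ * |C 0|
        + 2 * |(n : ℝ)⁻¹ * ∑ k ∈ Finset.range n, C (k + 1)|) atTop (𝓝 0) := by
      have := (hinv.mul_const |C 0|).add (hC1.abs.const_mul 2)
      simpa using this
    refine tendsto_of_tendsto_of_tendsto_of_le_of_le' tendsto_const_nhds h1
      (Eventually.of_forall fun n => by positivity) ?_
    filter_upwards [eventually_gt_atTop 0] with n hn
    have hn' : (0 : ℝ) < n := by exact_mod_cast hn
    have h2 : |e n| ≤ |C 0| + 2 * |∑ k ∈ Finset.range n, C (k + 1)| := by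
      refine (abs_add_le _ _).trans ?_
      rw [abs_mul, abs_two]
    rw [abs_mul, abs_of_pos (inv_pos.2 hn')]
    calc |e n| / ((n : ℝ) + 1) ≤ |e n| / n := by gcongr; linarith
      _ ≤ (|C 0| + 2 * |∑ k ∈ Finset.range n, C (k + 1)|) / n := by gcongr
      _ = _ := by ring
  have hces := hen.cesaro
  refine tendsto_of_tendsto_of_tendsto_of_le_of_le' tendsto_const_nhds hces
    (Eventually.of_forall fun n => integral_nonneg fun x => sq_nonneg _) ?_
  filter_upwards [eventually_gt_atTop 0] with n hn
  have hn' : (0 : ℝ) < n := by exact_mod_cast hn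
  have h1 : ∀ x, (birkhoffAverage ℝ S f n x - c) ^ 2
      = (n : ℝ)⁻¹ ^ 2 * (birkhoffSum S Y n x) ^ 2 := by
    intro x
    have : birkhoffSum S Y n x = birkhoffSum S f n x - n * c := by
      simp [birkhoffSum, hY, Finset.sum_sub_distrib]
    rw [this, birkhoffAverage, smul_eq_mul]
    field_simp
  simp only [h1]
  rw [integral_const_mul]
  change (n : ℝ)⁻¹ ^ 2 * V n ≤ _
  rw [hVn, pow_two, mul_assoc]
  refine mul_le_mul_of_nonneg_left ?_ (inv_nonneg.2 hn'.le)
  rw [Finset.mul_sum]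
  refine Finset.sum_le_sum fun i hi => ?_
  have hi' : (i : ℝ) + 1 ≤ n := by exact_mod_cast Finset.mem_range.1 hi
  calc (n : ℝ)⁻¹ * e i ≤ (n : ℝ)⁻¹ * |e i| := by gcongr; exact le_abs_self _
    _ = |e i| / n := by ring
    _ ≤ |e i| / ((i : ℝ) + 1) := by gcongr

end Ergodic

section Cocycle

variable {ι A M : Type*} [AddMonoidWithOne ι]

theorem shift_iterate_apply (n : ℕ) (ω : ι → A) (i : ι) : shift^[n] ω i = ω (i + n) := by
  induction n generalizing ω i with
  | zero => simp
  | succ n ih =>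
    rw [Function.iterate_succ_apply, ih]
    simp [shift, add_assoc]

theorem iter_add (T : A → M → M) (ω : ι → A) (m n : ℕ) (x : M) :
    iter T ω (m + n) x = iter T (shift^[m] ω) n (iter T ω m x) := by
  induction n with
  | zero => rfl
  | succ n ih =>
    rw [← add_assoc]
    simp only [iter, Function.comp_apply, ih]
    rw [← Function.iterate_add_apply, add_comm n m]

theorem iter_congr (T : A → M → M) {ω ω' : ι → A} {n : ℕ}
    (h : ∀ i < n, ω' (i : ι) = ω (i : ι)) : iter T ω' n = iter T ω n := by
  induction n with
  | zero => rfl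
  | succ n ih =>
    simp only [iter, fibreMap, shift_iterate_apply, zero_add]
    rw [ih fun i hi => h i (hi.trans (Nat.lt_succ_self n)), h n (Nat.lt_succ_self n)]

/-- A point fixed by `T_ω^j` is fixed by the cocycle along the repeated block. -/
theorem iter_repeat_fixed (T : A → M → M) {ω ω' : ι → A} {j m : ℕ}
    (h : ∀ i : ℕ, i < m * j → ω' (i : ι) = ω ((i % j : ℕ) : ι)) {x : M} (hx : iter T ω j x = x) :
    iter T ω' (m * j) x = x := by
  suffices H : ∀ l ≤ m, iter T ω' (l * j) x = x from H m le_rfl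
  intro l
  induction l with
  | zero => intro _; simp [iter]
  | succ l ih =>
    intro hl
    have h1 : iter T (shift^[l * j] ω') j = iter T ω j := by
      refine iter_congr T fun i hi => ?_
      rw [shift_iterate_apply, ← Nat.cast_add, h (i + l * j)]
      · rw [Nat.add_mul_mod_self_right, Nat.mod_eq_of_lt hi]
      · calc i + l * j < j + l * j := by omega
          _ = (l + 1) * j := by ring
          _ ≤ m * j := Nat.mul_le_mul_right j hl
    rw [Nat.succ_mul, iter_add, ih (by omega), h1, hx]

variable [MeasurableSpace A] [MeasurableSpace M]

theorem measurable_shift : Measurable (shift : (ι → A) → ι → A) :=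
  measurable_pi_lambda _ fun i => measurable_pi_apply (i + 1)

theorem measurable_iter {T : A → M → M} (hT : Measurable fun q : A × M => T q.1 q.2) (n : ℕ) :
    Measurable fun q : (ι → A) × M => iter T q.1 n q.2 := by
  induction n with
  | zero => exact measurable_snd
  | succ n ih =>
    have h1 : Measurable fun q : (ι → A) × M => (shift^[n] q.1) 0 :=
      (measurable_pi_apply 0).comp ((measurable_shift.iterate n).comp measurable_fst)
    exact hT.comp (h1.prodMk ih)

theorem measurable_iter_right {T : A → M → M} (hT : Measurable fun q : A × M => T q.1 q.2)
    (ω : ι → A) (n : ℕ) : Measurable (iter T ω n) :=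
  (measurable_iter hT n).comp measurable_prodMk_left

end Cocycle

namespace System

variable {ι A M U : Type*} [AddMonoidWithOne ι] [MeasurableSpace A]
    [MetricSpace M] [CompactSpace M] [MeasurableSpace M] [BorelSpace M]
    [MeasurableSpace U] (S : System ι A M U)

instance : IsProbabilityMeasure S.ν := S.prob_ν

instance : IsMarkovKernel S.μf := S.prob_μf

instance : IsProbabilityMeasure S.μ := by
  refine ⟨?_⟩
  rw [μ, Measure.bind_apply MeasurableSet.univ S.μf.measurable.aemeasurable]
  simp

theorem measurable_T_iter (ω : ι → A) (n : ℕ) : Measurable (iter S.T ω n) :=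
  measurable_iter_right S.meas_T ω n

theorem ae_shift_iterate {p : (ι → A) → Prop} (hp : ∀ᵐ ω ∂S.ν, p ω) :
    ∀ᵐ ω ∂S.ν, ∀ k : ℕ, p (shift^[k] ω) :=
  ae_all_iff.2 fun k => (S.inv_ν.iterate k).quasiMeasurePreserving.ae hp

theorem shift_iterate_good {ω : ι → A} (hω : ω ∈ S.good) (k : ℕ) : shift^[k] ω ∈ S.good := by
  induction k with
  | zero => exact hω
  | succ k ih => rw [Function.iterate_succ_apply']; exact S.shift_good _ ih

theorem exists_good : ∃ ω, ω ∈ S.good := S.ae_good.exists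

/-- Invariance of the fibre measures along the whole orbit of `ω`. -/
def InvariantAlong (ω : ι → A) : Prop :=
  ∀ k : ℕ, (S.μf (shift^[k] ω)).map (fibreMap S.T (shift^[k] ω)) = S.μf (shift^[k + 1] ω)

theorem ae_invariantAlong : ∀ᵐ ω ∂S.ν, S.InvariantAlong ω := by
  filter_upwards [S.ae_shift_iterate S.inv_μf] with ω hω k
  rw [Function.iterate_succ_apply']
  exact hω k

variable {S} in
theorem InvariantAlong.shift_iterate {ω : ι → A} (h : S.InvariantAlong ω) (k : ℕ) :
    S.InvariantAlong (shift^[k] ω) := by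
  intro l
  have := h (l + k)
  rwa [← Function.iterate_add_apply, ← Function.iterate_add_apply, add_right_comm]

variable {S} in
theorem InvariantAlong.map_iter {ω : ι → A} (h : S.InvariantAlong ω) (n : ℕ) :
    (S.μf ω).map (iter S.T ω n) = S.μf (shift^[n] ω) := by
  induction n with
  | zero => exact Measure.map_id
  | succ n ih =>
    have h1 : Measurable (fibreMap S.T (shift^[n] ω)) := S.meas_T.comp measurable_prodMk_left
    rw [iter, ← Measure.map_map h1 (S.measurable_T_iter ω n), ih, h n]

variable {S} in
theorem InvariantAlong.integral_comp_iter {ω : ι → A} (h : S.InvariantAlong ω) (n : ℕ)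
    {f : M → ℝ} (hf : Measurable f) :
    ∫ x, f (iter S.T ω n x) ∂(S.μf ω) = ∫ x, f x ∂(S.μf (shift^[n] ω)) := by
  rw [← h.map_iter n, integral_map (S.measurable_T_iter ω n).aemeasurable hf.aestronglyMeasurable]

variable {S} in
theorem InvariantAlong.measureReal_preimage {ω : ι → A} (h : S.InvariantAlong ω) (n : ℕ)
    {E : Set M} (hE : MeasurableSet E) :
    (S.μf ω).real (iter S.T ω n ⁻¹' E) = (S.μf (shift^[n] ω)).real E := by
  rw [← h.map_iter n, measureReal_def, measureReal_def,
    Measure.map_apply (S.measurable_T_iter ω n) hE]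

theorem measurable_μf_real {E : Set M} (hE : MeasurableSet E) :
    Measurable fun ω => (S.μf ω).real E :=
  (S.μf.measurable_coe hE).ennreal_toReal

theorem integrable_μf_real {E : Set M} (hE : MeasurableSet E) :
    Integrable (fun ω => (S.μf ω).real E) S.ν := by
  refine Integrable.of_bound (S.measurable_μf_real hE).aestronglyMeasurable 1
    (Eventually.of_forall fun ω => ?_)
  rw [Real.norm_eq_abs, abs_of_nonneg measureReal_nonneg]
  exact measureReal_le_one

theorem μ_real_eq {E : Set M} (hE : MeasurableSet E) :
    S.μ.real E = ∫ ω, (S.μf ω).real E ∂S.ν := by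
  rw [measureReal_def, μ, Measure.bind_apply hE S.μf.measurable.aemeasurable]
  simp only [measureReal_def]
  rw [integral_toReal (S.μf.measurable_coe hE).aemeasurable
    (Eventually.of_forall fun ω => measure_lt_top _ _)]

theorem μ_real_le_of_ae {E : Set M} (hE : MeasurableSet E) {c : ℝ}
    (h : ∀ᵐ ω ∂S.ν, (S.μf ω).real E ≤ c) : S.μ.real E ≤ c := by
  rw [S.μ_real_eq hE]
  calc ∫ ω, (S.μf ω).real E ∂S.ν ≤ ∫ _, c ∂S.ν :=
        integral_mono_ae (S.integrable_μf_real hE) (integrable_const c) h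
    _ = c := by simp

theorem measurableSet_support : MeasurableSet S.μ.support :=
  Measure.isClosed_support.measurableSet

theorem ae_fibre_of_ae_μ {p : M → Prop} (hp : ∀ᵐ x ∂S.μ, p x) :
    ∀ᵐ ω ∂S.ν, ∀ᵐ x ∂(S.μf ω), p x :=
  Measure.ae_ae_of_ae_bind S.μf.measurable.aemeasurable hp

variable {S}

theorem μ_ball_pos {x : M} (hx : x ∈ S.μ.support) {ρ : ℝ} (hρ : 0 < ρ) :
    0 < S.μ.real (Metric.ball x ρ) :=
  ENNReal.toReal_pos ((Measure.mem_support_iff_forall x).1 hx _ (Metric.ball_mem_nhds x hρ)).ne'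
    (measure_ne_top _ _)

/-- The annulus condition passes to the marginal. -/
theorem AnnulusCondition.marginal {ξ β : ℝ} (h : S.AnnulusCondition ξ β) :
    ∃ C ρ₀ : ℝ, 0 < C ∧ 0 < ρ₀ ∧ ∀ x ∈ S.μ.support, ∀ ρ r : ℝ, 0 < r → r < ρ → ρ < ρ₀ →
      S.μ.real (Metric.ball x (ρ + r) \ Metric.ball x (ρ - r))
        ≤ C * (r ^ ξ / ρ ^ β) * S.μ.real (Metric.ball x ρ) := by
  obtain ⟨C, ρ₀, hρ₀, h⟩ := h
  refine ⟨|C| + 1, ρ₀, by positivity, hρ₀, fun x hx ρ r hr hrρ hρ => ?_⟩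
  refine S.μ_real_le_of_ae (Metric.isOpen_ball.measurableSet.diff Metric.isOpen_ball.measurableSet) ?_
  filter_upwards [h] with ω hω
  refine (hω x hx ρ r hr hrρ hρ).trans ?_
  have hρ' : 0 < ρ := hr.trans hrρ
  gcongr
  linarith [le_abs_self C]

/-- The marginal is doubling on its support. -/
theorem AnnulusCondition.doubling {ξ β : ℝ} (h : S.AnnulusCondition ξ β) (hβ : 0 < β) (hξ : β ≤ ξ) :
    ∃ (D : ℝ≥0) (ρ₀ : ℝ), 1 ≤ D ∧ 0 < ρ₀ ∧ ∀ x ∈ S.μ.support, ∀ ρ : ℝ, 0 < ρ → ρ < ρ₀ →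
      S.μ (Metric.ball x (4 * ρ)) ≤ D * S.μ (Metric.ball x ρ) := by
  obtain ⟨C, ρ₀, hC, hρ₀, h⟩ := h.marginal
  have step : ∀ x ∈ S.μ.support, ∀ ρ : ℝ, 0 < ρ → ρ < min ρ₀ 1 →
      S.μ.real (Metric.ball x (3 / 2 * ρ)) ≤ (1 + C) * S.μ.real (Metric.ball x ρ) := by
    intro x hx ρ hρ hρ1
    have h1 := h x hx ρ (ρ / 2) (by positivity) (by linarith) (hρ1.trans_le (min_le_left _ _))
    have hρle : ρ ≤ 1 := (hρ1.trans_le (min_le_right _ _)).le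
    have h2 : (ρ / 2) ^ ξ / ρ ^ β ≤ 1 := by
      rw [div_le_one (Real.rpow_pos_of_pos hρ _)]
      calc (ρ / 2) ^ ξ ≤ ρ ^ ξ := Real.rpow_le_rpow (by positivity) (by linarith) (by linarith)
        _ ≤ ρ ^ β := Real.rpow_le_rpow_of_exponent_ge hρ hρle hξ
    have h3 : S.μ.real (Metric.ball x (3 / 2 * ρ)) ≤ S.μ.real (Metric.ball x ρ)
        + S.μ.real (Metric.ball x (ρ + ρ / 2) \ Metric.ball x (ρ - ρ / 2)) := by
      refine (measureReal_mono ?_).trans (measureReal_union_le _ _)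
      intro y hy
      by_cases hyρ : y ∈ Metric.ball x ρ
      · exact Or.inl hyρ
      · refine Or.inr ⟨?_, fun hy' => hyρ (Metric.ball_subset_ball (by linarith) hy')⟩
        convert hy using 2; ring
    have h4 : C * ((ρ / 2) ^ ξ / ρ ^ β) * S.μ.real (Metric.ball x ρ)
        ≤ C * S.μ.real (Metric.ball x ρ) := by
      refine mul_le_mul_of_nonneg_right ?_ measureReal_nonneg
      nlinarith
    linarith
  have hC1 : 0 ≤ 1 + C := by linarith
  refine ⟨Real.toNNReal ((1 + C) ^ 4), min ρ₀ 1 / 8, ?_, ?_, fun x hx ρ hρ hρ1 => ?_⟩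
  · rw [Real.one_le_toNNReal]
    exact one_le_pow₀ (by linarith)
  · have : 0 < min ρ₀ 1 := lt_min hρ₀ one_pos
    positivity
  · have h1 := step x hx ρ hρ (by linarith)
    have h2 := step x hx (3 / 2 * ρ) (by linarith) (by linarith)
    have h3 := step x hx (3 / 2 * (3 / 2 * ρ)) (by linarith) (by linarith)
    have h4 := step x hx (3 / 2 * (3 / 2 * (3 / 2 * ρ))) (by linarith) (by linarith)
    have h5 : S.μ.real (Metric.ball x (4 * ρ))
        ≤ S.μ.real (Metric.ball x (3 / 2 * (3 / 2 * (3 / 2 * (3 / 2 * ρ))))) :=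
      measureReal_mono (Metric.ball_subset_ball (by linarith))
    have h6 : S.μ.real (Metric.ball x (4 * ρ)) ≤ (1 + C) ^ 4 * S.μ.real (Metric.ball x ρ) := by
      calc _ ≤ _ := h5
        _ ≤ (1 + C) * ((1 + C) * ((1 + C) * ((1 + C) * S.μ.real (Metric.ball x ρ)))) := by
            refine h4.trans (mul_le_mul_of_nonneg_left (h3.trans (mul_le_mul_of_nonneg_left
              (h2.trans (mul_le_mul_of_nonneg_left h1 hC1)) hC1)) hC1)
        _ = _ := by ring
    rw [← ENNReal.toReal_le_toReal (measure_ne_top _ _)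
      (ENNReal.mul_ne_top ENNReal.coe_ne_top (measure_ne_top _ _)), ENNReal.toReal_mul,
      ENNReal.coe_toReal, Real.coe_toNNReal _ (by positivity)]
    exact h6

/-- The annulus condition forces its two exponents to coincide. -/
theorem AnnulusCondition.exponents_eq {ξ β d₀ d₁ : ℝ} (h : S.AnnulusCondition ξ β)
    (hξ : β ≤ ξ) (hd₀ : 0 < d₀) (hdim : S.DimensionBounds d₀ d₁) : ξ = β := by
  by_contra hne
  have hlt : 0 < ξ - β := sub_pos.2 (lt_of_le_of_ne hξ (Ne.symm hne))
  obtain ⟨C, ρ₀, hC, hρ₀, h⟩ := h.marginal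
  obtain ⟨ρ₁, hρ₁, hdim⟩ := hdim
  obtain ⟨x, hx⟩ : S.μ.support.Nonempty :=
    Measure.nonempty_support (IsProbabilityMeasure.ne_zero S.μ)
  have key : ∀ ρ ∈ Ioo 0 (min ρ₀ ρ₁), 1 ≤ C * ρ ^ (ξ - β) := by
    intro ρ hρ
    have hρ0 : 0 < ρ := hρ.1
    have hpos := μ_ball_pos hx hρ0
    have hlim1 : Tendsto (fun r : ℝ => C * (r ^ ξ / ρ ^ β) * S.μ.real (Metric.ball x ρ)
        + (ρ - r) ^ d₀) (𝓝[<] ρ) (𝓝 (C * (ρ ^ ξ / ρ ^ β) * S.μ.real (Metric.ball x ρ) + 0)) := by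
      refine Tendsto.mono_left ?_ nhdsWithin_le_nhds
      refine Tendsto.add (Tendsto.mul_const _ (Tendsto.const_mul _ (Tendsto.div_const ?_ _))) ?_
      · exact (Real.continuousAt_rpow_const _ _ (Or.inl hρ0.ne')).tendsto
      · have h1 : Tendsto (fun r : ℝ => ρ - r) (𝓝 ρ) (𝓝 0) := by
          have : Tendsto (fun r : ℝ => ρ - r) (𝓝 ρ) (𝓝 (ρ - ρ)) := tendsto_const_nhds.sub tendsto_id
          rwa [sub_self] at this
        have h2 := (Real.continuousAt_rpow_const 0 d₀ (Or.inr hd₀.le)).tendsto.comp h1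
        rwa [Real.zero_rpow hd₀.ne'] at h2
    have h3 : S.μ.real (Metric.ball x ρ)
        ≤ C * (ρ ^ ξ / ρ ^ β) * S.μ.real (Metric.ball x ρ) + 0 := by
      refine ge_of_tendsto hlim1 ?_
      filter_upwards [Ioo_mem_nhdsLT hρ0] with r hr
      have h4 := h x hx ρ r hr.1 hr.2 (hρ.2.trans_le (min_le_left _ _))
      have h5 := (hdim x hx (ρ - r) (by linarith [hr.2])
        (by linarith [hr.1, hρ.2.trans_le (min_le_right ρ₀ ρ₁)])).2
      have h6 : S.μ.real (Metric.ball x ρ)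
          ≤ S.μ.real (Metric.ball x (ρ + r) \ Metric.ball x (ρ - r))
            + S.μ.real (Metric.ball x (ρ - r)) := by
        refine (measureReal_mono ?_).trans (measureReal_union_le _ _)
        intro y hy
        by_cases hy' : y ∈ Metric.ball x (ρ - r)
        · exact Or.inr hy'
        · exact Or.inl ⟨Metric.ball_subset_ball (by linarith [hr.1]) hy, hy'⟩
      linarith
    rw [Real.rpow_sub hρ0]
    rw [add_zero] at h3
    by_contra hcon
    push Not at hcon
    nlinarith
  have hlim : Tendsto (fun ρ : ℝ => C * ρ ^ (ξ - β)) (𝓝[>] 0) (𝓝 (C * 0)) := by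
    refine Tendsto.const_mul _ (Tendsto.mono_left ?_ nhdsWithin_le_nhds)
    have := (Real.continuousAt_rpow_const 0 (ξ - β) (Or.inr hlt.le)).tendsto
    rwa [Real.zero_rpow hlt.ne'] at this
  rw [mul_zero] at hlim
  have : (1 : ℝ) ≤ 0 := by
    refine ge_of_tendsto hlim ?_
    filter_upwards [Ioo_mem_nhdsGT (lt_min hρ₀ hρ₁)] with ρ hρ using key ρ hρ
  linarith

/-- The fibre measures and the marginal dominate each other. -/
theorem Comparable.domination (h : S.Comparable) {D : ℝ≥0} {ρ₀ : ℝ} (hρ₀ : 0 < ρ₀)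
    (hD : ∀ x ∈ S.μ.support, ∀ ρ : ℝ, 0 < ρ → ρ < ρ₀ →
      S.μ (Metric.ball x (4 * ρ)) ≤ D * S.μ (Metric.ball x ρ)) :
    ∃ K : ℝ≥0, 0 < K ∧ (∀ ω ∈ S.good, ∀ E, S.μ E ≤ K * S.μf ω E) ∧
      ∀ᵐ ω ∂S.ν, ∀ E, S.μf ω E ≤ K * S.μ E := by
  obtain ⟨K, ρ₁, hK, hρ₁, h⟩ := h
  have hup : ∀ ω ∈ S.good, ∀ x ∈ S.μ.support, ∀ ρ : ℝ, 0 < ρ → ρ < ρ₁ →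
      S.μf ω (Metric.ball x ρ) ≤ K.toNNReal * S.μ (Metric.ball x ρ) := by
    intro ω hω x hx ρ hρ hρ'
    have h1 := (h ω hω x hx ρ hρ hρ').1
    rw [inv_mul_le_iff₀ hK] at h1
    rw [← ENNReal.toReal_le_toReal (measure_ne_top _ _)
      (ENNReal.mul_ne_top ENNReal.coe_ne_top (measure_ne_top _ _)), ENNReal.toReal_mul,
      ENNReal.coe_toReal, Real.coe_toNNReal _ hK.le]
    exact h1
  have hlo : ∀ ω ∈ S.good, ∀ x ∈ S.μ.support, ∀ ρ : ℝ, 0 < ρ → ρ < ρ₁ →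
      S.μ (Metric.ball x ρ) ≤ K.toNNReal * S.μf ω (Metric.ball x ρ) := by
    intro ω hω x hx ρ hρ hρ'
    have h1 := (h ω hω x hx ρ hρ hρ').2
    rw [← ENNReal.toReal_le_toReal (measure_ne_top _ _)
      (ENNReal.mul_ne_top ENNReal.coe_ne_top (measure_ne_top _ _)), ENNReal.toReal_mul,
      ENNReal.coe_toReal, Real.coe_toNNReal _ hK.le]
    exact h1
  have hr : 0 < min ρ₀ (ρ₁ / 4) := lt_min hρ₀ (by positivity)
  have hle1 : ∀ {ρ : ℝ}, ρ < min ρ₀ (ρ₁ / 4) → ρ < ρ₀ ∧ 4 * ρ < ρ₁ := fun hρ =>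
    ⟨hρ.trans_le (min_le_left _ _), by linarith [hρ.trans_le (min_le_right ρ₀ (ρ₁ / 4))]⟩
  refine ⟨K.toNNReal * D + 1, by positivity, fun ω hω E => ?_, ?_⟩
  · refine (measure_le_of_ball_le (m₁ := S.μ) (m₂ := S.μf ω) (C := K.toNNReal * D)
      S.measurableSet_support Measure.measure_compl_support (by finiteness) hr ?_ E).trans ?_
    · intro x hx ρ hρ hρ'
      calc S.μ (Metric.ball x (4 * ρ)) ≤ D * S.μ (Metric.ball x ρ) := hD x hx ρ hρ (hle1 hρ').1
        _ ≤ D * (K.toNNReal * S.μf ω (Metric.ball x ρ)) := by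
            gcongr; exact hlo ω hω x hx ρ hρ (by linarith [(hle1 hρ').2])
        _ = _ := by ring
    · push_cast
      gcongr
      exact le_self_add
  · filter_upwards [S.ae_good, S.ae_fibre_of_ae_μ (Measure.support_mem_ae (μ := S.μ))]
      with ω hω hsupp E
    refine (measure_le_of_ball_le (m₁ := S.μf ω) (m₂ := S.μ) (C := K.toNNReal * D)
      S.measurableSet_support hsupp (by finiteness) hr ?_ E).trans ?_
    · intro x hx ρ hρ hρ'
      calc S.μf ω (Metric.ball x (4 * ρ)) ≤ K.toNNReal * S.μ (Metric.ball x (4 * ρ)) :=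
            hup ω hω x hx (4 * ρ) (by positivity) (hle1 hρ').2
        _ ≤ K.toNNReal * (D * S.μ (Metric.ball x ρ)) := by
            gcongr; exact hD x hx ρ hρ (hle1 hρ').1
        _ = _ := by ring
    · push_cast
      gcongr
      exact le_self_add

/-- A ball meeting the leaf in positive measure is small for the leaf measure. -/
theorem LeafBound.leaf_ball {u₀ : ℝ} (h : S.LeafBound u₀) :
    ∃ C ρ₀ : ℝ, 0 < C ∧ 0 < ρ₀ ∧ ∀ ω ∈ S.good, ∀ a, ∀ E : Set M, ∀ ρ : ℝ, 0 < ρ → ρ < ρ₀ →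
      (∀ y ∈ E, ∀ z ∈ E, dist y z < ρ) → S.μu ω a E ≤ ENNReal.ofReal (C * ρ ^ u₀) := by
  obtain ⟨C, ρ₀, hρ₀, h⟩ := h
  refine ⟨|C| + 1, ρ₀, by positivity, hρ₀, fun ω hω a E ρ hρ hρ' hE => ?_⟩
  have := S.prob_μu ω hω
  by_cases h0 : S.μu ω a E = 0
  · rw [h0]; exact zero_le
  obtain ⟨y, hyE, hy⟩ : ∃ y ∈ E, ∀ ρ : ℝ, 0 < ρ → ρ < ρ₀ →
      (S.μu ω a).real (Metric.ball y ρ) ≤ C * ρ ^ u₀ := by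
    by_contra hcon
    push Not at hcon
    refine h0 (measure_mono_null ?_ (ae_iff.1 (h ω hω a)))
    intro y hy
    obtain ⟨r, hr⟩ := hcon y hy
    simp only [mem_ofPred_eq, not_forall, not_le]
    exact ⟨r, hr.1, hr.2.1, hr.2.2⟩
  calc S.μu ω a E ≤ S.μu ω a (Metric.ball y ρ) := measure_mono fun z hz => hE z hz y hyE
    _ = ENNReal.ofReal ((S.μu ω a).real (Metric.ball y ρ)) :=
        (ENNReal.ofReal_toReal (measure_ne_top _ _)).symm
    _ ≤ ENNReal.ofReal ((|C| + 1) * ρ ^ u₀) := by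
        refine ENNReal.ofReal_le_ofReal ((hy ρ hρ hρ').trans ?_)
        have := Real.rpow_nonneg hρ.le u₀
        gcongr
        linarith [le_abs_self C]

/-- The marginal of a ball is bounded by a power of the radius. -/
theorem LeafBound.ball_le {u₀ : ℝ} (h : S.LeafBound u₀) {K : ℝ≥0}
    (hK : ∀ ω ∈ S.good, ∀ E, S.μ E ≤ K * S.μf ω E) :
    ∃ C ρ₀ : ℝ, 0 < C ∧ 0 < ρ₀ ∧ ∀ x, ∀ ρ : ℝ, 0 < ρ → ρ < ρ₀ →
      S.μ.real (Metric.ball x ρ) ≤ C * ρ ^ u₀ := by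
  obtain ⟨C, ρ₀, hC, hρ₀, h⟩ := h.leaf_ball
  obtain ⟨ω, hω⟩ := S.exists_good
  have := S.prob_μu ω hω
  have := S.prob_υ ω hω
  refine ⟨(K + 1) * (C * 2 ^ u₀), ρ₀ / 2, by positivity, by positivity, fun x ρ hρ hρ' => ?_⟩
  have h1 : S.μf ω (Metric.ball x ρ) ≤ ENNReal.ofReal (C * (2 * ρ) ^ u₀) := by
    rw [S.decomp ω hω, Measure.bind_apply Metric.isOpen_ball.measurableSet
      (S.μu ω).measurable.aemeasurable]
    calc ∫⁻ a, S.μu ω a (Metric.ball x ρ) ∂(S.υ ω)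
        ≤ ∫⁻ _, ENNReal.ofReal (C * (2 * ρ) ^ u₀) ∂(S.υ ω) := by
          refine lintegral_mono fun a => h ω hω a _ (2 * ρ) (by positivity) (by linarith) ?_
          intro y hy z hz
          have := dist_triangle_right y z x
          rw [Metric.mem_ball] at hy hz
          linarith
      _ = _ := by simp
  have hnn : 0 ≤ C * (2 * ρ) ^ u₀ := by positivity
  have h2 : S.μ (Metric.ball x ρ) ≤ ENNReal.ofReal (K * (C * (2 * ρ) ^ u₀)) := by
    rw [ENNReal.ofReal_mul (NNReal.coe_nonneg K), ENNReal.ofReal_coe_nnreal]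
    exact (hK ω hω _).trans (by gcongr)
  have h3 := ENNReal.toReal_mono ENNReal.ofReal_ne_top h2
  rw [ENNReal.toReal_ofReal (by positivity)] at h3
  refine h3.trans ?_
  rw [Real.mul_rpow (by norm_num) hρ.le]
  have : 0 ≤ C * 2 ^ u₀ * ρ ^ u₀ := by positivity
  nlinarith

theorem DimensionBounds.exponent_le {d₀ d₁ u₀ : ℝ} (hdim : S.DimensionBounds d₀ d₁) {C ρ₀ : ℝ}
    (hρ₀ : 0 < ρ₀) (h : ∀ x, ∀ ρ : ℝ, 0 < ρ → ρ < ρ₀ →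
      S.μ.real (Metric.ball x ρ) ≤ C * ρ ^ u₀) : u₀ ≤ d₁ := by
  by_contra hlt
  push Not at hlt
  obtain ⟨ρ₁, hρ₁, hdim⟩ := hdim
  obtain ⟨x, hx⟩ : S.μ.support.Nonempty :=
    Measure.nonempty_support (IsProbabilityMeasure.ne_zero S.μ)
  have hlim : Tendsto (fun ρ : ℝ => C * ρ ^ (u₀ - d₁)) (𝓝[>] 0) (𝓝 (C * 0)) := by
    refine Tendsto.const_mul _ (Tendsto.mono_left ?_ nhdsWithin_le_nhds)
    have := (Real.continuousAt_rpow_const 0 (u₀ - d₁) (Or.inr (by linarith))).tendsto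
    rwa [Real.zero_rpow (by linarith)] at this
  rw [mul_zero] at hlim
  have : (1 : ℝ) ≤ 0 := by
    refine ge_of_tendsto hlim ?_
    filter_upwards [Ioo_mem_nhdsGT (lt_min hρ₀ hρ₁)] with ρ hρ
    have h1 := (hdim x hx ρ hρ.1 (hρ.2.trans_le (min_le_right _ _))).1
    have h2 := h x ρ hρ.1 (hρ.2.trans_le (min_le_left _ _))
    have h3 : 0 < ρ ^ d₁ := Real.rpow_pos_of_pos hρ.1 _
    rw [Real.rpow_sub hρ.1, ← mul_div_assoc, le_div_iff₀ h3]
    linarith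
  linarith

end System

theorem PolyDecay.exists_bound {f : ℕ → ℝ} {q : ℝ} (h : PolyDecay f q) :
    ∃ C : ℝ, 0 < C ∧ ∀ n : ℕ, 1 ≤ n → |f n| ≤ C * (n : ℝ) ^ (-q) := by
  obtain ⟨C, hC, hb⟩ := bound_of_isBigO_nat_atTop h
  refine ⟨C, hC, fun n hn => ?_⟩
  have hpos : (0 : ℝ) < (n : ℝ) ^ (-q) := Real.rpow_pos_of_pos (by exact_mod_cast hn) _
  have := hb hpos.ne'
  rwa [Real.norm_eq_abs, Real.norm_eq_abs, abs_of_pos hpos] at this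

theorem tendsto_const_mul_natCast_rpow_neg (C : ℝ) {q : ℝ} (hq : 0 < q) :
    Tendsto (fun n : ℕ => C * (n : ℝ) ^ (-q)) atTop (𝓝 0) := by
  have := ((tendsto_rpow_neg_atTop hq).comp tendsto_natCast_atTop_atTop).const_mul C
  simpa using this

/-- The measures of a family of sets of bounded overlap are summable. -/
theorem tsum_measure_le_of_overlap {X : Type*} [MeasurableSpace X] (m : Measure X)
    [IsProbabilityMeasure m] {𝒵 : Set (Set X)} (hm : ∀ ζ ∈ 𝒵, MeasurableSet ζ) {L : ℕ}
    (hL : ∀ ζ ∈ 𝒵, {ζ' | ζ' ∈ 𝒵 ∧ (ζ ∩ ζ').Nonempty}.encard ≤ L) :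
    ∑' ζ : 𝒵, m ζ ≤ L := by
  rw [ENNReal.tsum_eq_iSup_sum]
  refine iSup_le fun F => ?_
  have h1 : ∑ ζ ∈ F, m ζ = ∫⁻ x, ∑ ζ ∈ F, (ζ : Set X).indicator (fun _ => (1 : ℝ≥0∞)) x ∂m := by
    rw [lintegral_finsetSum _ fun (ζ : 𝒵) _ => measurable_const.indicator (hm ζ ζ.2)]
    refine Finset.sum_congr rfl fun ζ _ => ?_
    rw [lintegral_indicator (hm ζ ζ.2)]
    simp
  rw [h1]
  calc ∫⁻ x, ∑ ζ ∈ F, (ζ : Set X).indicator (fun _ => (1 : ℝ≥0∞)) x ∂m ≤ ∫⁻ _, (L : ℝ≥0∞) ∂m := by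
        refine lintegral_mono fun x => ?_
        classical
        have h2 : ∑ ζ ∈ F, (ζ : Set X).indicator (fun _ => (1 : ℝ≥0∞)) x
            = ((F.filter fun ζ : 𝒵 => x ∈ (ζ : Set X)).card : ℝ≥0∞) := by
          rw [Finset.card_filter]
          push_cast
          refine Finset.sum_congr rfl fun ζ _ => ?_
          simp [Set.indicator_apply]
        rw [h2]
        rcases (F.filter fun ζ : 𝒵 => x ∈ (ζ : Set X)).eq_empty_or_nonempty with h0 | ⟨ζ₀, hζ₀⟩
        · simp [h0]
        have hx0 : x ∈ (ζ₀ : Set X) := (Finset.mem_filter.1 hζ₀).2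
        have h3 : ((Subtype.val '' (↑(F.filter fun ζ : 𝒵 => x ∈ (ζ : Set X)) : Set 𝒵)) : Set (Set X)).encard
            ≤ L := by
          refine (Set.encard_le_encard ?_).trans (hL ζ₀ ζ₀.2)
          rintro _ ⟨ζ, hζ, rfl⟩
          exact ⟨ζ.2, x, hx0, (Finset.mem_filter.1 hζ).2⟩
        rw [Subtype.val_injective.encard_image, Set.encard_coe_eq_coe_finsetCard] at h3
        exact Nat.cast_le.2 (by exact_mod_cast h3)
    _ = L := by simp

namespace System

variable {ι A M U : Type*} [AddMonoidWithOne ι] [MeasurableSpace A]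
    [MetricSpace M] [CompactSpace M] [MeasurableSpace M] [BorelSpace M]
    [MeasurableSpace U] {S : System ι A M U}

/-- A set of fixed points of `T_ω^n` has small leaf measure. -/
theorem leaf_measure_fixed_le {ω : ι → A} (hω : ω ∈ S.good) {a : U} {n : ℕ}
    (hmeas : ∀ ζ ∈ S.cylinders ω a n, MeasurableSet ζ)
    (hcov : ∀ᵐ x ∂(S.μu ω a), ∃ ζ ∈ S.cylinders ω a n, x ∈ ζ) {L : ℕ}
    (hL : ∀ ζ ∈ S.cylinders ω a n,
      {ζ' | ζ' ∈ S.cylinders ω a n ∧ (ζ ∩ ζ').Nonempty}.encard ≤ L)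
    {c : ℝ≥0∞} (hc0 : c ≠ 0) (hctop : c ≠ ∞)
    (hc : ∀ b ∈ S.centres ω a n, c ≤ S.μu (shift^[n] ω) b.1 (S.disk ω n b))
    {Q : ℝ} (hJ : ∀ b ζ, S.IsCylinderOver ω a n b ζ →
      ∃ J : M → ℝ≥0, S.IsJacobian ω a n b.1 ζ J ∧ ∀ x ∈ ζ, ∀ y ∈ ζ, (J x : ℝ) ≤ Q * J y)
    {E : Set M} (hE : MeasurableSet E) (hfix : ∀ y ∈ E, iter S.T ω n y = y) {η : ℝ≥0∞}
    (hη : ∀ b, ∀ ζ ∈ S.cylinders ω a n, S.μu (shift^[n] ω) b (E ∩ ζ) ≤ η) :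
    S.μu ω a E ≤ c⁻¹ * (ENNReal.ofReal Q * η * L) := by
  have := S.prob_μu ω hω
  have key : ∀ ζ ∈ S.cylinders ω a n, S.μu ω a ζ ≠ 0 ∧
      S.μu ω a (E ∩ ζ) ≤ c⁻¹ * (ENNReal.ofReal Q * η * S.μu ω a ζ) := by
    rintro ζ ⟨b, hb⟩
    have hζm : MeasurableSet ζ := hmeas ζ ⟨b, hb⟩
    obtain ⟨J, ⟨hJm, hJi⟩, hJd⟩ := hJ b ζ hb
    obtain ⟨hbc, φ, ⟨-, -, hφ⟩, hζ⟩ := id hb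
    have himg : iter S.T ω n '' ζ = S.disk ω n b := by
      rw [hζ, image_image]
      ext z
      constructor
      · rintro ⟨w, hw, rfl⟩
        simpa only [hφ w hw] using hw
      · exact fun hz => ⟨z, hz, hφ z hz⟩
    have h1 : c ≤ ∫⁻ x in ζ, (J x : ℝ≥0∞) ∂(S.μu ω a) := by
      rw [← hJi ζ hζm Subset.rfl, himg]
      exact hc b hbc
    have h2 : ∫⁻ x in E ∩ ζ, (J x : ℝ≥0∞) ∂(S.μu ω a) ≤ η := by
      rw [← hJi (E ∩ ζ) (hE.inter hζm) inter_subset_right]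
      have : iter S.T ω n '' (E ∩ ζ) = E ∩ ζ := by
        ext z
        constructor
        · rintro ⟨w, hw, rfl⟩
          rw [hfix w hw.1]; exact hw
        · exact fun hz => ⟨z, hz, hfix z hz.1⟩
      rw [this]
      exact hη b.1 ζ ⟨b, hb⟩
    have hJd' : ∀ x ∈ ζ, ∀ y ∈ ζ, (J x : ℝ≥0∞) ≤ ENNReal.ofReal Q * J y := by
      intro x hx y hy
      have h3 := ENNReal.ofReal_le_ofReal (hJd x hx y hy)
      rwa [ENNReal.ofReal_mul' (NNReal.coe_nonneg _), ENNReal.ofReal_coe_nnreal,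
        ENNReal.ofReal_coe_nnreal] at h3
    refine ⟨fun h0 => ?_, ?_⟩
    · rw [setLIntegral_measure_zero _ _ h0] at h1
      exact hc0 (le_antisymm h1 zero_le)
    · have h4 : ∀ y ∈ E ∩ ζ, c ≤ ENNReal.ofReal Q * J y * S.μu ω a ζ := by
        intro y hy
        calc c ≤ ∫⁻ x in ζ, (J x : ℝ≥0∞) ∂(S.μu ω a) := h1
          _ ≤ ∫⁻ _ in ζ, ENNReal.ofReal Q * J y ∂(S.μu ω a) :=
              setLIntegral_mono' hζm fun x hx => hJd' x hx y hy.2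
          _ = _ := by simp
      have h5 : c * S.μu ω a (E ∩ ζ) ≤ ENNReal.ofReal Q * η * S.μu ω a ζ := by
        calc c * S.μu ω a (E ∩ ζ) = ∫⁻ _ in E ∩ ζ, c ∂(S.μu ω a) := by simp
          _ ≤ ∫⁻ y in E ∩ ζ, ENNReal.ofReal Q * S.μu ω a ζ * J y ∂(S.μu ω a) := by
              refine setLIntegral_mono' (hE.inter hζm) fun y hy => (h4 y hy).trans_eq ?_
              ring
          _ = ENNReal.ofReal Q * S.μu ω a ζ * ∫⁻ y in E ∩ ζ, (J y : ℝ≥0∞) ∂(S.μu ω a) :=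
              lintegral_const_mul _ hJm.coe_nnreal_ennreal
          _ ≤ ENNReal.ofReal Q * S.μu ω a ζ * η := by gcongr
          _ = _ := by ring
      rwa [← ENNReal.mul_le_mul_iff_right hc0 hctop, ← mul_assoc, ENNReal.mul_inv_cancel hc0 hctop,
        one_mul]
  have hsum := tsum_measure_le_of_overlap (S.μu ω a) hmeas hL
  have hcount : (S.cylinders ω a n).Countable := by
    have h1 := Summable.countable_support_ennreal (ne_top_of_le_ne_top (by simp) hsum)
    have h2 : Function.support (fun ζ : S.cylinders ω a n => S.μu ω a ζ) = univ := by
      ext ζ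
      simpa using (key ζ ζ.2).1
    rw [h2] at h1
    exact countable_coe_iff.1 (countable_univ_iff.1 h1)
  have : Countable (S.cylinders ω a n) := hcount.to_subtype
  calc S.μu ω a E ≤ S.μu ω a (⋃ ζ : S.cylinders ω a n, E ∩ ζ) := by
        refine measure_mono_ae ?_
        filter_upwards [hcov] with x hx hxE
        obtain ⟨ζ, hζ, hxζ⟩ := hx
        exact mem_iUnion.2 ⟨⟨ζ, hζ⟩, hxE, hxζ⟩
    _ ≤ ∑' ζ : S.cylinders ω a n, S.μu ω a (E ∩ ζ) := measure_iUnion_le _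
    _ ≤ ∑' ζ : S.cylinders ω a n, c⁻¹ * (ENNReal.ofReal Q * η * S.μu ω a ζ) :=
        ENNReal.tsum_le_tsum fun ζ => (key ζ ζ.2).2
    _ = c⁻¹ * (ENNReal.ofReal Q * η * ∑' ζ : S.cylinders ω a n, S.μu ω a ζ) := by
        rw [ENNReal.tsum_mul_left, ENNReal.tsum_mul_left]
    _ ≤ _ := by gcongr

/-- Almost no point is periodic. -/
theorem measure_periodic_eq_zero (hcyl : S.CylinderStructure) {u₀ κ κ' : ℝ} {δ Θ : ℕ → ℝ}
    (hIV : S.LeafBound u₀) (hΘ : PolyDecay Θ (-κ')) (hV : S.Distortion Θ)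
    (hκ : 0 < κ) (hδ : PolyDecay δ κ) (hVI : S.Contraction δ) (hexp : κ' < κ * u₀)
    {K : ℝ≥0} (hK : ∀ ω ∈ S.good, ∀ E, S.μ E ≤ K * S.μf ω E)
    {ω : ι → A} (hω : ω ∈ S.good) {j : ℕ} (hj : 1 ≤ j) :
    S.μ {y | iter S.T ω j y = y} = 0 := by
  obtain ⟨hcyl1, ⟨L, hL⟩, c, hc, hcd⟩ := hcyl
  obtain ⟨CV, hV⟩ := hV
  obtain ⟨C₁, ρ₀, hC₁, hρ₀, hleaf⟩ := hIV.leaf_ball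
  obtain ⟨Cδ, hCδ, hδb⟩ := hδ.exists_bound
  obtain ⟨CΘ, hCΘ, hΘb⟩ := hΘ.exists_bound
  set E := {y | iter S.T ω j y = y} with hE
  have hEm : MeasurableSet E := measurableSet_eq_fun (S.measurable_T_iter ω j) measurable_id
  set r : ℕ → ℝ := fun n => 2 * Cδ * (n : ℝ) ^ (-κ) with hr
  have hr0 : Tendsto r atTop (𝓝 0) := tendsto_const_mul_natCast_rpow_neg _ hκ
  set F : ℝ := |CV| * CΘ * (C₁ * (2 * Cδ) ^ u₀) with hF
  have hFb : ∀ m : ℕ, r m < ρ₀ → 1 ≤ m →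
      S.μ E ≤ K * ((ENNReal.ofReal c)⁻¹ *
        (ENNReal.ofReal (F * ((m * j : ℕ) : ℝ) ^ (-(κ * u₀ - κ'))) * L)) := by
    intro m hm hm1
    set n := m * j with hn
    have hmn : m ≤ n := Nat.le_mul_of_pos_right m hj
    have hn1 : 1 ≤ n := hm1.trans hmn
    have hnpos : (0 : ℝ) < n := by exact_mod_cast hn1
    obtain ⟨ω', hω', hrep⟩ := S.repeat_good ω hω j hj m
    have hfix : ∀ y ∈ E, iter S.T ω' n y = y := fun y hy => iter_repeat_fixed S.T hrep hy
    have hrpos : 0 < r n := by positivity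
    have hrn : r n < ρ₀ := by
      refine lt_of_le_of_lt ?_ hm
      refine mul_le_mul_of_nonneg_left ?_ (by positivity)
      exact Real.rpow_le_rpow_of_nonpos (by exact_mod_cast hm1) (by exact_mod_cast hmn)
        (by linarith)
    have hδr : δ n < r n := by
      have h1 := hδb n hn1
      have h2 : 0 < Cδ * (n : ℝ) ^ (-κ) := by positivity
      have h3 : r n = 2 * (Cδ * (n : ℝ) ^ (-κ)) := by simp only [hr]; ring
      rw [h3]
      linarith [le_abs_self (δ n)]
    have hleafE : ∀ a, S.μu ω' a E ≤ (ENNReal.ofReal c)⁻¹ *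
        (ENNReal.ofReal (CV * Θ n) * ENNReal.ofReal (C₁ * r n ^ u₀) * L) := by
      intro a
      refine leaf_measure_fixed_le hω' (hcyl1 ω' hω' a n hn1).1 (hcyl1 ω' hω' a n hn1).2
        (hL ω' hω' a n hn1) (by simpa using hc) ENNReal.ofReal_ne_top (hcd ω' hω' a n hn1)
        (hV ω' hω' a n hn1) hEm hfix fun b ζ hζ => ?_
      refine hleaf _ (S.shift_iterate_good hω' n) b _ (r n) hrpos hrn fun y hy z hz => ?_
      have hd := (hVI ω' hω' n hn1).1 a ζ hζ
      have := Metric.dist_le_diam_of_mem (Metric.isBounded_of_compactSpace (s := ζ)) hy.2 hz.2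
      linarith
    have hfib : S.μf ω' E ≤ (ENNReal.ofReal c)⁻¹ *
        (ENNReal.ofReal (CV * Θ n) * ENNReal.ofReal (C₁ * r n ^ u₀) * L) := by
      have := S.prob_υ ω' hω'
      rw [S.decomp ω' hω', Measure.bind_apply hEm (S.μu ω').measurable.aemeasurable]
      refine (lintegral_mono hleafE).trans ?_
      simp
    refine (hK ω' hω' E).trans ?_
    gcongr
    refine hfib.trans ?_
    gcongr
    have hnn : 0 ≤ C₁ * r n ^ u₀ := by positivity
    rw [← ENNReal.ofReal_mul' hnn]
    refine ENNReal.ofReal_le_ofReal ?_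
    have h1 : CV * Θ n ≤ |CV| * (CΘ * (n : ℝ) ^ κ') := by
      have := hΘb n hn1
      rw [neg_neg] at this
      calc CV * Θ n ≤ |CV * Θ n| := le_abs_self _
        _ = |CV| * |Θ n| := abs_mul _ _
        _ ≤ _ := by gcongr
    have h2 : r n ^ u₀ = (2 * Cδ) ^ u₀ * (n : ℝ) ^ (-(κ * u₀)) := by
      simp only [hr]
      rw [Real.mul_rpow (by positivity) (by positivity), ← Real.rpow_mul hnpos.le]
      ring_nf
    calc CV * Θ n * (C₁ * r n ^ u₀) ≤ |CV| * (CΘ * (n : ℝ) ^ κ') * (C₁ * r n ^ u₀) := by gcongr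
      _ = F * ((n : ℝ) ^ κ' * (n : ℝ) ^ (-(κ * u₀))) := by rw [h2, hF]; ring
      _ = F * (n : ℝ) ^ (-(κ * u₀ - κ')) := by
          rw [← Real.rpow_add hnpos]; ring_nf
  have hmj : Tendsto (fun m : ℕ => m * j) atTop atTop :=
    tendsto_id.atTop_mul_const' (by omega)
  have hlim : Tendsto (fun m : ℕ => (K : ℝ≥0∞) * ((ENNReal.ofReal c)⁻¹ *
      (ENNReal.ofReal (F * ((m * j : ℕ) : ℝ) ^ (-(κ * u₀ - κ'))) * L))) atTop (𝓝 0) := by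
    have h1 : Tendsto (fun m : ℕ => ENNReal.ofReal (F * ((m * j : ℕ) : ℝ) ^ (-(κ * u₀ - κ'))))
        atTop (𝓝 0) := by
      have := (tendsto_const_mul_natCast_rpow_neg F (q := κ * u₀ - κ') (by linarith)).comp hmj
      simpa using ENNReal.tendsto_ofReal this
    have hL' : (L : ℝ≥0∞) ≠ ∞ := by simp
    have hc' : (ENNReal.ofReal c)⁻¹ ≠ ∞ := by simpa using hc
    have h2 := ENNReal.Tendsto.mul_const h1 (b := (L : ℝ≥0∞)) (Or.inr hL')
    have h3 := ENNReal.Tendsto.const_mul h2 (a := (ENNReal.ofReal c)⁻¹) (Or.inr hc')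
    have h4 := ENNReal.Tendsto.const_mul h3 (a := (K : ℝ≥0∞)) (Or.inr ENNReal.coe_ne_top)
    simpa using h4
  refine le_antisymm (ge_of_tendsto hlim ?_) zero_le
  filter_upwards [hr0.eventually_lt_const hρ₀, eventually_ge_atTop 1] with m hm hm1
  exact hFb m hm hm1

end System

section Bump

variable {M : Type*} [MetricSpace M]

/-- The piecewise linear function equal to `1` on `B_ρ(x)` and to `0` off `B_{ρ+r}(x)`. -/
noncomputable def bump (x : M) (ρ r : ℝ) (y : M) : ℝ := max 0 (min 1 ((ρ + r - dist y x) / r))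

theorem bump_nonneg (x : M) (ρ r : ℝ) (y : M) : 0 ≤ bump x ρ r y := le_max_left _ _

theorem bump_le_one (x : M) (ρ r : ℝ) (y : M) : bump x ρ r y ≤ 1 :=
  max_le zero_le_one (min_le_left _ _)

theorem bump_eq_one {x : M} {ρ r : ℝ} (hr : 0 < r) {y : M} (h : dist y x ≤ ρ) :
    bump x ρ r y = 1 := by
  have : 1 ≤ (ρ + r - dist y x) / r := by rw [le_div_iff₀ hr]; linarith
  rw [bump, min_eq_left this, max_eq_right zero_le_one]

theorem bump_eq_zero {x : M} {ρ r : ℝ} (hr : 0 < r) {y : M} (h : ρ + r ≤ dist y x) :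
    bump x ρ r y = 0 := by
  have : (ρ + r - dist y x) / r ≤ 0 := div_nonpos_of_nonpos_of_nonneg (by linarith) hr.le
  rw [bump, min_eq_right (this.trans zero_le_one), max_eq_left this]

theorem lipschitzWith_bump (x : M) (ρ : ℝ) {r : ℝ} (hr : 0 < r) :
    LipschitzWith (Real.toNNReal (1 / r)) (bump x ρ r) := by
  refine LipschitzWith.const_max (LipschitzWith.const_min ?_ 1) 0
  refine LipschitzWith.of_dist_le_mul fun y z => ?_
  rw [Real.coe_toNNReal _ (by positivity), Real.dist_eq, ← sub_div, abs_div, abs_of_pos hr,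
    one_div_mul_eq_div]
  gcongr
  rw [sub_sub_sub_cancel_left, dist_comm y z]
  exact abs_dist_sub_le z y x

theorem abs_bump_sub_le (x : M) (ρ : ℝ) {r : ℝ} (hr : 0 < r) (y z : M) :
    |bump x ρ r y - bump x ρ r z| ≤ 1 / r * dist y z := by
  have := (lipschitzWith_bump x ρ hr).dist_le_mul y z
  rwa [Real.coe_toNNReal _ (by positivity), Real.dist_eq] at this

theorem measurable_bump [MeasurableSpace M] [BorelSpace M] (x : M) (ρ : ℝ) {r : ℝ} (hr : 0 < r) :
    Measurable (bump x ρ r) :=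
  (lipschitzWith_bump x ρ hr).continuous.measurable

end Bump

section Holonomy

variable {M : Type*} {Γs : Set (Set M)} {γ : Set M}

theorem holonomy_mem (hd : Γs.PairwiseDisjoint id) {s : Set M} (hs : s ∈ Γs)
    (hγ : (γ ∩ s).Nonempty) {x : M} (hx : x ∈ s) : holonomy Γs γ x ∈ γ ∩ s := by
  obtain ⟨z, hz⟩ := hγ
  have h : ∃ z, ∃ s ∈ Γs, x ∈ s ∧ z ∈ γ ∩ s := ⟨z, s, hs, hx, hz⟩
  rw [holonomy, dif_pos h]
  obtain ⟨s', hs', hx', hz'⟩ := h.choose_spec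
  have : s' = s := hd.elim_set hs' hs x hx' hx
  rwa [this] at hz'

theorem holonomy_of_notMem {x : M} (hx : ∀ s ∈ Γs, x ∉ s) : holonomy Γs γ x = x := by
  rw [holonomy, dif_neg]
  rintro ⟨z, s, hs, hxs, -⟩
  exact hx s hs hxs

end Holonomy

namespace System

variable {ι A M U : Type*} [AddMonoidWithOne ι] [MeasurableSpace A]
    [MetricSpace M] [CompactSpace M] [MeasurableSpace M] [BorelSpace M]
    [MeasurableSpace U] {S : System ι A M U}

theorem holonomy_eq_of_mem {ω : ι → A} (hω : ω ∈ S.good) (a : U) {s : Set M} (hs : s ∈ S.stab ω)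
    {x y : M} (hx : x ∈ s) (hy : y ∈ s) :
    holonomy (S.stab ω) (S.unst ω a) x = holonomy (S.stab ω) (S.unst ω a) y := by
  obtain ⟨z, hz⟩ := S.inter_single ω hω a s hs
  have hne : (S.unst ω a ∩ s).Nonempty := by rw [hz]; exact singleton_nonempty z
  have h1 := holonomy_mem (S.stab_disjoint ω hω) hs hne hx
  have h2 := holonomy_mem (S.stab_disjoint ω hω) hs hne hy
  rw [hz, mem_singleton_iff] at h1 h2
  rw [h1, h2]

/-- A point and its holonomy image have close orbits. -/
theorem Contraction.dist_holonomy_le {δ : ℕ → ℝ} (h : S.Contraction δ) {ω : ι → A}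
    (hω : ω ∈ S.good) (a : U) {n : ℕ} (hn : 1 ≤ n) {r : ℝ} (hr : 0 ≤ r) (hδ : δ n ≤ r) (y : M) :
    dist (iter S.T ω n y) (iter S.T ω n (holonomy (S.stab ω) (S.unst ω a) y)) ≤ r := by
  by_cases hy : ∃ s ∈ S.stab ω, y ∈ s
  · obtain ⟨s, hs, hys⟩ := hy
    obtain ⟨z, hz⟩ := S.inter_single ω hω a s hs
    have hne : (S.unst ω a ∩ s).Nonempty := by rw [hz]; exact singleton_nonempty z
    have h1 := (holonomy_mem (S.stab_disjoint ω hω) hs hne hys).2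
    refine (Metric.dist_le_diam_of_mem (Metric.isBounded_of_compactSpace) (mem_image_of_mem _ hys)
      (mem_image_of_mem _ h1)).trans (((h ω hω n hn).2 s hs).trans hδ)
  · push Not at hy
    rw [holonomy_of_notMem hy, dist_self]
    exact hr

/-- Quenched decay of correlations at the realisation `ω`. -/
def DecayAt (S : System ι A M U) (lam : ℕ → ℝ) (ω : ι → A) : Prop :=
  ∀ k : ℕ, 1 ≤ k → ∀ (G H : M → ℝ) (K L C : ℝ≥0),
    LipschitzWith L G → (∀ x, |G x| ≤ K) → Measurable H → (∀ x, |H x| ≤ C) →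
    (∀ s ∈ S.stab (shift^[k] ω), ∀ x ∈ s, ∀ y ∈ s, H x = H y) →
    |(∫ x, G x * H (iter S.T ω k x) ∂(S.μf ω))
        - (∫ x, G x ∂(S.μf ω)) * ∫ x, H x ∂(S.μf (shift^[k] ω))|
      ≤ lam k * (K + L) * C

theorem DecayAt.holonomy {lam : ℕ → ℝ} {ω : ι → A} (h : S.DecayAt lam ω) (hω : ω ∈ S.good)
    {k : ℕ} (hk : 1 ≤ k) (a : U) {G F : M → ℝ} {K L C : ℝ} (hL : 0 ≤ L)
    (hG : ∀ x y, |G x - G y| ≤ L * dist x y)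
    (hK : ∀ x, |G x| ≤ K) (hF : Measurable F) (hC : ∀ x, |F x| ≤ C) :
    |(∫ x, G x * F (RandomMaps.holonomy (S.stab (shift^[k] ω)) (S.unst (shift^[k] ω) a)
        (iter S.T ω k x)) ∂(S.μf ω))
        - (∫ x, G x ∂(S.μf ω)) * ∫ x, F (RandomMaps.holonomy (S.stab (shift^[k] ω))
          (S.unst (shift^[k] ω) a) x) ∂(S.μf (shift^[k] ω))|
      ≤ |lam k| * (K + L) * C := by
  have hωk := S.shift_iterate_good hω k
  have hne : Nonempty M := (nonempty_of_isProbabilityMeasure (S.μf ω))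
  have hK0 : 0 ≤ K := (abs_nonneg _).trans (hK hne.some)
  have hC0 : 0 ≤ C := (abs_nonneg _).trans (hC hne.some)
  have := h k hk G (fun x => F (RandomMaps.holonomy (S.stab (shift^[k] ω))
    (S.unst (shift^[k] ω) a) x)) K.toNNReal L.toNNReal C.toNNReal
    (LipschitzWith.of_dist_le_mul fun x y => by
      rw [Real.coe_toNNReal _ hL, Real.dist_eq]; exact hG x y)
    (fun x => by rw [Real.coe_toNNReal _ hK0]; exact hK x)
    (hF.comp (S.meas_holonomy _ hωk a))
    (fun x => by rw [Real.coe_toNNReal _ hC0]; exact hC _)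
    (fun s hs x hx y hy => by rw [holonomy_eq_of_mem hωk a hs hx hy])
  rw [Real.coe_toNNReal _ hL, Real.coe_toNNReal _ hK0, Real.coe_toNNReal _ hC0] at this
  refine this.trans ?_
  gcongr
  exact le_abs_self _

/-- The realisations for which the almost sure assumptions hold along the whole orbit. -/
structure RegularAt (S : System ι A M U) (lam : ℕ → ℝ) (K : ℝ≥0) (C ρ₀ ξ : ℝ) (ω : ι → A) :
    Prop where
  good : ω ∈ S.good
  inv : S.InvariantAlong ω
  decay : ∀ k, S.DecayAt lam (shift^[k] ω)
  dom : ∀ k E, S.μf (shift^[k] ω) E ≤ K * S.μ E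
  annulus : ∀ k : ℕ, ∀ x ∈ S.μ.support, ∀ ρ r : ℝ, 0 < r → r < ρ → ρ < ρ₀ →
    (S.μf (shift^[k] ω)).real (Metric.ball x (ρ + r) \ Metric.ball x (ρ - r))
      ≤ C * (r ^ ξ / ρ ^ ξ) * S.μ.real (Metric.ball x ρ)

theorem RegularAt.shift_iterate {lam : ℕ → ℝ} {K : ℝ≥0} {C ρ₀ ξ : ℝ} {ω : ι → A}
    (h : S.RegularAt lam K C ρ₀ ξ ω) (k : ℕ) : S.RegularAt lam K C ρ₀ ξ (shift^[k] ω) where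
  good := S.shift_iterate_good h.good k
  inv := h.inv.shift_iterate k
  decay l := by rw [← Function.iterate_add_apply]; exact h.decay (l + k)
  dom l := by rw [← Function.iterate_add_apply]; exact h.dom (l + k)
  annulus l := by rw [← Function.iterate_add_apply]; exact h.annulus (l + k)

theorem RegularAt.dom_real {lam : ℕ → ℝ} {K : ℝ≥0} {C ρ₀ ξ : ℝ} {ω : ι → A}
    (h : S.RegularAt lam K C ρ₀ ξ ω) (E : Set M) : (S.μf ω).real E ≤ K * S.μ.real E := by
  have := ENNReal.toReal_mono (ENNReal.mul_ne_top ENNReal.coe_ne_top (measure_ne_top _ _))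
    (h.dom 0 E)
  rwa [ENNReal.toReal_mul, ENNReal.coe_toReal] at this

theorem ae_regularAt {lam : ℕ → ℝ} {K : ℝ≥0} {ξ : ℝ} (hdecay : S.QuenchedDecay lam)
    (hK : ∀ᵐ ω ∂S.ν, ∀ E, S.μf ω E ≤ K * S.μ E) (hann : S.AnnulusCondition ξ ξ) :
    ∃ C ρ₀ : ℝ, 0 < C ∧ 0 < ρ₀ ∧ ∀ᵐ ω ∂S.ν, S.RegularAt lam K C ρ₀ ξ ω := by
  obtain ⟨C, ρ₀, hρ₀, hann⟩ := hann
  refine ⟨|C| + 1, ρ₀, by positivity, hρ₀, ?_⟩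
  have hdecay' : ∀ᵐ ω ∂S.ν, S.DecayAt lam ω := hdecay
  filter_upwards [S.ae_good, S.ae_invariantAlong, S.ae_shift_iterate hdecay',
    S.ae_shift_iterate hK, S.ae_shift_iterate hann] with ω h1 h2 h3 h4 h5
  refine ⟨h1, h2, h3, h4, fun k x hx ρ r hr hrρ hρ => (h5 k x hx ρ r hr hrρ hρ).trans ?_⟩
  have hρ' : 0 < ρ := hr.trans hrρ
  gcongr
  linarith [le_abs_self C]

/-- Bounded overlap of the balls about a separated set, for a measure that is doubling on its
support. -/
theorem card_filter_net_le {M : Type*} [MetricSpace M] [MeasurableSpace M] [BorelSpace M]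
    {m : Measure M} [IsFiniteMeasure m] {D : ℝ≥0} {ρ₀ : ℝ}
    (hD : ∀ x ∈ m.support, ∀ ρ : ℝ, 0 < ρ → ρ < ρ₀ →
      m (Metric.ball x (4 * ρ)) ≤ D * m (Metric.ball x ρ))
    {s : ℝ} (hs : 0 < s) (hsρ : 8 * s < ρ₀) {Z : Finset M} (hZ : ∀ z ∈ Z, z ∈ m.support)
    (hsep : ∀ z ∈ Z, ∀ w ∈ Z, z ≠ w → s < dist z w) (y : M) :
    ((Z.filter fun z => dist y z < 5 * s).card : ℝ) ≤ (D : ℝ) ^ 3 := by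
  set W := Z.filter fun z => dist y z < 5 * s with hW
  rcases W.eq_empty_or_nonempty with h0 | ⟨z₀, hz₀⟩
  · rw [h0]; simp
  have hWZ : ∀ z ∈ W, z ∈ Z ∧ dist y z < 5 * s := fun z hz => Finset.mem_filter.1 hz
  have hdisj : (W : Set M).PairwiseDisjoint fun z => Metric.ball z (s / 2) :=
    disjoint_ball_of_separated fun z hz w hw => hsep z (hWZ z hz).1 w (hWZ w hw).1
  have hdist : ∀ z ∈ W, dist z z₀ < 10 * s := fun z hz => by
    have := dist_triangle_left z z₀ y
    linarith [(hWZ z hz).2, (hWZ z₀ hz₀).2]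
  have hpos : m (Metric.ball z₀ (11 * s)) ≠ 0 :=
    ((Measure.mem_support_iff_forall z₀).1 (hZ z₀ (hWZ z₀ hz₀).1) _
      (Metric.ball_mem_nhds z₀ (by positivity))).ne'
  have h1 : ∀ z ∈ W, m (Metric.ball z₀ (11 * s)) ≤ D ^ 3 * m (Metric.ball z (s / 2)) := by
    intro z hz
    have hzs := hZ z (hWZ z hz).1
    calc m (Metric.ball z₀ (11 * s)) ≤ m (Metric.ball z (4 * (4 * (4 * (s / 2))))) := by
          refine measure_mono fun x hx => ?_
          rw [Metric.mem_ball] at hx ⊢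
          have := dist_triangle x z₀ z
          rw [dist_comm z₀ z] at this
          linarith [hdist z hz]
      _ ≤ D * (D * (D * m (Metric.ball z (s / 2)))) := by
          refine (hD z hzs _ (by positivity) (by linarith)).trans ?_
          gcongr
          refine (hD z hzs _ (by positivity) (by linarith)).trans ?_
          gcongr
          exact hD z hzs _ (by positivity) (by linarith)
      _ = _ := by ring
  have h2 : (W.card : ℝ≥0∞) * m (Metric.ball z₀ (11 * s)) ≤ D ^ 3 * m (Metric.ball z₀ (11 * s)) := by
    calc (W.card : ℝ≥0∞) * m (Metric.ball z₀ (11 * s)) = ∑ _z ∈ W, m (Metric.ball z₀ (11 * s)) := by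
          simp
      _ ≤ ∑ z ∈ W, D ^ 3 * m (Metric.ball z (s / 2)) := Finset.sum_le_sum h1
      _ = D ^ 3 * m (⋃ z ∈ W, Metric.ball z (s / 2)) := by
          rw [← Finset.mul_sum,
            measure_biUnion_finset hdisj
            fun z _ => Metric.isOpen_ball.measurableSet]
      _ ≤ _ := by
          gcongr
          refine iUnion₂_subset fun z hz x hx => ?_
          rw [Metric.mem_ball] at hx ⊢
          have := dist_triangle x z z₀
          linarith [hdist z hz]
  have h3 : (W.card : ℝ≥0∞) ≤ D ^ 3 :=
    (ENNReal.mul_le_mul_iff_left hpos (measure_ne_top _ _)).1 h2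
  have h4 : (W.card : ℝ≥0) ≤ D ^ 3 := by exact_mod_cast h3
  exact_mod_cast h4

/-- Points of the fibre over `ω` that return close to themselves at time `k + l` are rare. -/
theorem close_return_le {δ : ℕ → ℝ} (hVI : S.Contraction δ) {D : ℝ≥0} {ρ₁ : ℝ} (hρ₁ : 0 < ρ₁)
    (hD : ∀ x ∈ S.μ.support, ∀ ρ : ℝ, 0 < ρ → ρ < ρ₁ →
      S.μ (Metric.ball x (4 * ρ)) ≤ D * S.μ (Metric.ball x ρ))
    {C₂ ρ₂ u₀ : ℝ} (hρ₂ : 0 < ρ₂)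
    (hball : ∀ x, ∀ ρ : ℝ, 0 < ρ → ρ < ρ₂ → S.μ.real (Metric.ball x ρ) ≤ C₂ * ρ ^ u₀)
    (lam : ℕ → ℝ) (K : ℝ≥0) (C ρ₀ ξ : ℝ) :
    ∃ C₃ ρ₃ : ℝ, 0 < C₃ ∧ 0 < ρ₃ ∧ ∀ ω, S.RegularAt lam K C ρ₀ ξ ω → ∀ k l : ℕ, 1 ≤ k → 1 ≤ l →
      ∀ s : ℝ, 0 < s → s < ρ₃ → δ l ≤ s →
      (S.μf ω).real {y | dist y (iter S.T ω (k + l) y) < 2 * s}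
        ≤ C₃ * (s ^ u₀ + |lam k| / s) := by
  set N : ℝ := (D : ℝ) ^ 3 with hN
  have hN0 : 0 ≤ N := by positivity
  refine ⟨N * (K * (|C₂| * 5 ^ u₀)) + 3 * N ^ 2 + 1, min (ρ₁ / 8) (min (ρ₂ / 5) 1), by positivity,
    by positivity, fun ω hω k l hk hl s hs hsρ hδ => ?_⟩
  have hs1 : 8 * s < ρ₁ := by linarith [hsρ.trans_le (min_le_left _ _)]
  have hs2 : 5 * s < ρ₂ := by
    linarith [hsρ.trans_le ((min_le_right _ _).trans (min_le_left _ _))]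
  have hs3 : s < 1 := hsρ.trans_le ((min_le_right _ _).trans (min_le_right _ _))
  have hgk := S.shift_iterate_good hω.good k
  obtain ⟨a⟩ : Nonempty U := by
    have := S.prob_υ ω hω.good
    exact nonempty_of_isProbabilityMeasure (S.υ ω)
  obtain ⟨Z, hZs, hZsep, hZc⟩ := exists_finset_net S.μ.support hs
  have hcard := card_filter_net_le hD hs hs1 hZs hZsep
  classical
  set h := holonomy (S.stab (shift^[k] ω)) (S.unst (shift^[k] ω) a) with hh
  have hhm : Measurable h := S.meas_holonomy _ hgk a
  have hTk := S.measurable_T_iter ω k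
  have hTl := S.measurable_T_iter (shift^[k] ω) l
  have hdist : ∀ y, dist (iter S.T (shift^[k] ω) l y) (iter S.T (shift^[k] ω) l (h y)) ≤ s :=
    fun y => hVI.dist_holonomy_le hgk a hl hs.le hδ y
  set G : M → M → ℝ := fun z => bump z s s with hG
  set F : M → M → ℝ := fun z y =>
    (Metric.ball z (4 * s)).indicator (fun _ => (1 : ℝ)) (iter S.T (shift^[k] ω) l y) with hF
  have hGm : ∀ z, Measurable (G z) := fun z => measurable_bump z s hs
  have hFm : ∀ z, Measurable (F z) := fun z =>
    (measurable_const.indicator Metric.isOpen_ball.measurableSet).comp hTl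
  have hF0 : ∀ z y, 0 ≤ F z y := fun z y => Set.indicator_nonneg (fun _ _ => zero_le_one) _
  have hF1 : ∀ z y, F z y ≤ 1 := fun z y => Set.indicator_le_self' (fun _ _ => zero_le_one) _
  have hint : ∀ {f : M → ℝ} {L : ℝ} {m : Measure M} [IsFiniteMeasure m], Measurable f →
      (∀ x, |f x| ≤ L) → Integrable f m :=
    fun hf hL => Integrable.of_bound hf.aestronglyMeasurable _ (Eventually.of_forall hL)
  have hGa : ∀ z y, |G z y| ≤ 1 := fun z y => by
    rw [abs_of_nonneg (bump_nonneg _ _ _ _)]; exact bump_le_one _ _ _ _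
  have hFa : ∀ z y, |F z y| ≤ 1 := fun z y => by rw [abs_of_nonneg (hF0 z y)]; exact hF1 z y
  have hGint : ∀ z, Integrable (G z) (S.μf ω) := fun z => hint (hGm z) (hGa z)
  have hFint : ∀ z, Integrable (fun y => F z (h y)) (S.μf (shift^[k] ω)) := fun z =>
    hint ((hFm z).comp hhm) fun y => hFa z _
  have hGFint : ∀ z w, Integrable (fun y => G z y * F w (h (iter S.T ω k y))) (S.μf ω) :=
    fun z w => by
      refine hint (L := 1) ((hGm z).mul ((hFm w).comp (hhm.comp hTk))) fun y => ?_
      rw [abs_mul]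
      exact mul_le_one₀ (hGa z y) (abs_nonneg _) (hFa w _)
  have hGsum : ∀ y (c : M → ℝ), (∀ z, |c z| ≤ 1) → |∑ z ∈ Z, c z * G z y| ≤ N := by
    intro y c hc
    refine (Finset.abs_sum_le_sum_abs _ _).trans ?_
    calc ∑ z ∈ Z, |c z * G z y| ≤ ∑ z ∈ Z, if dist y z < 5 * s then (1 : ℝ) else 0 := by
          refine Finset.sum_le_sum fun z _ => ?_
          split_ifs with hd
          · rw [abs_mul]
            exact mul_le_one₀ (hc z) (abs_nonneg _) (hGa z y)
          · have : G z y = 0 := bump_eq_zero hs (by linarith)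
            simp [this]
      _ = ((Z.filter fun z => dist y z < 5 * s).card : ℝ) := by
          rw [Finset.sum_ite]; simp
      _ ≤ N := hcard y
  have hFsum : ∀ y (c : M → ℝ), (∀ z, |c z| ≤ 1) → |∑ z ∈ Z, c z * F z y| ≤ N := by
    intro y c hc
    refine (Finset.abs_sum_le_sum_abs _ _).trans ?_
    calc ∑ z ∈ Z, |c z * F z y|
        ≤ ∑ z ∈ Z, if dist (iter S.T (shift^[k] ω) l y) z < 5 * s then (1 : ℝ) else 0 := by
          refine Finset.sum_le_sum fun z _ => ?_
          split_ifs with hd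
          · rw [abs_mul]
            exact mul_le_one₀ (hc z) (abs_nonneg _) (hFa z y)
          · have : F z y = 0 := Set.indicator_of_notMem (fun hm => hd (by
              rw [Metric.mem_ball] at hm; linarith)) _
            simp [this]
      _ = ((Z.filter fun z => dist (iter S.T (shift^[k] ω) l y) z < 5 * s).card : ℝ) := by
          rw [Finset.sum_ite]; simp
      _ ≤ N := hcard _
  have hGlip : ∀ (c : M → ℝ), (∀ z, |c z| ≤ 1) → ∀ y y',
      |∑ z ∈ Z, c z * G z y - ∑ z ∈ Z, c z * G z y'| ≤ 2 * N / s * dist y y' := by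
    intro c hc y y'
    rw [← Finset.sum_sub_distrib]
    refine (Finset.abs_sum_le_sum_abs _ _).trans ?_
    calc ∑ z ∈ Z, |c z * G z y - c z * G z y'|
        ≤ ∑ z ∈ Z, ((if dist y z < 5 * s then (1 : ℝ) else 0)
            + (if dist y' z < 5 * s then (1 : ℝ) else 0)) * (1 / s * dist y y') := by
          refine Finset.sum_le_sum fun z _ => ?_
          have hb : |c z * G z y - c z * G z y'| ≤ 1 / s * dist y y' := by
            rw [← mul_sub, abs_mul]
            calc _ ≤ 1 * |G z y - G z y'| := by gcongr; exact hc z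
              _ ≤ _ := by rw [one_mul]; exact abs_bump_sub_le z s hs y y'
          have hnn : 0 ≤ 1 / s * dist y y' := by positivity
          by_cases h1 : dist y z < 5 * s
          · rw [if_pos h1]
            refine hb.trans ?_
            split_ifs <;> linarith
          · by_cases h2 : dist y' z < 5 * s
            · rw [if_neg h1, if_pos h2]; linarith
            · have e1 : G z y = 0 := bump_eq_zero hs (by linarith)
              have e2 : G z y' = 0 := bump_eq_zero hs (by linarith)
              rw [if_neg h1, if_neg h2, e1, e2]; simp
      _ = (((Z.filter fun z => dist y z < 5 * s).card : ℝ)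
            + ((Z.filter fun z => dist y' z < 5 * s).card : ℝ)) * (1 / s * dist y y') := by
          rw [← Finset.sum_mul, Finset.sum_add_distrib, Finset.sum_ite, Finset.sum_ite]; simp
      _ ≤ (N + N) * (1 / s * dist y y') := by
          gcongr
          · exact hcard y
          · exact hcard y'
      _ = _ := by ring
  set I : M → M → ℝ := fun z w => (∫ y, G z y * F w (h (iter S.T ω k y)) ∂(S.μf ω))
    - (∫ y, G z y ∂(S.μf ω)) * ∫ y, F w (h y) ∂(S.μf (shift^[k] ω)) with hI
  obtain ⟨σ, hσ, hσI⟩ := exists_sign_sum_diag_le Z I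
  have hσ1 : ∀ z, |σ z| ≤ 1 := fun z => by rcases hσ z with h | h <;> simp [h]
  have hcorr : ∑ z ∈ Z, I z z ≤ |lam k| * (N + 2 * N / s) * N := by
    refine hσI.trans ?_
    have hdec := (hω.decay 0).holonomy hω.good hk a (G := fun y => ∑ z ∈ Z, σ z * G z y)
      (F := fun y => ∑ z ∈ Z, σ z * F z y) (K := N) (L := 2 * N / s) (C := N) (by positivity)
      (hGlip σ hσ1) (fun y => hGsum y σ hσ1)
      (Finset.measurable_sum _ fun z _ => (hFm z).const_mul _) (fun y => hFsum y σ hσ1)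
    refine (le_of_eq ?_).trans ((le_abs_self _).trans hdec)
    simp only [Function.iterate_zero, id_eq]
    have e1 : ∫ y, (∑ z ∈ Z, σ z * G z y) * (∑ w ∈ Z, σ w * F w (h (iter S.T ω k y))) ∂(S.μf ω)
        = ∑ z ∈ Z, ∑ w ∈ Z, σ z * σ w * ∫ y, G z y * F w (h (iter S.T ω k y)) ∂(S.μf ω) := by
      have : ∀ y, (∑ z ∈ Z, σ z * G z y) * (∑ w ∈ Z, σ w * F w (h (iter S.T ω k y)))
          = ∑ z ∈ Z, ∑ w ∈ Z, σ z * σ w * (G z y * F w (h (iter S.T ω k y))) := fun y => by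
        rw [Finset.sum_mul_sum]
        exact Finset.sum_congr rfl fun z _ => Finset.sum_congr rfl fun w _ => by ring
      simp only [this]
      rw [integral_finsetSum _ fun z _ => integrable_finsetSum _ fun w _ =>
        (hGFint z w).const_mul _]
      refine Finset.sum_congr rfl fun z _ => ?_
      rw [integral_finsetSum _ fun w _ => (hGFint z w).const_mul _]
      exact Finset.sum_congr rfl fun w _ => integral_const_mul _ _
    have e2 : ∫ y, ∑ z ∈ Z, σ z * G z y ∂(S.μf ω) = ∑ z ∈ Z, σ z * ∫ y, G z y ∂(S.μf ω) := by
      rw [integral_finsetSum _ fun z _ => (hGint z).const_mul _]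
      exact Finset.sum_congr rfl fun z _ => integral_const_mul _ _
    have e3 : ∫ y, ∑ z ∈ Z, σ z * F z (h y) ∂(S.μf (shift^[k] ω))
        = ∑ z ∈ Z, σ z * ∫ y, F z (h y) ∂(S.μf (shift^[k] ω)) := by
      rw [integral_finsetSum _ fun z _ => (hFint z).const_mul _]
      exact Finset.sum_congr rfl fun z _ => integral_const_mul _ _
    rw [← hh, e1, e2, e3, Finset.sum_mul_sum, ← Finset.sum_sub_distrib]
    refine Finset.sum_congr rfl fun z _ => ?_
    rw [← Finset.sum_sub_distrib]
    refine Finset.sum_congr rfl fun w _ => ?_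
    simp only [hI]; ring
  have hFh : ∀ z, ∫ y, F z (h y) ∂(S.μf (shift^[k] ω)) ≤ K * (|C₂| * 5 ^ u₀) * s ^ u₀ := by
    intro z
    have hb : MeasurableSet (Metric.ball z (5 * s)) := Metric.isOpen_ball.measurableSet
    calc ∫ y, F z (h y) ∂(S.μf (shift^[k] ω))
        ≤ ∫ y, (iter S.T (shift^[k] ω) l ⁻¹' Metric.ball z (5 * s)).indicator (fun _ => (1 : ℝ)) y
            ∂(S.μf (shift^[k] ω)) := by
          refine integral_mono (hFint z) ((integrable_const (1 : ℝ)).indicator (hTl hb)) fun y => ?_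
          by_cases hy : iter S.T (shift^[k] ω) l (h y) ∈ Metric.ball z (4 * s)
          · have : y ∈ iter S.T (shift^[k] ω) l ⁻¹' Metric.ball z (5 * s) := by
              rw [mem_preimage, Metric.mem_ball]
              rw [Metric.mem_ball] at hy
              have := dist_triangle (iter S.T (shift^[k] ω) l y) (iter S.T (shift^[k] ω) l (h y)) z
              linarith [hdist y]
            rw [Set.indicator_of_mem this]
            exact hF1 z _
          · have : F z (h y) = 0 := Set.indicator_of_notMem hy _
            rw [this]
            exact Set.indicator_nonneg (fun _ _ => zero_le_one) _
      _ = (S.μf (shift^[l] (shift^[k] ω))).real (Metric.ball z (5 * s)) := by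
          rw [integral_indicator (hTl hb), setIntegral_const, smul_eq_mul, mul_one,
            (hω.shift_iterate k).inv.measureReal_preimage l hb]
      _ ≤ K * S.μ.real (Metric.ball z (5 * s)) := ((hω.shift_iterate k).shift_iterate l).dom_real _
      _ ≤ K * (|C₂| * (5 * s) ^ u₀) := by
          gcongr
          refine (hball z (5 * s) (by positivity) hs2).trans ?_
          gcongr
          exact le_abs_self _
      _ = _ := by rw [Real.mul_rpow (by norm_num) hs.le]; ring
  have hGtot : ∑ z ∈ Z, ∫ y, G z y ∂(S.μf ω) ≤ N := by
    rw [← integral_finsetSum _ fun z _ => hGint z]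
    calc ∫ y, ∑ z ∈ Z, G z y ∂(S.μf ω) ≤ ∫ _, N ∂(S.μf ω) := by
          refine integral_mono (integrable_finsetSum _ fun z _ => hGint z) (integrable_const _)
            fun y => ?_
          have := hGsum y (fun _ => 1) (fun _ => by simp)
          simp only [one_mul] at this
          exact (le_abs_self _).trans this
      _ = N := by simp
  set W := {y | dist y (iter S.T ω (k + l) y) < 2 * s} with hW
  have hWm : MeasurableSet W :=
    measurableSet_lt (measurable_id.dist (S.measurable_T_iter ω (k + l))) measurable_const
  have hsupp : ∀ᵐ y ∂(S.μf ω), y ∈ S.μ.support := by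
    have h0 : S.μf ω S.μ.supportᶜ ≤ K * S.μ S.μ.supportᶜ := hω.dom 0 _
    rw [Measure.measure_compl_support, mul_zero] at h0
    exact le_antisymm h0 zero_le
  have hmain : (S.μf ω).real W ≤ ∑ z ∈ Z, ∫ y, G z y * F z (h (iter S.T ω k y)) ∂(S.μf ω) := by
    rw [← integral_finsetSum _ fun z _ => hGFint z z]
    have : (S.μf ω).real W = ∫ y, W.indicator (fun _ => (1 : ℝ)) y ∂(S.μf ω) := by
      rw [integral_indicator hWm]; simp
    rw [this]
    refine integral_mono_ae ((integrable_const (1 : ℝ)).indicator hWm)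
      (integrable_finsetSum _ fun z _ => hGFint z z) ?_
    filter_upwards [hsupp] with y hy
    have hnn : ∀ z ∈ Z, 0 ≤ G z y * F z (h (iter S.T ω k y)) := fun z _ =>
      mul_nonneg (bump_nonneg _ _ _ _) (hF0 _ _)
    by_cases hyW : y ∈ W
    · rw [Set.indicator_of_mem hyW]
      obtain ⟨z, hz, hyz⟩ := hZc y hy
      refine le_trans (le_of_eq ?_) (Finset.single_le_sum hnn hz)
      have e1 : G z y = 1 := bump_eq_one hs hyz
      have e2 : F z (h (iter S.T ω k y)) = 1 := by
        refine Set.indicator_of_mem ?_ _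
        rw [Metric.mem_ball]
        have hyW' : dist y (iter S.T ω (k + l) y) < 2 * s := hyW
        rw [iter_add] at hyW'
        have h1 := hdist (iter S.T ω k y)
        have h2 := dist_triangle (iter S.T (shift^[k] ω) l (h (iter S.T ω k y)))
          (iter S.T (shift^[k] ω) l (iter S.T ω k y)) z
        have h3 := dist_triangle (iter S.T (shift^[k] ω) l (iter S.T ω k y)) y z
        rw [dist_comm] at h1
        rw [dist_comm] at hyW'
        linarith
      rw [e1, e2, one_mul]
    · rw [Set.indicator_of_notMem hyW]
      exact Finset.sum_nonneg hnn
  have hprod : ∑ z ∈ Z, (∫ y, G z y ∂(S.μf ω)) * ∫ y, F z (h y) ∂(S.μf (shift^[k] ω))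
      ≤ N * (K * (|C₂| * 5 ^ u₀) * s ^ u₀) := by
    calc _ ≤ ∑ z ∈ Z, (∫ y, G z y ∂(S.μf ω)) * (K * (|C₂| * 5 ^ u₀) * s ^ u₀) := by
          refine Finset.sum_le_sum fun z _ => mul_le_mul_of_nonneg_left (hFh z) ?_
          exact integral_nonneg fun y => bump_nonneg _ _ _ _
      _ = (∑ z ∈ Z, ∫ y, G z y ∂(S.μf ω)) * (K * (|C₂| * 5 ^ u₀) * s ^ u₀) := by
          rw [Finset.sum_mul]
      _ ≤ _ := by gcongr
  have hsumI : ∑ z ∈ Z, I z z = ∑ z ∈ Z, ∫ y, G z y * F z (h (iter S.T ω k y)) ∂(S.μf ω)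
      - ∑ z ∈ Z, (∫ y, G z y ∂(S.μf ω)) * ∫ y, F z (h y) ∂(S.μf (shift^[k] ω)) := by
    rw [← Finset.sum_sub_distrib]
  have hlast : |lam k| * (N + 2 * N / s) * N ≤ 3 * N ^ 2 * (|lam k| / s) := by
    have : N ≤ N / s := by rw [le_div_iff₀ hs]; nlinarith
    calc |lam k| * (N + 2 * N / s) * N ≤ |lam k| * (N / s + 2 * N / s) * N := by gcongr
      _ = _ := by ring
  have hA : 0 ≤ s ^ u₀ := by positivity
  have hB : 0 ≤ |lam k| / s := by positivity
  have hA' : 0 ≤ N * (K * (|C₂| * 5 ^ u₀)) := by positivity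
  have hB' : 0 ≤ 3 * N ^ 2 := by positivity
  nlinarith [mul_nonneg hA' hB, mul_nonneg hB' hA]

end System

theorem eventually_const_mul_rpow_le (c : ℝ) {e : ℝ} (he : 0 < e) {ε : ℝ} (hε : 0 < ε) :
    ∀ᶠ ρ : ℝ in 𝓝[>] 0, c * ρ ^ e ≤ ε := by
  have h1 : Tendsto (fun ρ : ℝ => c * ρ ^ e) (𝓝[>] 0) (𝓝 (c * 0)) := by
    refine Tendsto.const_mul _ (Tendsto.mono_left ?_ nhdsWithin_le_nhds)
    have := (Real.continuousAt_rpow_const 0 e (Or.inr he.le)).tendsto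
    rwa [Real.zero_rpow he.ne'] at this
  rw [mul_zero] at h1
  exact h1.eventually_le_const hε

theorem integral_mul_indicator_comp {M : Type*} [MeasurableSpace M] {m : Measure M}
    {G : M → ℝ} {f : M → M} {E : Set M} :
    ∫ y, G y * E.indicator (fun _ => (1 : ℝ)) (f y) ∂m
      = ∫ y, (f ⁻¹' E).indicator G y ∂m := by
  congr 1
  ext y
  by_cases hy : f y ∈ E
  · rw [Set.indicator_of_mem hy, Set.indicator_of_mem (show y ∈ f ⁻¹' E from hy), mul_one]
  · rw [Set.indicator_of_notMem hy, Set.indicator_of_notMem (show y ∉ f ⁻¹' E from hy), mul_zero]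

namespace System

variable {ι A M U : Type*} [AddMonoidWithOne ι] [MeasurableSpace A]
    [MetricSpace M] [CompactSpace M] [MeasurableSpace M] [BorelSpace M]
    [MeasurableSpace U] {S : System ι A M U}

/-- The points of the fibre over `ω` whose orbit avoids `B` at the times `m < j ≤ n`. -/
def avoid (S : System ι A M U) (ω : ι → A) (B : Set M) (m n : ℕ) : Set M :=
  {y | ∀ j, m < j → j ≤ n → iter S.T ω j y ∉ B}

/-- The points of the fibre over `ω` whose orbit enters the sets `V i` at some time `m < i ≤ n`. -/
def visit (S : System ι A M U) (ω : ι → A) (V : ℕ → Set M) (m n : ℕ) : Set M :=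
  ⋃ i ∈ Finset.Ioc m n, iter S.T ω i ⁻¹' V i

theorem measurableSet_visit {ω : ι → A} {V : ℕ → Set M} (hV : ∀ i, MeasurableSet (V i)) (m n : ℕ) :
    MeasurableSet (S.visit ω V m n) :=
  Finset.measurableSet_biUnion _ fun i _ => S.measurable_T_iter ω i (hV i)

theorem avoid_eq_compl_visit (ω : ι → A) (B : Set M) (m n : ℕ) :
    S.avoid ω B m n = (S.visit ω (fun _ => B) m n)ᶜ := by
  ext y
  simp only [avoid, visit, mem_ofPred_eq, mem_compl_iff, mem_iUnion, Finset.mem_Ioc, mem_preimage,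
    exists_prop, not_exists, not_and]
  exact ⟨fun h j hj => h j hj.1 hj.2, fun h j h1 h2 => h j ⟨h1, h2⟩⟩

theorem measurableSet_avoid {ω : ι → A} {B : Set M} (hB : MeasurableSet B) (m n : ℕ) :
    MeasurableSet (S.avoid ω B m n) := by
  rw [avoid_eq_compl_visit]
  exact (measurableSet_visit (fun _ => hB) m n).compl

theorem InvariantAlong.measureReal_visit_le {ω : ι → A} (h : S.InvariantAlong ω) {V : ℕ → Set M}
    (hV : ∀ i, MeasurableSet (V i)) (m n : ℕ) :
    (S.μf ω).real (S.visit ω V m n) ≤ ∑ i ∈ Finset.Ioc m n, (S.μf (shift^[i] ω)).real (V i) := by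
  refine (measureReal_biUnion_finset_le _ _).trans (Finset.sum_le_sum fun i _ => ?_)
  rw [h.measureReal_preimage i (hV i)]

/-- Decorrelation of a ball and of the event that an orbit avoids it after a long gap. -/
theorem RegularAt.abs_inter_avoid_sub_le {lam δ : ℕ → ℝ} {K : ℝ≥0} {C ρ₀ ξ : ℝ} {ω : ι → A}
    (hω : S.RegularAt lam K C ρ₀ ξ ω) (hVI : S.Contraction δ) {x : M} (hx : x ∈ S.μ.support)
    {ρ r : ℝ} (hr : 0 < r) (hrρ : r < ρ) (hρ : ρ < ρ₀) {k : ℕ} (hk : 1 ≤ k) (n : ℕ)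
    {q : ℕ → ℝ} (hq : ∀ i, k < i → 0 < q i ∧ δ i ≤ q i ∧ 3 * q i < ρ) :
    |(S.μf ω).real (Metric.ball x ρ ∩ S.avoid ω (Metric.ball x ρ) (k + k) n)
        - (S.μf ω).real (Metric.ball x ρ)
          * (S.μf ω).real (S.avoid ω (Metric.ball x ρ) (k + k) n)|
      ≤ 2 * (C * (r ^ ξ / ρ ^ ξ) * S.μ.real (Metric.ball x ρ)) + 2 * (|lam k| * (1 + 1 / r))
        + 2 * ((S.μf ω).real (Metric.ball x (ρ + r))
          * ∑ i ∈ Finset.Ioc k (n - k), C * ((3 * q i) ^ ξ / ρ ^ ξ) * S.μ.real (Metric.ball x ρ)) := by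
  have hgk := S.shift_iterate_good hω.good k
  obtain ⟨a⟩ : Nonempty U := by
    have := S.prob_υ ω hω.good
    exact nonempty_of_isProbabilityMeasure (S.υ ω)
  set B := Metric.ball x ρ with hB
  have hBm : MeasurableSet B := Metric.isOpen_ball.measurableSet
  set m := S.μf ω with hm
  set ω' := shift^[k] ω with hω'
  set m' := S.μf ω' with hm'
  set T := iter S.T ω k with hT
  have hTm : Measurable T := S.measurable_T_iter ω k
  set h := holonomy (S.stab ω') (S.unst ω' a) with hh
  have hhm : Measurable h := S.meas_holonomy _ hgk a
  have hdist : ∀ i, k < i → ∀ y, dist (iter S.T ω' i y) (iter S.T ω' i (h y)) ≤ q i :=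
    fun i hi y => hVI.dist_holonomy_le hgk a (by omega) (hq i hi).1.le (hq i hi).2.1 y
  set ann : ℝ → ℕ → Set M := fun c i =>
    Metric.ball x (ρ + c * q i) \ Metric.ball x (ρ - c * q i) with hann
  have hannm : ∀ c i, MeasurableSet (ann c i) := fun c i =>
    Metric.isOpen_ball.measurableSet.diff Metric.isOpen_ball.measurableSet
  set E := S.avoid ω' B k (n - k) with hE
  have hEm : MeasurableSet E := measurableSet_avoid hBm _ _
  set W : ℝ → Set M := fun c => S.visit ω' (ann c) k (n - k) with hW
  have hWm : ∀ c, MeasurableSet (W c) := fun c => measurableSet_visit (hannm c) _ _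
  have hmemW : ∀ c y, y ∈ W c ↔ ∃ i, (k < i ∧ i ≤ n - k) ∧ iter S.T ω' i y ∈ ann c i := by
    intro c y
    simp only [hW, visit, mem_iUnion, Finset.mem_Ioc, mem_preimage, exists_prop]
  set Wsum := ∑ i ∈ Finset.Ioc k (n - k), C * ((3 * q i) ^ ξ / ρ ^ ξ) * S.μ.real B with hWsum
  have hW3 : m'.real (W 3) ≤ Wsum := by
    refine ((hω.shift_iterate k).inv.measureReal_visit_le (hannm 3) k (n - k)).trans ?_
    refine Finset.sum_le_sum fun i hi => ?_
    have hi' := hq i (Finset.mem_Ioc.1 hi).1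
    exact (hω.shift_iterate k).annulus i x hx ρ (3 * q i) (by linarith) hi'.2.2 hρ
  have hA : S.avoid ω B (k + k) n = T ⁻¹' E := by
    ext y
    simp only [avoid, mem_ofPred_eq, hE, mem_preimage]
    constructor
    · intro hy i hi1 hi2
      rw [hω', hT, ← iter_add]
      exact hy (k + i) (by omega) (by omega)
    · intro hy j hj1 hj2
      obtain ⟨i, rfl⟩ : ∃ i, j = k + i := ⟨j - k, by omega⟩
      rw [iter_add]
      exact hy i (by omega) (by omega)
  have hmA : m.real (S.avoid ω B (k + k) n) = m'.real E := by
    rw [hA]; exact hω.inv.measureReal_preimage k hEm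
  have hstep : ∀ c i y z, k < i → dist (iter S.T ω' i y) (iter S.T ω' i z) ≤ q i →
      iter S.T ω' i y ∈ ann c i → iter S.T ω' i z ∈ ann (c + 1) i := by
    intro c i y z hi hd hy
    have h1 := dist_triangle (iter S.T ω' i z) (iter S.T ω' i y) x
    have h2 := dist_triangle (iter S.T ω' i y) (iter S.T ω' i z) x
    rw [dist_comm (iter S.T ω' i z) (iter S.T ω' i y)] at h1
    obtain ⟨hy1, hy2⟩ := hy
    rw [Metric.mem_ball] at hy1 hy2
    refine ⟨?_, ?_⟩ <;> rw [Metric.mem_ball] <;> linarith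
  have hW12 : ∀ y, y ∈ W 1 → h y ∈ W 2 := by
    intro y hy
    obtain ⟨i, hi, hyi⟩ := (hmemW 1 y).1 hy
    refine (hmemW 2 _).2 ⟨i, hi, ?_⟩
    have := hstep 1 i y (h y) hi.1 (hdist i hi.1 y) hyi
    norm_num at this
    exact this
  have hW23 : ∀ y, h y ∈ W 2 → y ∈ W 3 := by
    intro y hy
    obtain ⟨i, hi, hyi⟩ := (hmemW 2 _).1 hy
    refine (hmemW 3 _).2 ⟨i, hi, ?_⟩
    have := hstep 2 i (h y) y hi.1 (by rw [dist_comm]; exact hdist i hi.1 y) hyi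
    norm_num at this
    exact this
  have hEW : ∀ y, (¬ (y ∈ E ↔ h y ∈ E)) → y ∈ W 1 := by
    intro y hy
    by_contra hyW
    refine hy ?_
    have key : ∀ i, k < i → i ≤ n - k → (iter S.T ω' i y ∈ B ↔ iter S.T ω' i (h y) ∈ B) := by
      intro i hi1 hi2
      have hn : iter S.T ω' i y ∉ ann 1 i := fun hc => hyW ((hmemW 1 y).2 ⟨i, ⟨hi1, hi2⟩, hc⟩)
      have hd := hdist i hi1 y
      have h1 := dist_triangle (iter S.T ω' i (h y)) (iter S.T ω' i y) x
      have h2 := dist_triangle (iter S.T ω' i y) (iter S.T ω' i (h y)) x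
      rw [dist_comm (iter S.T ω' i (h y)) (iter S.T ω' i y)] at h1
      have hqi := (hq i hi1).1
      simp only [hann, one_mul, Set.mem_sdiff, Metric.mem_ball, not_and, not_not] at hn
      simp only [hB, Metric.mem_ball]
      constructor
      · intro h3
        have := hn (by linarith)
        linarith
      · intro h3
        have := hn (by linarith)
        linarith
    constructor
    · intro h1 i hi1 hi2 h2
      exact h1 i hi1 hi2 ((key i hi1 hi2).2 h2)
    · intro h1 i hi1 hi2 h2
      exact h1 i hi1 hi2 ((key i hi1 hi2).1 h2)
  set G := bump x ρ r with hG
  have hGm : Measurable G := measurable_bump x ρ hr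
  have hG0 : ∀ y, 0 ≤ G y := bump_nonneg x ρ r
  have hG1 : ∀ y, G y ≤ 1 := bump_le_one x ρ r
  have hGa : ∀ y, |G y| ≤ 1 := fun y => by rw [abs_of_nonneg (hG0 y)]; exact hG1 y
  have hGi : Integrable G m :=
    Integrable.of_bound hGm.aestronglyMeasurable 1 (Eventually.of_forall hGa)
  have hGind : ∀ {E' : Set M}, MeasurableSet E' → Integrable (E'.indicator G) m :=
    fun hE' => hGi.indicator hE'
  have h1i : ∀ {E' : Set M} {m₁ : Measure M} [IsFiniteMeasure m₁], MeasurableSet E' →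
      Integrable (E'.indicator fun _ => (1 : ℝ)) m₁ :=
    fun hE' => (integrable_const (1 : ℝ)).indicator hE'
  have hdec : ∀ {E' : Set M}, MeasurableSet E' →
      |∫ y, (T ⁻¹' (h ⁻¹' E')).indicator G y ∂m - (∫ y, G y ∂m) * m'.real (h ⁻¹' E')|
        ≤ |lam k| * (1 + 1 / r) := by
    intro E' hE'
    have := (hω.decay 0).holonomy hω.good hk a (G := G)
      (F := E'.indicator fun _ => (1 : ℝ)) (K := 1) (L := 1 / r) (C := 1) (by positivity)
      (abs_bump_sub_le x ρ hr) hGa (measurable_const.indicator hE')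
      (fun y => by
        by_cases hy : y ∈ E'
        · rw [Set.indicator_of_mem hy]; simp
        · rw [Set.indicator_of_notMem hy]; simp)
    simp only [Function.iterate_zero, id_eq, mul_one] at this
    have e1 := integral_mul_indicator_comp (m := m) (G := G) (f := fun y => h (T y)) (E := E')
    have e2 : ∫ y, E'.indicator (fun _ => (1 : ℝ)) (h y) ∂m' = m'.real (h ⁻¹' E') := by
      have : ∀ y, E'.indicator (fun _ => (1 : ℝ)) (h y)
          = (h ⁻¹' E').indicator (fun _ => (1 : ℝ)) y := fun y => rfl
      simp only [this]
      rw [integral_indicator (hhm hE')]; simp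
    rw [e1, e2] at this
    exact this
  set g := ∫ y, G y ∂m with hg
  have hg0 : 0 ≤ g := integral_nonneg hG0
  have hgle : g ≤ m.real (Metric.ball x (ρ + r)) := by
    have hb : MeasurableSet (Metric.ball x (ρ + r)) := Metric.isOpen_ball.measurableSet
    calc g ≤ ∫ y, (Metric.ball x (ρ + r)).indicator (fun _ => (1 : ℝ)) y ∂m := by
          refine integral_mono hGi (h1i hb) fun y => ?_
          by_cases hy : y ∈ Metric.ball x (ρ + r)
          · rw [Set.indicator_of_mem hy]; exact hG1 y
          · rw [Set.indicator_of_notMem hy]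
            exact (bump_eq_zero hr (by rw [Metric.mem_ball] at hy; linarith)).le
      _ = _ := by rw [integral_indicator hb]; simp
  have e1 : |∫ y, (T ⁻¹' E).indicator G y ∂m - ∫ y, (T ⁻¹' (h ⁻¹' E)).indicator G y ∂m|
      ≤ ∫ y, (T ⁻¹' (h ⁻¹' W 2)).indicator G y ∂m := by
    rw [← integral_sub (hGind (hTm hEm)) (hGind (hTm (hhm hEm)))]
    refine (abs_integral_le_integral_abs).trans ?_
    refine integral_mono ((hGind (hTm hEm)).sub (hGind (hTm (hhm hEm)))).abs
      (hGind (hTm (hhm (hWm 2)))) fun y => ?_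
    have hnn : 0 ≤ (T ⁻¹' (h ⁻¹' W 2)).indicator G y := Set.indicator_nonneg (fun y _ => hG0 y) y
    by_cases hiff : T y ∈ E ↔ h (T y) ∈ E
    · have : (T ⁻¹' E).indicator G y = (T ⁻¹' (h ⁻¹' E)).indicator G y := by
        by_cases hy : T y ∈ E
        · rw [Set.indicator_of_mem (show y ∈ T ⁻¹' E from hy),
            Set.indicator_of_mem (show y ∈ T ⁻¹' (h ⁻¹' E) from hiff.1 hy)]
        · rw [Set.indicator_of_notMem (show y ∉ T ⁻¹' E from hy),
            Set.indicator_of_notMem (show y ∉ T ⁻¹' (h ⁻¹' E) from fun h' => hy (hiff.2 h'))]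
      beta_reduce
      rw [this, sub_self, abs_zero]; exact hnn
    · have hy2 : y ∈ T ⁻¹' (h ⁻¹' W 2) := hW12 _ (hEW _ hiff)
      rw [Set.indicator_of_mem hy2]
      have b1 : 0 ≤ (T ⁻¹' E).indicator G y ∧ (T ⁻¹' E).indicator G y ≤ G y :=
        ⟨Set.indicator_nonneg (fun y _ => hG0 y) y, Set.indicator_le_self' (fun y _ => hG0 y) y⟩
      have b2 : 0 ≤ (T ⁻¹' (h ⁻¹' E)).indicator G y ∧ (T ⁻¹' (h ⁻¹' E)).indicator G y ≤ G y :=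
        ⟨Set.indicator_nonneg (fun y _ => hG0 y) y, Set.indicator_le_self' (fun y _ => hG0 y) y⟩
      beta_reduce
      rw [abs_le]
      constructor <;> linarith
  have e2 := hdec hEm
  have e3 := hdec (hWm 2)
  have e4 : m'.real (h ⁻¹' W 2) ≤ Wsum := (measureReal_mono hW23).trans hW3
  have e5 : |m'.real (h ⁻¹' E) - m'.real E| ≤ Wsum := by
    have hd : ∀ E₁ E₂ : Set M, (∀ y ∈ E₁, y ∉ E₂ → y ∈ W 3) → m'.real E₁ - m'.real E₂ ≤ Wsum := by
      intro E₁ E₂ h12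
      have : m'.real E₁ ≤ m'.real E₂ + m'.real (W 3) := by
        refine (measureReal_mono fun y hy => ?_).trans (measureReal_union_le _ _)
        by_cases h2 : y ∈ E₂
        · exact Or.inl h2
        · exact Or.inr (h12 y hy h2)
      linarith
    have hW13 : ∀ y, (¬ (y ∈ E ↔ h y ∈ E)) → y ∈ W 3 := fun y hy => hW23 y (hW12 y (hEW y hy))
    rw [abs_le]
    constructor
    · have := hd E (h ⁻¹' E) fun y h1 h2 => hW13 y fun h3 => h2 (h3.1 h1)
      linarith
    · exact hd (h ⁻¹' E) E fun y h1 h2 => hW13 y fun h3 => h2 (h3.2 h1)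
  have hWs0 : 0 ≤ Wsum := measureReal_nonneg.trans hW3
  have hmain : |∫ y, (T ⁻¹' E).indicator G y ∂m - g * m'.real E|
      ≤ 2 * (|lam k| * (1 + 1 / r)) + 2 * (m.real (Metric.ball x (ρ + r)) * Wsum) := by
    have p1 : g * m'.real (h ⁻¹' W 2) ≤ m.real (Metric.ball x (ρ + r)) * Wsum :=
      mul_le_mul hgle e4 measureReal_nonneg measureReal_nonneg
    have p2 : |g * m'.real (h ⁻¹' E) - g * m'.real E| ≤ m.real (Metric.ball x (ρ + r)) * Wsum := by
      rw [← mul_sub, abs_mul, abs_of_nonneg hg0]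
      exact mul_le_mul hgle e5 (abs_nonneg _) measureReal_nonneg
    rw [abs_le] at e1 e2 e3 p2 ⊢
    constructor <;> linarith [e1.1, e1.2, e2.1, e2.2, e3.1, e3.2, p2.1, p2.2]
  set α := m.real (Metric.ball x (ρ + r) \ Metric.ball x (ρ - r)) with hα
  have hαle : α ≤ C * (r ^ ξ / ρ ^ ξ) * S.μ.real B := hω.annulus 0 x hx ρ r hr hrρ hρ
  have hdiff : ∀ {A' : Set M}, MeasurableSet A' →
      |m.real (B ∩ A') - ∫ y, A'.indicator G y ∂m| ≤ α := by
    intro A' hA'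
    have hRm : MeasurableSet (Metric.ball x (ρ + r) \ Metric.ball x (ρ - r)) :=
      Metric.isOpen_ball.measurableSet.diff Metric.isOpen_ball.measurableSet
    have q1 : m.real (B ∩ A') = ∫ y, (B ∩ A').indicator (fun _ => (1 : ℝ)) y ∂m := by
      rw [integral_indicator (hBm.inter hA')]; simp
    have q2 : α = ∫ y, (Metric.ball x (ρ + r) \ Metric.ball x (ρ - r)).indicator
        (fun _ => (1 : ℝ)) y ∂m := by
      rw [integral_indicator hRm]; simp [hα]
    rw [q1, q2, ← integral_sub (h1i (hBm.inter hA')) (hGind hA')]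
    refine abs_integral_le_integral_abs.trans ?_
    refine integral_mono ((h1i (hBm.inter hA')).sub (hGind hA')).abs (h1i hRm) fun y => ?_
    have hnn : 0 ≤ (Metric.ball x (ρ + r) \ Metric.ball x (ρ - r)).indicator
        (fun _ => (1 : ℝ)) y := Set.indicator_nonneg (fun _ _ => zero_le_one) y
    beta_reduce
    by_cases hyA : y ∈ A'
    · rw [Set.indicator_of_mem hyA]
      by_cases hyB : y ∈ B
      · rw [Set.indicator_of_mem (show y ∈ B ∩ A' from ⟨hyB, hyA⟩)]
        have : G y = 1 := bump_eq_one hr (Metric.mem_ball.1 hyB).le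
        rw [this, sub_self, abs_zero]; exact hnn
      · rw [Set.indicator_of_notMem (show y ∉ B ∩ A' from fun h' => hyB h'.1), zero_sub, abs_neg]
        by_cases hyR : y ∈ Metric.ball x (ρ + r)
        · rw [Set.indicator_of_mem (show y ∈ Metric.ball x (ρ + r) \ Metric.ball x (ρ - r) from
            ⟨hyR, fun h' => hyB (Metric.ball_subset_ball (by linarith) h')⟩)]
          exact hGa y
        · have : G y = 0 := bump_eq_zero hr (by rw [Metric.mem_ball] at hyR; linarith)
          rw [this, abs_zero]; exact hnn
    · rw [Set.indicator_of_notMem hyA,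
        Set.indicator_of_notMem (show y ∉ B ∩ A' from fun h' => hyA h'.2), sub_zero, abs_zero]
      exact hnn
  have f1 := hdiff (hTm hEm)
  have f2 : |m.real B - g| ≤ α := by
    have := hdiff (A' := univ) MeasurableSet.univ
    simpa [hg] using this
  have hE1 : m'.real E ≤ 1 := measureReal_le_one
  have hE0 : 0 ≤ m'.real E := measureReal_nonneg
  have f3 : |m.real B * m'.real E - g * m'.real E| ≤ α := by
    rw [← sub_mul, abs_mul, abs_of_nonneg hE0]
    calc |m.real B - g| * m'.real E ≤ |m.real B - g| * 1 := by gcongr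
      _ ≤ α := by rw [mul_one]; exact f2
  rw [hmA, hA]
  rw [abs_le] at f1 f3 hmain ⊢
  constructor <;> linarith [f1.1, f1.2, f3.1, f3.2, hmain.1, hmain.2]

/-- Decorrelation of a ball and of the event that an orbit avoids it, up to short returns. -/
theorem RegularAt.abs_inter_avoid_zero_sub_le {lam : ℕ → ℝ} {K : ℝ≥0} {C ρ₀ ξ : ℝ} {ω : ι → A}
    (hω : S.RegularAt lam K C ρ₀ ξ ω) {B : Set M} (hB : MeasurableSet B) (k n : ℕ) :
    |(S.μf ω).real (B ∩ S.avoid ω B 0 n) - (S.μf ω).real B * (S.μf ω).real (S.avoid ω B 0 n)|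
      ≤ (S.μf ω).real (B ∩ S.visit ω (fun _ => B) 0 k)
        + K * S.μ.real B * (k * (K * S.μ.real B))
        + |(S.μf ω).real (B ∩ S.avoid ω B k n)
            - (S.μf ω).real B * (S.μf ω).real (S.avoid ω B k n)| := by
  set Q := S.visit ω (fun _ => B) 0 k with hQ
  have hsub : S.avoid ω B 0 n ⊆ S.avoid ω B k n := fun y hy j hj hjn => hy j (by omega) hjn
  have hsub' : S.avoid ω B k n ⊆ S.avoid ω B 0 n ∪ Q := by
    intro y hy
    by_cases hyQ : y ∈ Q
    · exact Or.inr hyQ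
    · refine Or.inl fun j hj hjn hjB => ?_
      by_cases hjk : j ≤ k
      · refine hyQ ?_
        simp only [hQ, visit, mem_iUnion, Finset.mem_Ioc, mem_preimage, exists_prop]
        exact ⟨j, ⟨hj, hjk⟩, hjB⟩
      · exact hy j (by omega) hjn hjB
  have a1 : (S.μf ω).real (B ∩ S.avoid ω B 0 n) ≤ (S.μf ω).real (B ∩ S.avoid ω B k n) :=
    measureReal_mono (inter_subset_inter_right _ hsub)
  have a2 : (S.μf ω).real (B ∩ S.avoid ω B k n)
      ≤ (S.μf ω).real (B ∩ S.avoid ω B 0 n) + (S.μf ω).real (B ∩ Q) := by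
    refine (measureReal_mono ?_).trans (measureReal_union_le _ _)
    rw [← inter_union_distrib_left]
    exact inter_subset_inter_right _ hsub'
  have a3 : (S.μf ω).real (S.avoid ω B 0 n) ≤ (S.μf ω).real (S.avoid ω B k n) :=
    measureReal_mono hsub
  have a4 : (S.μf ω).real (S.avoid ω B k n)
      ≤ (S.μf ω).real (S.avoid ω B 0 n) + (S.μf ω).real Q :=
    (measureReal_mono hsub').trans (measureReal_union_le _ _)
  have a5 : (S.μf ω).real Q ≤ k * (K * S.μ.real B) := by
    refine (hω.inv.measureReal_visit_le (fun _ => hB) 0 k).trans ?_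
    refine (Finset.sum_le_sum fun i _ => (hω.shift_iterate i).dom_real B).trans ?_
    simp
  have a6 : (S.μf ω).real B ≤ K * S.μ.real B := hω.dom_real B
  have b0 : 0 ≤ (S.μf ω).real B := measureReal_nonneg
  have b1 : 0 ≤ (S.μf ω).real Q := measureReal_nonneg
  have b2 : 0 ≤ (S.μf ω).real (B ∩ Q) := measureReal_nonneg
  have a7 : (S.μf ω).real B * (S.μf ω).real Q ≤ K * S.μ.real B * (k * (K * S.μ.real B)) :=
    mul_le_mul a6 a5 b1 (b0.trans a6)
  have a8 : 0 ≤ (S.μf ω).real B * (S.μf ω).real Q := mul_nonneg b0 b1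
  set X := (S.μf ω).real (B ∩ S.avoid ω B k n)
            - (S.μf ω).real B * (S.μf ω).real (S.avoid ω B k n) with hX
  have c1 := le_abs_self X
  have c2 := neg_abs_le X
  have c3 : (S.μf ω).real B * (S.μf ω).real (S.avoid ω B 0 n)
      ≤ (S.μf ω).real B * (S.μf ω).real (S.avoid ω B k n) := by gcongr
  have c4 : (S.μf ω).real B * (S.μf ω).real (S.avoid ω B k n)
      ≤ (S.μf ω).real B * (S.μf ω).real (S.avoid ω B 0 n) + (S.μf ω).real B * (S.μf ω).real Q := by
    rw [← mul_add]; gcongr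
  rw [abs_le]
  constructor <;> linarith

set_option maxHeartbeats 1000000 in
/-- The decorrelation error is of smaller order than the measure of the ball, apart from the short
returns. -/
theorem eventually_abs_inter_avoid_sub_le {lam δ : ℕ → ℝ} (hVI : S.Contraction δ)
    {K D : ℝ≥0} {C ρ₀ ξ : ℝ} (hC : 0 < C) (hρ₀ : 0 < ρ₀) (hξ : 0 < ξ)
    {Cδ κ : ℝ} (hCδ : 0 < Cδ) (hδ : ∀ n : ℕ, 1 ≤ n → |δ n| ≤ Cδ * (n : ℝ) ^ (-κ))
    {Cl p : ℝ} (hCl : 0 < Cl) (hlam : ∀ n : ℕ, 1 ≤ n → |lam n| ≤ Cl * (n : ℝ) ^ (-p))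
    {ρ₁ : ℝ} (hρ₁ : 0 < ρ₁) (hD : ∀ x ∈ S.μ.support, ∀ ρ : ℝ, 0 < ρ → ρ < ρ₁ →
      S.μ (Metric.ball x (4 * ρ)) ≤ D * S.μ (Metric.ball x ρ))
    {C₂ ρ₂ u₀ : ℝ} (hC₂ : 0 < C₂) (hρ₂ : 0 < ρ₂)
    (hball : ∀ x, ∀ ρ : ℝ, 0 < ρ → ρ < ρ₂ → S.μ.real (Metric.ball x ρ) ≤ C₂ * ρ ^ u₀)
    {d₁ ρ₃ : ℝ} (hρ₃ : 0 < ρ₃) (hdim : ∀ x ∈ S.μ.support, ∀ ρ : ℝ, 0 < ρ → ρ < ρ₃ →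
      ρ ^ d₁ ≤ S.μ.real (Metric.ball x ρ))
    {v q : ℝ} (hv : 0 < v) (hvu : v < u₀) (hp : 0 < p) (hvp : 1 + d₁ < p * v) (hκ : 0 < κ)
    (hvκ : 1 < v * κ) (hq : 1 < q) (hqκ : q < κ * ξ) (hvq : ξ < v * (κ * ξ - q) + u₀)
    {ε : ℝ} (hε : 0 < ε) :
    ∀ᶠ ρ : ℝ in 𝓝[>] 0, ∀ x ∈ S.μ.support, ∀ ω, S.RegularAt lam K C ρ₀ ξ ω → ∀ n : ℕ,
      |(S.μf ω).real (Metric.ball x ρ ∩ S.avoid ω (Metric.ball x ρ) 0 n)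
          - (S.μf ω).real (Metric.ball x ρ) * (S.μf ω).real (S.avoid ω (Metric.ball x ρ) 0 n)|
        ≤ (S.μf ω).real (Metric.ball x ρ ∩
            S.visit ω (fun _ => Metric.ball x ρ) 0 (⌈ρ ^ (-v)⌉₊ + ⌈ρ ^ (-v)⌉₊))
          + ε * S.μ.real (Metric.ball x ρ) := by
  obtain ⟨η, hη1, hη0, hηε⟩ : ∃ η : ℝ, η < 1 ∧ 0 < η ∧ 2 * C * η ^ ξ ≤ ε / 4 := by
    have h1 := eventually_const_mul_rpow_le (2 * C) hξ (show 0 < ε / 4 by positivity)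
    have h2 : ∀ᶠ η : ℝ in 𝓝[>] 0, η ∈ Ioo (0 : ℝ) 1 := Ioo_mem_nhdsGT one_pos
    obtain ⟨η, h3, h4⟩ := (h1.and h2).exists
    exact ⟨η, h4.2, h4.1, h3⟩
  set sq : ℝ := ∑' i : ℕ, (i : ℝ) ^ (-q) with hsq
  have hsum : Summable fun i : ℕ => (i : ℝ) ^ (-q) := Real.summable_nat_rpow.2 (by linarith)
  have hsq0 : 0 ≤ sq := tsum_nonneg fun i => Real.rpow_nonneg (Nat.cast_nonneg _) _
  have ev1 := eventually_const_mul_rpow_le (4 * (K : ℝ) ^ 2 * C₂) (sub_pos.2 hvu)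
    (show 0 < ε / 4 by positivity)
  have ev2 := eventually_const_mul_rpow_le (4 * Cl / η) (show 0 < p * v - 1 - d₁ by linarith)
    (show 0 < ε / 4 by positivity)
  have ev3 := eventually_const_mul_rpow_le (2 * (K * D) * C₂ * (C * (3 * Cδ) ^ ξ * sq))
    (show 0 < v * (κ * ξ - q) + u₀ - ξ by linarith) (show 0 < ε / 4 by positivity)
  have ev4 := eventually_const_mul_rpow_le (3 * Cδ) (show 0 < v * κ - 1 by linarith)
    (show (0 : ℝ) < 1 / 2 by positivity)
  have hmin : 0 < min (min ρ₀ ρ₁) (min (min ρ₂ ρ₃) 1) := by positivity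
  filter_upwards [ev1, ev2, ev3, ev4, Ioo_mem_nhdsGT hmin] with ρ e1 e2 e3 e4 hρ x hx ω hω n
  obtain ⟨hρ0, hρlt⟩ := hρ
  simp only [lt_min_iff] at hρlt
  obtain ⟨⟨hρa, hρb⟩, ⟨hρc, hρd⟩, hρe⟩ := hρlt
  set B := Metric.ball x ρ with hB
  have hBm : MeasurableSet B := Metric.isOpen_ball.measurableSet
  set b := S.μ.real B with hb
  have hb0 : 0 < b := μ_ball_pos hx hρ0
  have hbu : b ≤ C₂ * ρ ^ u₀ := hball x ρ hρ0 hρc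
  have hbd : ρ ^ d₁ ≤ b := hdim x hx ρ hρ0 hρd
  set k := ⌈ρ ^ (-v)⌉₊ with hk
  have hρv : 1 ≤ ρ ^ (-v) := Real.one_le_rpow_of_pos_of_le_one_of_nonpos hρ0 hρe.le (by linarith)
  have hk1 : ρ ^ (-v) ≤ k := Nat.le_ceil _
  have hk2 : (k : ℝ) ≤ 2 * ρ ^ (-v) := by
    have := (Nat.ceil_lt_add_one (by linarith : (0 : ℝ) ≤ ρ ^ (-v))).le
    linarith
  have hk3 : 1 ≤ k := by exact_mod_cast hρv.trans hk1
  have hkpos : (0 : ℝ) < k := by linarith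
  have hkneg : ∀ e : ℝ, 0 < e → (k : ℝ) ^ (-e) ≤ ρ ^ (v * e) := by
    intro e he
    calc (k : ℝ) ^ (-e) ≤ (ρ ^ (-v)) ^ (-e) :=
          Real.rpow_le_rpow_of_nonpos (by linarith) hk1 (by linarith)
      _ = ρ ^ (v * e) := by rw [← Real.rpow_mul hρ0.le]; ring_nf
  set r := η * ρ with hr
  have hr0 : 0 < r := by positivity
  have hrρ : r < ρ := mul_lt_of_lt_one_left hρ0 hη1
  set qq : ℕ → ℝ := fun i => Cδ * (i : ℝ) ^ (-κ) with hqq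
  have hqq' : ∀ i, k < i → 0 < qq i ∧ δ i ≤ qq i ∧ 3 * qq i < ρ := by
    intro i hi
    have hi1 : 1 ≤ i := by omega
    have hi0 : (0 : ℝ) < i := by exact_mod_cast hi1
    refine ⟨by positivity, (le_abs_self _).trans (hδ i hi1), ?_⟩
    have h1 : (i : ℝ) ^ (-κ) ≤ ρ ^ (v * κ) :=
      (Real.rpow_le_rpow_of_nonpos hkpos (by exact_mod_cast hi.le) (by linarith)).trans
        (hkneg κ hκ)
    have h2 : ρ ^ (v * κ) = ρ ^ (v * κ - 1) * ρ := by
      rw [← Real.rpow_add_one hρ0.ne']; ring_nf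
    calc 3 * qq i ≤ 3 * (Cδ * ρ ^ (v * κ)) := by simp only [hqq]; gcongr
      _ = 3 * Cδ * ρ ^ (v * κ - 1) * ρ := by rw [h2]; ring
      _ ≤ 1 / 2 * ρ := by gcongr
      _ < ρ := by linarith
  have hmain := hω.abs_inter_avoid_sub_le hVI hx hr0 hrρ hρa hk3 n hqq'
  have hfirst := hω.abs_inter_avoid_zero_sub_le hBm (k + k) n
  have t1 : K * b * (((k + k : ℕ) : ℝ) * (K * b)) ≤ ε / 4 * b := by
    have : K * b * (((k + k : ℕ) : ℝ) * (K * b)) = 2 * (K : ℝ) ^ 2 * (k * b) * b := by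
      push_cast; ring
    rw [this]
    refine mul_le_mul_of_nonneg_right (le_trans ?_ e1) hb0.le
    have h1 : (k : ℝ) * b ≤ 2 * C₂ * ρ ^ (u₀ - v) := by
      calc (k : ℝ) * b ≤ 2 * ρ ^ (-v) * (C₂ * ρ ^ u₀) := by gcongr
        _ = 2 * C₂ * (ρ ^ u₀ * ρ ^ (-v)) := by ring
        _ = _ := by rw [← Real.rpow_add hρ0]; ring_nf
    calc 2 * (K : ℝ) ^ 2 * (k * b) ≤ 2 * (K : ℝ) ^ 2 * (2 * C₂ * ρ ^ (u₀ - v)) := by gcongr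
      _ = _ := by ring
  have t2 : 2 * (C * (r ^ ξ / ρ ^ ξ) * b) ≤ ε / 4 * b := by
    have : r ^ ξ / ρ ^ ξ = η ^ ξ := by
      rw [hr, Real.mul_rpow hη0.le hρ0.le, mul_div_assoc, div_self (Real.rpow_pos_of_pos hρ0 _).ne',
        mul_one]
    rw [this]
    calc 2 * (C * η ^ ξ * b) = 2 * C * η ^ ξ * b := by ring
      _ ≤ ε / 4 * b := by gcongr
  have t3 : 2 * (|lam k| * (1 + 1 / r)) ≤ ε / 4 * b := by
    have h1 : |lam k| ≤ Cl * ρ ^ (v * p) :=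
      (hlam k hk3).trans (mul_le_mul_of_nonneg_left (hkneg p hp) hCl.le)
    have h2 : 1 + 1 / r ≤ 2 / η * ρ⁻¹ := by
      have : (1 : ℝ) ≤ 1 / r := by rw [le_div_iff₀ hr0]; linarith
      calc 1 + 1 / r ≤ 1 / r + 1 / r := by linarith
        _ = _ := by rw [hr]; field_simp; norm_num
    calc 2 * (|lam k| * (1 + 1 / r)) ≤ 2 * (Cl * ρ ^ (v * p) * (2 / η * ρ⁻¹)) := by gcongr
      _ = 4 * Cl / η * (ρ ^ (v * p) * ρ ^ (-1 : ℝ)) := by rw [Real.rpow_neg_one]; ring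
      _ = 4 * Cl / η * (ρ ^ (p * v - 1 - d₁) * ρ ^ d₁) := by
          rw [← Real.rpow_add hρ0, ← Real.rpow_add hρ0]; ring_nf
      _ = 4 * Cl / η * ρ ^ (p * v - 1 - d₁) * ρ ^ d₁ := by ring
      _ ≤ ε / 4 * b := by gcongr
  have t4 : 2 * ((S.μf ω).real (Metric.ball x (ρ + r))
      * ∑ i ∈ Finset.Ioc k (n - k), C * ((3 * qq i) ^ ξ / ρ ^ ξ) * b) ≤ ε / 4 * b := by
    have h1 : (S.μf ω).real (Metric.ball x (ρ + r)) ≤ K * D * b := by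
      have hd : S.μ.real (Metric.ball x (4 * ρ)) ≤ D * b := by
        have h3 := ENNReal.toReal_mono (ENNReal.mul_ne_top ENNReal.coe_ne_top (measure_ne_top _ _))
          (hD x hx ρ hρ0 hρb)
        rwa [ENNReal.toReal_mul, ENNReal.coe_toReal] at h3
      calc _ ≤ (S.μf ω).real (Metric.ball x (4 * ρ)) :=
            measureReal_mono (Metric.ball_subset_ball (by linarith))
        _ ≤ K * S.μ.real (Metric.ball x (4 * ρ)) := hω.dom_real _
        _ ≤ K * (D * b) := by gcongr
        _ = _ := by ring
    have h2 : ∑ i ∈ Finset.Ioc k (n - k), C * ((3 * qq i) ^ ξ / ρ ^ ξ) * b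
        ≤ C * (3 * Cδ) ^ ξ * sq * ρ ^ (v * (κ * ξ - q) - ξ) * b := by
      calc _ ≤ ∑ i ∈ Finset.Ioc k (n - k),
            C * (3 * Cδ) ^ ξ * ρ ^ (v * (κ * ξ - q) - ξ) * b * (i : ℝ) ^ (-q) := by
            refine Finset.sum_le_sum fun i hi => ?_
            have hik := (Finset.mem_Ioc.1 hi).1
            have hi0 : (0 : ℝ) < i := by
              have : 0 < i := by omega
              exact_mod_cast this
            have f1 : (3 * qq i) ^ ξ = (3 * Cδ) ^ ξ * (i : ℝ) ^ (-(κ * ξ)) := by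
              simp only [hqq]
              rw [← mul_assoc, Real.mul_rpow (by positivity) (by positivity),
                ← Real.rpow_mul hi0.le]
              ring_nf
            have f2 : (i : ℝ) ^ (-(κ * ξ)) ≤ ρ ^ (v * (κ * ξ - q)) * (i : ℝ) ^ (-q) := by
              calc (i : ℝ) ^ (-(κ * ξ)) = (i : ℝ) ^ (-(κ * ξ - q)) * (i : ℝ) ^ (-q) := by
                    rw [← Real.rpow_add hi0]; ring_nf
                _ ≤ _ := by
                    gcongr
                    exact (Real.rpow_le_rpow_of_nonpos hkpos (by exact_mod_cast hik.le)
                      (by linarith)).trans (hkneg _ (by linarith))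
            rw [f1]
            calc C * ((3 * Cδ) ^ ξ * (i : ℝ) ^ (-(κ * ξ)) / ρ ^ ξ) * b
                ≤ C * ((3 * Cδ) ^ ξ * (ρ ^ (v * (κ * ξ - q)) * (i : ℝ) ^ (-q)) / ρ ^ ξ) * b := by
                  gcongr
              _ = C * (3 * Cδ) ^ ξ * (ρ ^ (v * (κ * ξ - q)) / ρ ^ ξ) * b * (i : ℝ) ^ (-q) := by ring
              _ = _ := by rw [← Real.rpow_sub hρ0]
        _ = C * (3 * Cδ) ^ ξ * ρ ^ (v * (κ * ξ - q) - ξ) * b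
            * ∑ i ∈ Finset.Ioc k (n - k), (i : ℝ) ^ (-q) := by rw [Finset.mul_sum]
        _ ≤ C * (3 * Cδ) ^ ξ * ρ ^ (v * (κ * ξ - q) - ξ) * b * sq := by
            gcongr
            exact hsum.sum_le_tsum _ fun i _ => Real.rpow_nonneg (Nat.cast_nonneg _) _
        _ = _ := by ring
    have h0 : 0 ≤ ∑ i ∈ Finset.Ioc k (n - k), C * ((3 * qq i) ^ ξ / ρ ^ ξ) * b :=
      Finset.sum_nonneg fun i _ => by
        have : 0 ≤ qq i := by simp only [hqq]; positivity
        positivity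
    calc _ ≤ 2 * (K * D * (C₂ * ρ ^ u₀)
          * (C * (3 * Cδ) ^ ξ * sq * ρ ^ (v * (κ * ξ - q) - ξ) * b)) := by
          gcongr
          exact h1.trans (by gcongr)
      _ = 2 * (K * D) * C₂ * (C * (3 * Cδ) ^ ξ * sq)
          * (ρ ^ u₀ * ρ ^ (v * (κ * ξ - q) - ξ)) * b := by ring
      _ = 2 * (K * D) * C₂ * (C * (3 * Cδ) ^ ξ * sq)
          * ρ ^ (v * (κ * ξ - q) + u₀ - ξ) * b := by
          rw [← Real.rpow_add hρ0]; ring_nf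
      _ ≤ ε / 4 * b := by gcongr
  linarith

end System

namespace System

variable {ι A M U : Type*} [AddMonoidWithOne ι] [MeasurableSpace A]
    [MetricSpace M] [CompactSpace M] [MeasurableSpace M] [BorelSpace M]
    [MeasurableSpace U] {S : System ι A M U}

theorem InvariantAlong.measureReal_avoid_succ {ω : ι → A} (h : S.InvariantAlong ω) {B : Set M}
    (hB : MeasurableSet B) (n : ℕ) :
    (S.μf ω).real (S.avoid ω B 0 (n + 1))
      = (S.μf (shift ω)).real (S.avoid (shift ω) B 0 n)
        - (S.μf (shift ω)).real (B ∩ S.avoid (shift ω) B 0 n) := by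
  have hEm : MeasurableSet (S.avoid (shift ω) B 0 n) := measurableSet_avoid hB 0 n
  have h1 : S.avoid ω B 0 (n + 1)
      = iter S.T ω 1 ⁻¹' (S.avoid (shift ω) B 0 n \ (B ∩ S.avoid (shift ω) B 0 n)) := by
    ext y
    have hadd : ∀ j, iter S.T ω (1 + j) y = iter S.T (shift ω) j (iter S.T ω 1 y) :=
      fun j => iter_add S.T ω 1 j y
    simp only [avoid, mem_ofPred_eq, mem_preimage, Set.mem_sdiff, mem_inter_iff, not_and]
    constructor
    · intro hy
      refine ⟨fun j hj hjn => ?_, fun hc => absurd hc (hy 1 one_pos (by omega))⟩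
      rw [← hadd]
      exact hy (1 + j) (by omega) (by omega)
    · rintro ⟨h2, h3⟩ j hj hjn
      rcases eq_or_ne j 1 with rfl | hj1
      · exact fun hc => h3 hc h2
      · obtain ⟨i, rfl⟩ : ∃ i, j = 1 + i := ⟨j - 1, by omega⟩
        rw [hadd]
        exact h2 i (by omega) (by omega)
  rw [h1, h.measureReal_preimage 1 (hEm.diff (hB.inter hEm)),
    measureReal_sdiff inter_subset_right (hB.inter hEm)]
  rfl

/-- The probability of avoiding a set up to time `N` is close to an exponential when, in each fibre,
the set decorrelates from the event that its orbits avoid it. -/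
theorem InvariantAlong.abs_avoid_sub_exp_le {B : Set M} (hB : MeasurableSet B)
    {e : (ι → A) → ℝ} (N : ℕ) {ω : ι → A} (h : S.InvariantAlong ω)
    (he : ∀ k n : ℕ, |(S.μf (shift^[k + 1] ω)).real (B ∩ S.avoid (shift^[k + 1] ω) B 0 n)
      - (S.μf (shift^[k + 1] ω)).real B
        * (S.μf (shift^[k + 1] ω)).real (S.avoid (shift^[k + 1] ω) B 0 n)| ≤ e (shift^[k + 1] ω)) :
    |(S.μf ω).real (S.avoid ω B 0 N)
        - Real.exp (-∑ k ∈ Finset.range N, (S.μf (shift^[k + 1] ω)).real B)|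
      ≤ ∑ k ∈ Finset.range N,
        (e (shift^[k + 1] ω) + (S.μf (shift^[k + 1] ω)).real B ^ 2) := by
  induction N generalizing ω with
  | zero =>
    have : S.avoid ω B 0 0 = univ := by
      ext y
      simp only [avoid, mem_ofPred_eq, mem_univ, iff_true]
      intro j h1 h2
      omega
    simp [this]
  | succ N ih =>
    have hsh : ∀ k, shift^[k] (shift ω) = shift^[k + 1] ω := fun k => rfl
    have ih' := ih (ω := shift ω) (h.shift_iterate 1) fun k n => he (k + 1) n
    simp only [hsh] at ih'
    rw [Finset.sum_range_succ', Finset.sum_range_succ', h.measureReal_avoid_succ hB N]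
    have he0 := he 0 N
    simp only [zero_add, Function.iterate_one] at he0 ⊢
    set g := (S.μf (shift ω)).real (S.avoid (shift ω) B 0 N) with hg
    set a := (S.μf (shift ω)).real B with ha
    set E := Real.exp (-∑ k ∈ Finset.range N, (S.μf (shift^[k + 1 + 1] ω)).real B) with hE
    have ha0 : 0 ≤ a := measureReal_nonneg
    have ha1 : a ≤ 1 := measureReal_le_one
    have hE0 : 0 ≤ E := (Real.exp_pos _).le
    have hE1 : E ≤ 1 := by
      rw [hE, Real.exp_le_one_iff, neg_nonpos]
      exact Finset.sum_nonneg fun k _ => measureReal_nonneg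
    have hexp : |Real.exp (-a) - 1 - -a| ≤ (-a) ^ 2 :=
      Real.abs_exp_sub_one_sub_id_le (by rw [abs_neg, abs_of_nonneg ha0]; exact ha1)
    rw [neg_add, Real.exp_add]
    have h1 : |(1 - a) * (g - E)| ≤ |g - E| := by
      rw [abs_mul, abs_of_nonneg (by linarith)]
      exact mul_le_of_le_one_left (abs_nonneg _) (by linarith)
    have h2 : |E * (Real.exp (-a) - 1 - -a)| ≤ a ^ 2 := by
      rw [abs_mul, abs_of_nonneg hE0, ← neg_sq a]
      exact (mul_le_of_le_one_left (abs_nonneg _) hE1).trans hexp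
    have h3 : g - (S.μf (shift ω)).real (B ∩ S.avoid (shift ω) B 0 N) - E * Real.exp (-a)
        = (1 - a) * (g - E) - E * (Real.exp (-a) - 1 - -a)
          - ((S.μf (shift ω)).real (B ∩ S.avoid (shift ω) B 0 N) - a * g) := by ring
    rw [h3]
    have h4 := abs_sub ((1 - a) * (g - E) - E * (Real.exp (-a) - 1 - -a))
      ((S.μf (shift ω)).real (B ∩ S.avoid (shift ω) B 0 N) - a * g)
    have h5 := abs_sub ((1 - a) * (g - E)) (E * (Real.exp (-a) - 1 - -a))
    linarith

/-- The points that come back too close to themselves: within `2 min (1 / (n + 1), j ^ (-a))` at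
some time `j ≥ 1`. -/
def closeReturns (S : System ι A M U) (a : ℝ) (n : ℕ) : Set ((ι → A) × M) :=
  {z | ∃ j : ℕ, 1 ≤ j ∧
    dist z.2 (iter S.T z.1 j z.2) < 2 * min (1 / ((n : ℝ) + 1)) ((j : ℝ) ^ (-a))}

theorem measurableSet_closeReturns (a : ℝ) (n : ℕ) : MeasurableSet (S.closeReturns a n) := by
  have : S.closeReturns a n = ⋃ j : ℕ, ⋃ _ : 1 ≤ j, {z : (ι → A) × M |
      dist z.2 (iter S.T z.1 j z.2) < 2 * min (1 / ((n : ℝ) + 1)) ((j : ℝ) ^ (-a))} := by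
    ext z; simp [closeReturns]
  rw [this]
  exact MeasurableSet.iUnion fun j => MeasurableSet.iUnion fun _ =>
    measurableSet_lt (measurable_snd.dist (measurable_iter S.meas_T j)) measurable_const

theorem antitone_closeReturns (a : ℝ) : Antitone (S.closeReturns a) := by
  rintro n m hnm z ⟨j, hj, h⟩
  refine ⟨j, hj, h.trans_le ?_⟩
  have : (n : ℝ) ≤ m := by exact_mod_cast hnm
  have hn : (0 : ℝ) ≤ n := Nat.cast_nonneg n
  gcongr

theorem inter_visit_subset_closeReturns {a v : ℝ} (ha : 0 < a) (hav : v * a < 1) (hv : 0 < v)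
    (n : ℕ) : ∀ᶠ ρ : ℝ in 𝓝[>] 0, ∀ x (ω : ι → A),
      Metric.ball x ρ ∩ S.visit ω (fun _ => Metric.ball x ρ) 0 (⌈ρ ^ (-v)⌉₊ + ⌈ρ ^ (-v)⌉₊)
        ⊆ Prod.mk ω ⁻¹' S.closeReturns a n := by
  have ev1 := eventually_const_mul_rpow_le ((4 : ℝ) ^ a) (show 0 < 1 - v * a by linarith) one_pos
  have hn : (0 : ℝ) < 1 / ((n : ℝ) + 1) := by positivity
  filter_upwards [ev1, Ioo_mem_nhdsGT (lt_min hn one_pos)] with ρ e1 hρ x ω y hy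
  obtain ⟨hρ0, hρlt⟩ := hρ
  obtain ⟨hρn, hρ1⟩ := lt_min_iff.1 hρlt
  obtain ⟨hy1, hy2⟩ := hy
  simp only [visit, mem_iUnion, Finset.mem_Ioc, mem_preimage, exists_prop] at hy2
  obtain ⟨j, ⟨hj0, hj⟩, hyj⟩ := hy2
  refine ⟨j, hj0, ?_⟩
  have hd : dist y (iter S.T ω j y) < 2 * ρ := by
    have := dist_triangle_right y (iter S.T ω j y) x
    rw [Metric.mem_ball] at hy1 hyj
    linarith
  refine hd.trans_le ?_
  have hρv : 1 ≤ ρ ^ (-v) := Real.one_le_rpow_of_pos_of_le_one_of_nonpos hρ0 hρ1.le (by linarith)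
  have hj' : (j : ℝ) ≤ 4 * ρ ^ (-v) := by
    have h1 := (Nat.ceil_lt_add_one (by linarith : (0 : ℝ) ≤ ρ ^ (-v))).le
    have h2 : (j : ℝ) ≤ (⌈ρ ^ (-v)⌉₊ : ℝ) + ⌈ρ ^ (-v)⌉₊ := by exact_mod_cast hj
    linarith
  have hj0' : (0 : ℝ) < j := by exact_mod_cast hj0
  have hja : ρ ≤ (j : ℝ) ^ (-a) := by
    rw [Real.rpow_neg hj0'.le, le_inv_comm₀ hρ0 (by positivity)]
    calc (j : ℝ) ^ a ≤ (4 * ρ ^ (-v)) ^ a := by gcongr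
      _ = 4 ^ a * ρ ^ (-(v * a)) := by
          rw [Real.mul_rpow (by norm_num) (by positivity), ← Real.rpow_mul hρ0.le, neg_mul]
      _ = 4 ^ a * ρ ^ (1 - v * a) * ρ⁻¹ := by
          rw [mul_assoc, ← Real.rpow_neg_one ρ, ← Real.rpow_add hρ0]; ring_nf
      _ ≤ 1 * ρ⁻¹ := by gcongr
      _ = ρ⁻¹ := one_mul _
  have := le_min hρn.le hja
  linarith

/-- Almost no point returns arbitrarily close to itself. -/
theorem RegularAt.measure_iInter_closeReturns {lam δ : ℕ → ℝ} {K : ℝ≥0} {C ρ₀ ξ : ℝ} {ω : ι → A}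
    (hω : S.RegularAt lam K C ρ₀ ξ ω) {K' : ℝ≥0} (hK' : ∀ ω ∈ S.good, ∀ E, S.μ E ≤ K' * S.μf ω E)
    (hper : ∀ j : ℕ, 1 ≤ j → S.μ {y | iter S.T ω j y = y} = 0)
    {C₃ ρ₃ u₀ : ℝ} (hC₃ : 0 < C₃) (hρ₃ : 0 < ρ₃)
    (hret : ∀ k l : ℕ, 1 ≤ k → 1 ≤ l → ∀ s : ℝ, 0 < s → s < ρ₃ → δ l ≤ s →
      (S.μf ω).real {y | dist y (iter S.T ω (k + l) y) < 2 * s} ≤ C₃ * (s ^ u₀ + |lam k| / s))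
    {Cδ κ : ℝ} (hδ : ∀ n : ℕ, 1 ≤ n → |δ n| ≤ Cδ * (n : ℝ) ^ (-κ))
    {Cl p : ℝ} (hCl : 0 < Cl) (hlam : ∀ n : ℕ, 1 ≤ n → |lam n| ≤ Cl * (n : ℝ) ^ (-p))
    (hCδ : 0 < Cδ) {a : ℝ} (ha : 0 < a) (hau : 1 < a * u₀) (hap : a + 1 < p) (haκ : a < κ) :
    S.μ (Prod.mk ω ⁻¹' ⋂ n, S.closeReturns a n) = 0 := by
  set E : ℕ → Set M := fun j => {y | dist y (iter S.T ω j y) < 2 * (j : ℝ) ^ (-a)} with hE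
  have hlim : S.μf ω (limsup E atTop) = 0 := by
    refine measure_limsup_atTop_eq_zero ?_
    have hsmall : ∀ᶠ j : ℕ in atTop, (j : ℝ) ^ (-a) < ρ₃ ∧ Cδ * 2 ^ κ * (j : ℝ) ^ (-(κ - a)) ≤ 1 := by
      have h1 := (tendsto_const_mul_natCast_rpow_neg 1 ha).eventually_lt_const hρ₃
      have h2 := (tendsto_const_mul_natCast_rpow_neg (Cδ * 2 ^ κ)
        (sub_pos.2 haκ)).eventually_le_const one_pos
      filter_upwards [h1, h2] with j h1 h2
      exact ⟨by simpa using h1, h2⟩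
    have hbound : ∀ᶠ j : ℕ in atTop, (S.μf ω).real (E j)
        ≤ C₃ * ((j : ℝ) ^ (-(a * u₀)) + Cl * 3 ^ p * (j : ℝ) ^ (-(p - a))) := by
      filter_upwards [hsmall, eventually_ge_atTop 2] with j hj hj2
      have hj0 : (0 : ℝ) < j := by
        have : 0 < j := by omega
        exact_mod_cast this
      have hkl : j / 2 + (j - j / 2) = j := by omega
      have hs : (0 : ℝ) < (j : ℝ) ^ (-a) := by positivity
      have hl : δ (j - j / 2) ≤ (j : ℝ) ^ (-a) := by
        refine (le_abs_self _).trans ((hδ _ (by omega)).trans ?_)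
        have h1 : (j : ℝ) / 2 ≤ ((j - j / 2 : ℕ) : ℝ) := by
          have : j ≤ 2 * (j - j / 2) := by omega
          have h2 : (j : ℝ) ≤ 2 * ((j - j / 2 : ℕ) : ℝ) := by exact_mod_cast this
          linarith
        calc Cδ * ((j - j / 2 : ℕ) : ℝ) ^ (-κ) ≤ Cδ * ((j : ℝ) / 2) ^ (-κ) :=
              mul_le_mul_of_nonneg_left
                (Real.rpow_le_rpow_of_nonpos (by positivity) h1 (by linarith)) hCδ.le
          _ = Cδ * 2 ^ κ * (j : ℝ) ^ (-(κ - a)) * (j : ℝ) ^ (-a) := by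
              rw [Real.div_rpow hj0.le (by norm_num), Real.rpow_neg (by norm_num : (0:ℝ) ≤ 2),
                mul_assoc _ ((j : ℝ) ^ (-(κ - a))), ← Real.rpow_add hj0]
              rw [div_inv_eq_mul]
              ring_nf
          _ ≤ 1 * (j : ℝ) ^ (-a) := by gcongr; exact hj.2
          _ = _ := one_mul _
      have hb := hret (j / 2) (j - j / 2) (by omega) (by omega) _ hs hj.1 hl
      rw [hkl] at hb
      refine hb.trans ?_
      gcongr
      · rw [← Real.rpow_mul hj0.le, neg_mul]
      · have h1 : (j : ℝ) / 3 ≤ ((j / 2 : ℕ) : ℝ) := by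
          have : j ≤ 3 * (j / 2) := by omega
          have h2 : (j : ℝ) ≤ 3 * ((j / 2 : ℕ) : ℝ) := by exact_mod_cast this
          linarith
        rw [div_le_iff₀ hs]
        calc |lam (j / 2)| ≤ Cl * ((j / 2 : ℕ) : ℝ) ^ (-p) := hlam _ (by omega)
          _ ≤ Cl * ((j : ℝ) / 3) ^ (-p) :=
              mul_le_mul_of_nonneg_left
                (Real.rpow_le_rpow_of_nonpos (by positivity) h1 (by linarith)) hCl.le
          _ = Cl * 3 ^ p * (j : ℝ) ^ (-(p - a)) * (j : ℝ) ^ (-a) := by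
              rw [Real.div_rpow hj0.le (by norm_num), Real.rpow_neg (by norm_num : (0:ℝ) ≤ 3),
                mul_assoc _ ((j : ℝ) ^ (-(p - a))), ← Real.rpow_add hj0, div_inv_eq_mul]
              ring_nf
    have hsum : Summable fun j => (S.μf ω).real (E j) := by
      refine Summable.of_norm_bounded_eventually_nat (g := fun j : ℕ => C₃ *
        ((j : ℝ) ^ (-(a * u₀)) + Cl * 3 ^ p * (j : ℝ) ^ (-(p - a)))) ?_ ?_
      · refine Summable.mul_left _ (Summable.add ?_ (Summable.mul_left _ ?_))
        · exact Real.summable_nat_rpow.2 (by linarith)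
        · exact Real.summable_nat_rpow.2 (by linarith)
      · filter_upwards [hbound] with j hj
        rwa [Real.norm_eq_abs, abs_of_nonneg measureReal_nonneg]
    have h2 : ∀ j, S.μf ω (E j) = ENNReal.ofReal ((S.μf ω).real (E j)) := fun j =>
      (ENNReal.ofReal_toReal (measure_ne_top _ _)).symm
    simp only [h2]
    exact hsum.tsum_ofReal_ne_top
  have hlim' : S.μ (limsup E atTop) = 0 := by
    refine le_antisymm ((hK' ω hω.good _).trans ?_) zero_le
    rw [hlim, mul_zero]
  refine measure_mono_null (t := limsup E atTop ∪ ⋃ j : ℕ, ⋃ _ : 1 ≤ j, {y | iter S.T ω j y = y}) ?_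
    (measure_union_null hlim' (measure_iUnion_null fun j =>
      measure_iUnion_null fun hj => hper j hj))
  intro y hy
  by_contra hcon
  rw [mem_union, not_or] at hcon
  obtain ⟨h1, h2⟩ := hcon
  rw [mem_limsup_iff_frequently_mem, not_frequently, eventually_atTop] at h1
  obtain ⟨J, hJ⟩ := h1
  simp only [mem_iUnion, mem_ofPred_eq, exists_prop, not_exists, not_and] at h2
  have hpos : ∀ j, 1 ≤ j → 0 < dist y (iter S.T ω j y) := fun j hj =>
    dist_pos.2 fun h => h2 j hj h.symm
  have hev : ∀ᶠ n : ℕ in atTop, ∀ j ∈ Finset.Ico 1 J,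
      2 * (1 / ((n : ℝ) + 1)) < dist y (iter S.T ω j y) := by
    rw [Finset.eventually_all]
    intro j hj
    have := (tendsto_one_div_add_atTop_nhds_zero_nat (𝕜 := ℝ)).const_mul 2
    rw [mul_zero] at this
    exact this.eventually_lt_const (hpos j (Finset.mem_Ico.1 hj).1)
  obtain ⟨n, hn⟩ := hev.exists
  obtain ⟨j, hj1, hj⟩ := mem_iInter.1 hy n
  simp only at hj
  by_cases hjJ : j < J
  · have := hn j (Finset.mem_Ico.2 ⟨hj1, hjJ⟩)
    have h3 := min_le_left (1 / ((n : ℝ) + 1)) ((j : ℝ) ^ (-a))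
    linarith
  · refine hJ j (not_lt.1 hjJ) (hj.trans_le ?_)
    have h3 := min_le_right (1 / ((n : ℝ) + 1)) ((j : ℝ) ^ (-a))
    linarith

end System

/-- If functions tend to zero almost everywhere, then at almost every point some of them has small
averages over all small balls. -/
theorem ae_exists_setIntegral_ball_le {M : Type*} [MetricSpace M] [CompactSpace M]
    [MeasurableSpace M] [BorelSpace M] {m : Measure M} [IsFiniteMeasure m] {D : ℝ≥0} {ρ₀ : ℝ}
    (hρ₀ : 0 < ρ₀) (hD : ∀ x ∈ m.support, ∀ ρ : ℝ, 0 < ρ → ρ < ρ₀ →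
      m (Metric.ball x (4 * ρ)) ≤ D * m (Metric.ball x ρ))
    {Z : ℕ → M → ℝ} (hZ : ∀ n, Integrable (Z n) m)
    (hlim : ∀ᵐ x ∂m, Tendsto (fun n => Z n x) atTop (𝓝 0)) :
    ∀ᵐ x ∂m, ∀ ε : ℝ, 0 < ε → ∃ n, ∀ᶠ ρ : ℝ in 𝓝[>] 0,
      ∫ y in Metric.ball x ρ, Z n y ∂m ≤ ε * m.real (Metric.ball x ρ) := by
  have hleb : ∀ᵐ x ∂m, ∀ n, Tendsto (fun ρ => (∫ y in Metric.ball x ρ, |Z n y - Z n x| ∂m)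
      / m.real (Metric.ball x ρ)) (𝓝[>] 0) (𝓝 0) :=
    ae_all_iff.2 fun n => ae_tendsto_ball_integral_sub hρ₀ hD (hZ n)
  filter_upwards [hleb, hlim] with x h1 h2 ε hε
  obtain ⟨n, hn⟩ := (h2.eventually_lt_const (show (0 : ℝ) < ε / 2 by positivity)).exists
  refine ⟨n, ?_⟩
  filter_upwards [(h1 n).eventually_lt_const (show (0 : ℝ) < ε / 2 by positivity)] with ρ hρ
  set B := Metric.ball x ρ with hB
  have hi : Integrable (fun y => |Z n y - Z n x|) (m.restrict B) :=
    ((hZ n).restrict.sub (integrable_const _)).abs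
  rcases (measureReal_nonneg : 0 ≤ m.real B).eq_or_lt with h0 | h0
  · have : m.restrict B = 0 := by
      rw [Measure.restrict_eq_zero]
      exact (measureReal_eq_zero_iff).1 h0.symm
    rw [this, integral_zero_measure, ← h0, mul_zero]
  rw [div_lt_iff₀ h0] at hρ
  calc ∫ y in B, Z n y ∂m ≤ ∫ y in B, (|Z n y - Z n x| + Z n x) ∂m := by
        refine integral_mono (hZ n).restrict (hi.add (integrable_const _)) fun y => ?_
        have := le_abs_self (Z n y - Z n x)
        simp only
        linarith
    _ = ∫ y in B, |Z n y - Z n x| ∂m + Z n x * m.real B := by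
        rw [integral_add hi (integrable_const _)]
        simp [mul_comm]
    _ ≤ ε / 2 * m.real B + ε / 2 * m.real B := by gcongr
    _ = ε * m.real B := by ring

section Birkhoff

variable {X : Type*} [MeasurableSpace X] {P : Measure X} {S : X → X}

/-- The supremum over all times of the frequency of visits to `E`. -/
noncomputable def maxFrequency {X : Type*} (S : X → X) (E : Set X) (x : X) : ℝ :=
  ⨆ N : ℕ, birkhoffAverage ℝ S (E.indicator fun _ => (1 : ℝ)) (N + 1) x

theorem abs_indicator_one_le {X : Type*} (E : Set X) (x : X) :
    |E.indicator (fun _ => (1 : ℝ)) x| ≤ 1 := by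
  by_cases h : x ∈ E
  · rw [indicator_of_mem h, abs_one]
  · rw [indicator_of_notMem h, abs_zero]; exact zero_le_one

theorem bddAbove_birkhoffAverage {X : Type*} (S : X → X) (E : Set X) (x : X) :
    BddAbove (range fun N : ℕ => birkhoffAverage ℝ S (E.indicator fun _ => (1 : ℝ)) (N + 1) x) := by
  refine ⟨1, ?_⟩
  rintro _ ⟨N, rfl⟩
  exact (le_abs_self _).trans (abs_birkhoffAverage_le (abs_indicator_one_le E) _ x)

theorem birkhoffAverage_le_maxFrequency {X : Type*} (S : X → X) (E : Set X) (N : ℕ) (x : X) :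
    birkhoffAverage ℝ S (E.indicator fun _ => (1 : ℝ)) (N + 1) x ≤ maxFrequency S E x :=
  le_ciSup (bddAbove_birkhoffAverage S E x) N

theorem indicator_le_maxFrequency {X : Type*} (S : X → X) (E : Set X) (x : X) :
    E.indicator (fun _ => (1 : ℝ)) x ≤ maxFrequency S E x := by
  have := birkhoffAverage_le_maxFrequency S E 0 x
  rwa [zero_add, birkhoffAverage_one] at this

theorem maxFrequency_nonneg {X : Type*} (S : X → X) (E : Set X) (x : X) : 0 ≤ maxFrequency S E x :=
  (indicator_nonneg (fun _ _ => zero_le_one) x).trans (indicator_le_maxFrequency S E x)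

theorem maxFrequency_le_one {X : Type*} (S : X → X) (E : Set X) (x : X) : maxFrequency S E x ≤ 1 :=
  ciSup_le fun _ => (le_abs_self _).trans (abs_birkhoffAverage_le (abs_indicator_one_le E) _ x)

theorem maxFrequency_mono {X : Type*} (S : X → X) {E F : Set X} (h : E ⊆ F) (x : X) :
    maxFrequency S E x ≤ maxFrequency S F x := by
  refine ciSup_mono (bddAbove_birkhoffAverage S F x) fun N => ?_
  simp only [birkhoffAverage, birkhoffSum, smul_eq_mul]
  gcongr

theorem measurable_maxFrequency (hS : Measurable S) {E : Set X} (hE : MeasurableSet E) :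
    Measurable (maxFrequency S E) :=
  Measurable.iSup fun _ => measurable_birkhoffAverage hS (measurable_const.indicator hE) _

theorem ae_tendsto_maxFrequency [IsFiniteMeasure P] (hS : MeasurePreserving S P P)
    {E : ℕ → Set X} (hE : ∀ n, MeasurableSet (E n)) (hanti : Antitone E)
    (hnull : P (⋂ n, E n) = 0) :
    ∀ᵐ x ∂P, Tendsto (fun n => maxFrequency S (E n) x) atTop (𝓝 0) := by
  have hlim : Tendsto (fun n => P.real (E n)) atTop (𝓝 0) := by
    have h := tendsto_measure_iInter_atTop (μ := P) (fun n => (hE n).nullMeasurableSet) hanti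
      ⟨0, measure_ne_top _ _⟩
    rw [hnull] at h
    exact (ENNReal.tendsto_toReal ENNReal.zero_ne_top).comp h
  have hall : ∀ᵐ x ∂P, ∀ j : ℕ, ¬ ∀ n, 1 / ((j : ℝ) + 1) < maxFrequency S (E n) x := by
    refine ae_all_iff.2 fun j => ?_
    have hs : (0 : ℝ) < 1 / ((j : ℝ) + 1) := by positivity
    rw [ae_iff]
    simp only [not_not]
    rw [← measureReal_eq_zero_iff]
    refine le_antisymm ?_ measureReal_nonneg
    have hl := hlim.div_const (1 / ((j : ℝ) + 1))
    rw [zero_div] at hl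
    refine ge_of_tendsto' hl fun n => ?_
    have hm := maximal_ergodic_inequality hS (measurable_const.indicator (hE n))
      ((integrable_const (1 : ℝ)).indicator (hE n))
      (fun x => indicator_nonneg (fun _ _ => zero_le_one) x) hs
    rw [integral_indicator (hE n)] at hm
    simp only [integral_const, smul_eq_mul, mul_one, measureReal_restrict_apply_univ] at hm
    refine (measureReal_mono fun x hx => ?_).trans hm
    obtain ⟨N, hN⟩ := exists_lt_of_lt_ciSup (hx n)
    refine ⟨N, ?_⟩
    rw [birkhoffAverage, smul_eq_mul, lt_inv_mul_iff₀ (by positivity), mul_comm] at hN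
    push_cast at hN
    exact hN
  filter_upwards [hall] with x hx
  rw [Metric.tendsto_atTop]
  intro ε hε
  obtain ⟨j, hj⟩ := exists_nat_one_div_lt hε
  obtain ⟨n, hn⟩ := not_forall.1 (hx j)
  refine ⟨n, fun k hk => ?_⟩
  rw [Real.dist_eq, sub_zero, abs_of_nonneg (maxFrequency_nonneg _ _ _)]
  exact ((maxFrequency_mono S (hanti hk) x).trans (not_lt.1 hn)).trans_lt hj

/-- The largest deviation of the ergodic averages from `c` after time `n`. -/
noncomputable def tailDeviation {X : Type*} (S : X → X) (f : X → ℝ) (c : ℝ) (n : ℕ) (x : X) : ℝ :=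
  ⨆ N : ℕ, |birkhoffAverage ℝ S f (n + N) x - c|

theorem abs_birkhoffAverage_sub_le {X : Type*} {S : X → X} {f : X → ℝ} {K : ℝ}
    (hK : ∀ x, |f x| ≤ K) (c : ℝ) (n : ℕ) (x : X) :
    |birkhoffAverage ℝ S f n x - c| ≤ K + |c| :=
  (abs_sub _ _).trans (add_le_add (abs_birkhoffAverage_le hK n x) le_rfl)

theorem le_tailDeviation {X : Type*} {S : X → X} {f : X → ℝ} {K : ℝ}
    (hK : ∀ x, |f x| ≤ K) (c : ℝ) {n N : ℕ} (h : n ≤ N) (x : X) :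
    |birkhoffAverage ℝ S f N x - c| ≤ tailDeviation S f c n x := by
  have hb : BddAbove (range fun N : ℕ => |birkhoffAverage ℝ S f (n + N) x - c|) := by
    refine ⟨K + |c|, ?_⟩
    rintro _ ⟨N, rfl⟩
    exact abs_birkhoffAverage_sub_le hK c _ x
  have := le_ciSup hb (N - n)
  simp only [Nat.add_sub_cancel' h] at this
  exact this

theorem tailDeviation_nonneg {X : Type*} {S : X → X} {f : X → ℝ} {K : ℝ}
    (hK : ∀ x, |f x| ≤ K) (c : ℝ) (n : ℕ) (x : X) : 0 ≤ tailDeviation S f c n x :=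
  (abs_nonneg _).trans (le_tailDeviation hK c le_rfl x)

theorem tailDeviation_le {X : Type*} {S : X → X} {f : X → ℝ} {K : ℝ}
    (hK : ∀ x, |f x| ≤ K) (c : ℝ) (n : ℕ) (x : X) : tailDeviation S f c n x ≤ K + |c| :=
  ciSup_le fun _ => abs_birkhoffAverage_sub_le hK c _ x

theorem measurable_tailDeviation (hS : Measurable S) {f : X → ℝ} (hf : Measurable f) (c : ℝ)
    (n : ℕ) : Measurable (tailDeviation S f c n) :=
  Measurable.iSup fun _ => ((measurable_birkhoffAverage hS hf _).sub_const c).abs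

theorem tendsto_tailDeviation {X : Type*} {S : X → X} {f : X → ℝ} {K : ℝ}
    (hK : ∀ x, |f x| ≤ K) {c : ℝ} {x : X}
    (h : Tendsto (fun n => birkhoffAverage ℝ S f n x) atTop (𝓝 c)) :
    Tendsto (fun n => tailDeviation S f c n x) atTop (𝓝 0) := by
  rw [Metric.tendsto_atTop] at h ⊢
  intro ε hε
  obtain ⟨n, hn⟩ := h (ε / 2) (by positivity)
  refine ⟨n, fun k hk => ?_⟩
  rw [Real.dist_eq, sub_zero, abs_of_nonneg (tailDeviation_nonneg hK c k x)]
  refine lt_of_le_of_lt (ciSup_le fun N => ?_) (half_lt_self hε)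
  have := hn (k + N) (by omega)
  rw [Real.dist_eq] at this
  exact this.le

theorem integral_abs_birkhoffAverage_le (hS : MeasurePreserving S P P) {f : X → ℝ}
    (hf : Integrable f P) (n : ℕ) :
    ∫ x, |birkhoffAverage ℝ S f n x| ∂P ≤ ∫ x, |f x| ∂P := by
  rcases Nat.eq_zero_or_pos n with rfl | hn
  · simpa using integral_nonneg fun x => abs_nonneg (f x)
  have hn' : (0 : ℝ) < n := by exact_mod_cast hn
  have hi : ∀ i, Integrable (fun x => |f (S^[i] x)|) P := fun i =>
    ((hS.iterate i).integrable_comp_of_integrable hf).abs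
  have hint : ∀ i, ∫ x, |f (S^[i] x)| ∂P = ∫ x, |f x| ∂P := fun i => by
    have h := integral_map (μ := P) (φ := S^[i]) (hS.iterate i).measurable.aemeasurable
      (f := fun x => |f x|) (by rw [(hS.iterate i).map_eq]; exact hf.abs.aestronglyMeasurable)
    rw [(hS.iterate i).map_eq] at h
    exact h.symm
  have hfi : ∀ i, Integrable (fun x => f (S^[i] x)) P := fun i =>
    (hS.iterate i).integrable_comp_of_integrable hf
  calc ∫ x, |birkhoffAverage ℝ S f n x| ∂P
      ≤ ∫ x, (n : ℝ)⁻¹ * ∑ i ∈ Finset.range n, |f (S^[i] x)| ∂P := by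
        refine integral_mono ?_ ((integrable_finsetSum _ fun i _ => hi i).const_mul _) fun x => ?_
        · simp only [birkhoffAverage, birkhoffSum, smul_eq_mul]
          exact ((integrable_finsetSum _ fun i _ => hfi i).const_mul _).abs
        · simp only [birkhoffAverage, birkhoffSum, smul_eq_mul]
          rw [abs_mul, abs_of_pos (inv_pos.2 hn')]
          gcongr
          exact Finset.abs_sum_le_sum_abs _ _
    _ = ∫ x, |f x| ∂P := by
        rw [integral_const_mul, integral_finsetSum _ fun i _ => hi i]
        simp only [hint, Finset.sum_const, Finset.card_range, nsmul_eq_mul]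
        field_simp

theorem tendsto_integral_abs_of_sq [IsProbabilityMeasure P] {u : ℕ → X → ℝ}
    (hu : ∀ n, Measurable (u n)) {K : ℝ} (hK : ∀ n x, |u n x| ≤ K)
    (h : Tendsto (fun n => ∫ x, u n x ^ 2 ∂P) atTop (𝓝 0)) :
    Tendsto (fun n => ∫ x, |u n x| ∂P) atTop (𝓝 0) := by
  have hi : ∀ n, Integrable (fun x => |u n x|) P := fun n =>
    Integrable.of_bound (hu n).abs.aestronglyMeasurable K
      (Eventually.of_forall fun x => by rw [Real.norm_eq_abs, abs_abs]; exact hK n x)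
  have hi2 : ∀ n, Integrable (fun x => u n x ^ 2) P := fun n =>
    Integrable.of_bound ((hu n).pow_const 2).aestronglyMeasurable (K ^ 2)
      (Eventually.of_forall fun x => by
        rw [Real.norm_eq_abs, abs_pow]
        have := hK n x
        gcongr)
  rw [Metric.tendsto_atTop] at h ⊢
  intro ε hε
  obtain ⟨N, hN⟩ := h ((ε / 2) * (ε / 2)) (by positivity)
  refine ⟨N, fun n hn => ?_⟩
  have h1 := hN n hn
  rw [Real.dist_eq, sub_zero, abs_of_nonneg (integral_nonneg fun x => sq_nonneg _)] at h1
  rw [Real.dist_eq, sub_zero, abs_of_nonneg (integral_nonneg fun x => abs_nonneg _)]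
  calc ∫ x, |u n x| ∂P ≤ ∫ x, (ε / 2 + (ε / 2)⁻¹ * u n x ^ 2) ∂P := by
        refine integral_mono (hi n) ((integrable_const _).add ((hi2 n).const_mul _)) fun x => ?_
        simp only
        have h2 : 0 < ε / 2 := by positivity
        have h3 : |u n x| * (ε / 2) ≤ (ε / 2 + (ε / 2)⁻¹ * u n x ^ 2) * (ε / 2) := by
          have h4 : (ε / 2 + (ε / 2)⁻¹ * u n x ^ 2) * (ε / 2) = (ε / 2) ^ 2 + |u n x| ^ 2 := by
            rw [sq_abs]; field_simp
          rw [h4]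
          nlinarith [sq_nonneg (|u n x| - ε / 2), abs_nonneg (u n x)]
        exact le_of_mul_le_mul_right h3 h2
    _ = ε / 2 + (ε / 2)⁻¹ * ∫ x, u n x ^ 2 ∂P := by
        rw [integral_add (integrable_const _) ((hi2 n).const_mul _), integral_const_mul]
        simp
    _ < ε / 2 + (ε / 2)⁻¹ * (ε / 2 * (ε / 2)) := by gcongr
    _ = ε := by field_simp; norm_num

end Birkhoff

namespace System

variable {ι A M U : Type*} [AddMonoidWithOne ι] [MeasurableSpace A]
    [MetricSpace M] [CompactSpace M] [MeasurableSpace M] [BorelSpace M]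
    [MeasurableSpace U] {S : System ι A M U}

theorem integral_μ_eq {G : M → ℝ} (hG : Integrable G S.μ) :
    ∫ x, G x ∂S.μ = ∫ ω, ∫ x, G x ∂(S.μf ω) ∂S.ν :=
  Kernel.integral_comp (η := S.μf) (κ := Kernel.const Unit S.ν) (a := ()) hG

/-- Quenched decorrelation of a Lipschitz function along the fibres. -/
theorem RegularAt.abs_integral_mul_comp_sub_le {lam δ : ℕ → ℝ} {K : ℝ≥0} {C ρ₀ ξ : ℝ} {ω : ι → A}
    (hω : S.RegularAt lam K C ρ₀ ξ ω) (hVI : S.Contraction δ) {k l : ℕ} (hk : 1 ≤ k) (hl : 1 ≤ l)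
    {G : M → ℝ} (hGm : Measurable G) {b L : ℝ} (hL : 0 ≤ L)
    (hG : ∀ x y, |G x - G y| ≤ L * dist x y) (hb : ∀ x, |G x| ≤ b) :
    |∫ x, G x * G (iter S.T ω (k + l) x) ∂(S.μf ω)
        - (∫ x, G x ∂(S.μf ω)) * ∫ x, G x ∂(S.μf (shift^[k + l] ω))|
      ≤ |lam k| * (b + L) * b + 2 * (b * (L * |δ l|)) := by
  have hgk := S.shift_iterate_good hω.good k
  obtain ⟨a⟩ : Nonempty U := by
    have := S.prob_υ ω hω.good
    exact nonempty_of_isProbabilityMeasure (S.υ ω)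
  have hb0 : 0 ≤ b := by
    obtain ⟨x⟩ : Nonempty M := nonempty_of_isProbabilityMeasure (S.μf ω)
    exact (abs_nonneg _).trans (hb x)
  set ω' := shift^[k] ω with hω'
  set h := RandomMaps.holonomy (S.stab ω') (S.unst ω' a) with hh
  have hhm : Measurable h := S.meas_holonomy _ hgk a
  set F : M → ℝ := fun z => G (iter S.T ω' l z) with hF
  have hTk : Measurable (iter S.T ω k) := S.measurable_T_iter ω k
  have hFm : Measurable F := hGm.comp (S.measurable_T_iter ω' l)
  have hFb : ∀ z, |F z| ≤ b := fun z => hb _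
  have hdec := (hω.decay 0).holonomy hω.good hk a hL hG hb hFm hFb
  simp only [Function.iterate_zero, id_eq, ← hω', ← hh] at hdec
  have hFh : ∀ z, |F z - F (h z)| ≤ L * |δ l| := fun z =>
    (hG _ _).trans (by
      gcongr
      exact hVI.dist_holonomy_le hgk a hl (abs_nonneg _) (le_abs_self _) z)
  have hint : ∀ {m : Measure M} [IsProbabilityMeasure m] {g : M → ℝ} {c : ℝ}, Measurable g →
      (∀ x, |g x| ≤ c) → Integrable g m := fun hg hc =>
    Integrable.of_bound hg.aestronglyMeasurable _ (Eventually.of_forall hc)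
  have hbd : ∀ {m : Measure M} [IsProbabilityMeasure m] {g : M → ℝ} {c : ℝ},
      (∀ x, |g x| ≤ c) → |∫ x, g x ∂m| ≤ c := by
    intro m _ g c hc
    have := norm_integral_le_of_norm_le_const (μ := m) (f := g) (C := c) (Eventually.of_forall hc)
    simpa using this
  have hmul : ∀ {u w : M → ℝ} {c d : ℝ}, 0 ≤ c → (∀ x, |u x| ≤ c) → (∀ x, |w x| ≤ d) →
      ∀ x, |u x * w x| ≤ c * d := fun hc hu hw x => by
    rw [abs_mul]; exact mul_le_mul (hu x) (hw x) (abs_nonneg _) hc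
  have e1 : ∫ x, G x * G (iter S.T ω (k + l) x) ∂(S.μf ω)
      = ∫ x, G x * F (iter S.T ω k x) ∂(S.μf ω) := by
    simp only [iter_add, hF, hω']
  have e2 : ∫ x, G x ∂(S.μf (shift^[k + l] ω)) = ∫ x, F x ∂(S.μf ω') := by
    rw [hF, (hω.shift_iterate k).inv.integral_comp_iter l hGm, ← Function.iterate_add_apply,
      add_comm l k]
  have e3 : |∫ x, G x * F (iter S.T ω k x) ∂(S.μf ω)
      - ∫ x, G x * F (h (iter S.T ω k x)) ∂(S.μf ω)| ≤ b * (L * |δ l|) := by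
    have i1 : Integrable (fun x => G x * F (iter S.T ω k x)) (S.μf ω) :=
      hint (hGm.mul (hFm.comp hTk)) (hmul hb0 hb fun x => hFb _)
    have i2 : Integrable (fun x => G x * F (h (iter S.T ω k x))) (S.μf ω) :=
      hint (hGm.mul (hFm.comp (hhm.comp hTk))) (hmul hb0 hb fun x => hFb _)
    rw [← integral_sub i1 i2]
    refine hbd fun x => ?_
    rw [← mul_sub, abs_mul]
    exact mul_le_mul (hb x) (hFh _) (abs_nonneg _) hb0
  have e4 : |∫ x, F x ∂(S.μf ω') - ∫ x, F (h x) ∂(S.μf ω')| ≤ L * |δ l| := by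
    have i1 : Integrable (fun x => F (h x)) (S.μf ω') := hint (hFm.comp hhm) fun x => hFb _
    rw [← integral_sub (hint hFm hFb) i1]
    exact hbd hFh
  have e5 : |(∫ x, G x ∂(S.μf ω)) * ∫ x, F x ∂(S.μf ω')
      - (∫ x, G x ∂(S.μf ω)) * ∫ x, F (h x) ∂(S.μf ω')| ≤ b * (L * |δ l|) := by
    rw [← mul_sub, abs_mul]
    exact mul_le_mul (hbd hb) e4 (abs_nonneg _) hb0
  rw [e1, e2]
  rw [abs_le] at hdec e3 e5 ⊢
  constructor <;> linarith [hdec.1, hdec.2, e3.1, e3.2, e5.1, e5.2]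

/-- The autocovariances of the fibre averages of a Lipschitz function tend to zero. -/
theorem tendsto_integral_fibre_average_mul {lam δ : ℕ → ℝ} (hI : S.AnnealedDecay lam)
    (hVI : S.Contraction δ) (hlam : Tendsto lam atTop (𝓝 0)) (hδ : Tendsto δ atTop (𝓝 0))
    {K : ℝ≥0} {C ρ₀ ξ : ℝ} (hreg : ∀ᵐ ω ∂S.ν, S.RegularAt lam K C ρ₀ ξ ω)
    {G : M → ℝ} {L b : ℝ≥0} (hG : LipschitzWith L G) (hb : ∀ x, |G x| ≤ b) :
    Tendsto (fun n : ℕ => ∫ ω, (∫ x, G x ∂(S.μf ω)) * ∫ x, G x ∂(S.μf (shift^[n] ω)) ∂S.ν) atTop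
      (𝓝 ((∫ x, G x ∂S.μ) ^ 2)) := by
  have hGm : Measurable G := hG.continuous.measurable
  have hG' : ∀ x y, |G x - G y| ≤ L * dist x y := fun x y => hG.dist_le_mul x y
  set X : (ι → A) → ℝ := fun ω => ∫ x, G x ∂(S.μf ω) with hX
  have hXm : Measurable X := (hGm.stronglyMeasurable.integral_kernel (κ := S.μf)).measurable
  have hbd : ∀ {m : Measure M} [IsProbabilityMeasure m] {g : M → ℝ} {c : ℝ},
      (∀ x, |g x| ≤ c) → |∫ x, g x ∂m| ≤ c := by
    intro m _ g c hc
    have := norm_integral_le_of_norm_le_const (μ := m) (f := g) (C := c) (Eventually.of_forall hc)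
    simpa using this
  have hXb : ∀ ω, |X ω| ≤ b := fun ω => hbd hb
  set Y : ℕ → (ι → A) → ℝ := fun n ω => ∫ x, G x * G (iter S.T ω n x) ∂(S.μf ω) with hY
  have hYm : ∀ n, Measurable (Y n) := fun n => by
    have h1 : Measurable fun q : (ι → A) × M => G q.2 * G (iter S.T q.1 n q.2) :=
      (hGm.comp measurable_snd).mul (hGm.comp (measurable_iter S.meas_T n))
    exact (h1.stronglyMeasurable.integral_kernel_prod_right' (κ := S.μf)).measurable
  have hYb : ∀ n ω, |Y n ω| ≤ b * b := fun n ω => hbd fun x => by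
    rw [abs_mul]; exact mul_le_mul (hb x) (hb _) (abs_nonneg _) b.2
  have hXXi : ∀ n, Integrable (fun ω => X ω * X (shift^[n] ω)) S.ν := fun n =>
    Integrable.of_bound (hXm.mul (hXm.comp (measurable_shift.iterate n))).aestronglyMeasurable
      (b * b) (Eventually.of_forall fun ω => by
        rw [Real.norm_eq_abs, abs_mul]; exact mul_le_mul (hXb _) (hXb _) (abs_nonneg _) b.2)
  have hYi : ∀ n, Integrable (Y n) S.ν := fun n =>
    Integrable.of_bound (hYm n).aestronglyMeasurable _ (Eventually.of_forall (hYb n))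
  have hdiv : Tendsto (fun n : ℕ => n / 2) atTop atTop :=
    Nat.tendsto_div_const_atTop (by norm_num)
  have hdiv' : Tendsto (fun n : ℕ => n - n / 2) atTop atTop :=
    tendsto_atTop_mono (fun n => by omega) hdiv
  have hlim : Tendsto (fun n : ℕ => (|lam (n / 2)| * (b + L) * b + 2 * (b * (L * |δ (n - n / 2)|)))
      + |lam n| * (b + L) * b) atTop (𝓝 ((|0| * (b + L) * b + 2 * (b * (L * |0|)))
        + |0| * (b + L) * b)) := by
    refine Tendsto.add (Tendsto.add ?_ ?_) ?_
    · exact ((hlam.comp hdiv).abs.mul_const _).mul_const _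
    · exact (((hδ.comp hdiv').abs.const_mul _).const_mul _).const_mul _
    · exact (hlam.abs.mul_const _).mul_const _
  simp only [abs_zero, zero_mul, mul_zero, add_zero] at hlim
  rw [tendsto_iff_dist_tendsto_zero]
  refine squeeze_zero' (Eventually.of_forall fun n => dist_nonneg) ?_ hlim
  filter_upwards [eventually_ge_atTop 2] with n hn
  have hkl : n / 2 + (n - n / 2) = n := by omega
  have h1 : |∫ ω, Y n ω ∂S.ν - ∫ ω, X ω * X (shift^[n] ω) ∂S.ν|
      ≤ |lam (n / 2)| * (b + L) * b + 2 * (b * (L * |δ (n - n / 2)|)) := by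
    rw [← integral_sub (hYi n) (hXXi n)]
    have := norm_integral_le_of_norm_le_const (μ := S.ν)
      (f := fun ω => Y n ω - X ω * X (shift^[n] ω))
      (C := |lam (n / 2)| * (b + L) * b + 2 * (b * (L * |δ (n - n / 2)|))) (by
        filter_upwards [hreg] with ω hω
        have h2 := hω.abs_integral_mul_comp_sub_le hVI (k := n / 2) (l := n - n / 2) (by omega)
          (by omega) hGm L.2 hG' hb
        rw [hkl] at h2
        exact h2)
    simpa using this
  have h2 : |∫ ω, Y n ω ∂S.ν - (∫ x, G x ∂S.μ) * ∫ x, G x ∂S.μ| ≤ |lam n| * (b + L) * b := by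
    refine (hI n (by omega) G G b L b hG hb hGm hb).trans ?_
    gcongr
    exact le_abs_self _
  rw [Real.dist_eq, sq]
  rw [abs_le] at h1 h2 ⊢
  constructor <;> linarith [h1.1, h1.2, h2.1, h2.2]

/-- A bounded jointly measurable density of the fibre measures with respect to the marginal. -/
theorem exists_density {K : ℝ≥0} (hK : ∀ᵐ ω ∂S.ν, ∀ E, S.μf ω E ≤ K * S.μ E) :
    ∃ f : (ι → A) × M → ℝ, Measurable f ∧ (∀ z, 0 ≤ f z) ∧ (∀ z, f z ≤ K) ∧
      ∀ᵐ ω ∂S.ν, S.μf ω = S.μ.withDensity fun y => ENNReal.ofReal (f (ω, y)) := by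
  set η : Kernel (ι → A) M := Kernel.const _ S.μ with hη
  set g : (ι → A) × M → ℝ≥0∞ := fun z => S.μf.rnDeriv η z.1 z.2 with hg
  have hgm : Measurable g := Kernel.measurable_rnDeriv _ _
  refine ⟨fun z => min (g z).toReal K, hgm.ennreal_toReal.min measurable_const,
    fun z => le_min ENNReal.toReal_nonneg K.2, fun z => min_le_right _ _, ?_⟩
  filter_upwards [hK] with ω hω
  have hac : S.μf ω ≪ S.μ := Measure.AbsolutelyContinuous.mk fun E _ hE =>
    le_antisymm ((hω E).trans (by rw [hE, mul_zero])) zero_le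
  have h1 : (fun y => g (ω, y)) =ᵐ[S.μ] (S.μf ω).rnDeriv S.μ :=
    Kernel.rnDeriv_eq_rnDeriv_measure (κ := S.μf) (η := η) (a := ω)
  have h2 : (S.μf ω).rnDeriv S.μ ≤ᵐ[S.μ] fun _ => (K : ℝ≥0∞) := by
    refine ae_le_of_forall_setLIntegral_le_of_sigmaFinite (Measure.measurable_rnDeriv _ _)
      fun s hs _ => ?_
    rw [setLIntegral_const]
    exact (Measure.setLIntegral_rnDeriv_le s).trans (hω s)
  rw [← Measure.withDensity_rnDeriv_eq _ _ hac]
  refine withDensity_congr_ae ?_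
  filter_upwards [h1, h2] with y hy1 hy2
  rw [← hy1] at hy2 ⊢
  have hne : g (ω, y) ≠ ∞ := ne_top_of_le_ne_top ENNReal.coe_ne_top hy2
  have h3 : (g (ω, y)).toReal ≤ K := by
    have := ENNReal.toReal_mono ENNReal.coe_ne_top hy2
    simpa using this
  rw [min_eq_left h3, ENNReal.ofReal_toReal hne]

theorem integral_eq_of_density {f : (ι → A) × M → ℝ} (hf : Measurable f) (hf0 : ∀ z, 0 ≤ f z)
    {ω : ι → A} (h : S.μf ω = S.μ.withDensity fun y => ENNReal.ofReal (f (ω, y))) (G : M → ℝ) :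
    ∫ x, G x ∂(S.μf ω) = ∫ x, G x * f (ω, x) ∂S.μ := by
  have hm : Measurable fun y => ENNReal.ofReal (f (ω, y)) :=
    (hf.comp measurable_prodMk_left).ennreal_ofReal
  rw [h, integral_withDensity_eq_integral_toReal_smul hm
    (Eventually.of_forall fun _ => ENNReal.ofReal_lt_top)]
  refine integral_congr_ae (Eventually.of_forall fun y => ?_)
  simp only [ENNReal.toReal_ofReal (hf0 _), smul_eq_mul, mul_comm]

theorem measureReal_eq_of_density {f : (ι → A) × M → ℝ} (hf : Measurable f) (hf0 : ∀ z, 0 ≤ f z)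
    {ω : ι → A} (h : S.μf ω = S.μ.withDensity fun y => ENNReal.ofReal (f (ω, y)))
    {E : Set M} (hE : MeasurableSet E) : (S.μf ω).real E = ∫ x in E, f (ω, x) ∂S.μ := by
  rw [← integral_indicator_one hE, integral_eq_of_density hf hf0 h, ← integral_indicator hE]
  refine integral_congr_ae (Eventually.of_forall fun y => ?_)
  by_cases hy : y ∈ E <;> simp [hy]

end System

theorem integrable_bump {M : Type*} [MetricSpace M] [MeasurableSpace M] [BorelSpace M]
    {m : Measure M} [IsFiniteMeasure m] (x : M) (ρ : ℝ) {r : ℝ} (hr : 0 < r) :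
    Integrable (bump x ρ r) m :=
  Integrable.of_bound (measurable_bump x ρ hr).aestronglyMeasurable 1
    (Eventually.of_forall fun y => by
      rw [Real.norm_eq_abs, abs_of_nonneg (bump_nonneg _ _ _ _)]; exact bump_le_one _ _ _ _)

theorem measureReal_ball_le_integral_bump {M : Type*} [MetricSpace M] [MeasurableSpace M]
    [BorelSpace M] {m : Measure M} [IsFiniteMeasure m] (x : M) (ρ : ℝ)
    {r : ℝ} (hr : 0 < r) : m.real (Metric.ball x ρ) ≤ ∫ y, bump x ρ r y ∂m := by
  have hB : MeasurableSet (Metric.ball x ρ) := Metric.isOpen_ball.measurableSet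
  rw [← integral_indicator_one hB]
  refine integral_mono ((integrable_const (1 : ℝ)).indicator hB) (integrable_bump x ρ hr)
    fun y => ?_
  by_cases hy : y ∈ Metric.ball x ρ
  · simp only [indicator_of_mem hy, Pi.one_apply]
    rw [bump_eq_one hr (Metric.mem_ball.1 hy).le]
  · simp only [indicator_of_notMem hy]
    exact bump_nonneg _ _ _ _

theorem birkhoffAverage_shift_prod {ι A M : Type*} [AddMonoidWithOne ι] (f : (ι → A) × M → ℝ)
    (n : ℕ) (ω : ι → A) (x : M) :
    birkhoffAverage ℝ (Prod.map shift id) f n (ω, x)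
      = birkhoffAverage ℝ shift (fun ω => f (ω, x)) n ω := by
  simp only [birkhoffAverage, birkhoffSum, Prod.map_iterate, Function.iterate_id, Prod.map_apply,
    id_eq]

namespace System

variable {ι A M U : Type*} [AddMonoidWithOne ι] [MeasurableSpace A]
    [MetricSpace M] [CompactSpace M] [MeasurableSpace M] [BorelSpace M]
    [MeasurableSpace U] {S : System ι A M U}

/-- The average of `f` at the scale `h` in the second variable. -/
noncomputable def mollify (S : System ι A M U) (f : (ι → A) × M → ℝ) (h : ℝ)
    (z : (ι → A) × M) : ℝ :=
  (∫ y, bump z.2 h h y * f (z.1, y) ∂S.μ) / ∫ y, bump z.2 h h y ∂S.μ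

theorem integrable_bump_mul {f : (ι → A) × M → ℝ} (hf : Measurable f) {K : ℝ}
    (hK : ∀ z, |f z| ≤ K) (ω : ι → A) (x : M) (ρ : ℝ) {r : ℝ} (hr : 0 < r) :
    Integrable (fun y => bump x ρ r y * f (ω, y)) S.μ := by
  refine Integrable.of_bound ((measurable_bump x ρ hr).mul
    (hf.comp measurable_prodMk_left)).aestronglyMeasurable K (Eventually.of_forall fun y => ?_)
  rw [Real.norm_eq_abs, abs_mul, abs_of_nonneg (bump_nonneg _ _ _ _)]
  exact (mul_le_of_le_one_left (abs_nonneg _) (bump_le_one _ _ _ _)).trans (hK _)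

theorem measurable_mollify {f : (ι → A) × M → ℝ} (hf : Measurable f) (h : ℝ) :
    Measurable (S.mollify f h) := by
  have hb : Measurable fun q : ((ι → A) × M) × M => bump q.1.2 h h q.2 := by
    unfold bump
    have : Measurable fun q : ((ι → A) × M) × M => dist q.2 q.1.2 :=
      measurable_snd.dist (measurable_snd.comp measurable_fst)
    exact measurable_const.max (measurable_const.min ((this.const_sub _).div_const _))
  have h1 : Measurable fun q : ((ι → A) × M) × M => bump q.1.2 h h q.2 * f (q.1.1, q.2) :=
    hb.mul (hf.comp ((measurable_fst.comp measurable_fst).prodMk measurable_snd))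
  exact (h1.stronglyMeasurable.integral_prod_right').measurable.div
    (hb.stronglyMeasurable.integral_prod_right').measurable

theorem abs_mollify_le {f : (ι → A) × M → ℝ} (hf : Measurable f) {K : ℝ} (hK : ∀ z, |f z| ≤ K)
    {h : ℝ} (hh : 0 < h) (z : (ι → A) × M) : |S.mollify f h z| ≤ K := by
  have hK0 : 0 ≤ K := (abs_nonneg _).trans (hK z)
  have hc : 0 ≤ ∫ y, bump z.2 h h y ∂S.μ := integral_nonneg fun y => bump_nonneg _ _ _ _
  rw [mollify, abs_div, abs_of_nonneg hc]
  refine div_le_of_le_mul₀ hc hK0 ?_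
  rw [← integral_const_mul]
  refine abs_integral_le_integral_abs.trans (integral_mono (integrable_bump_mul hf hK _ _ _ hh).abs
    ((integrable_bump _ _ hh).const_mul _) fun y => ?_)
  simp only
  rw [abs_mul, abs_of_nonneg (bump_nonneg _ _ _ _), mul_comm]
  exact mul_le_mul_of_nonneg_right (hK _) (bump_nonneg _ _ _ _)

theorem ae_tendsto_mollify {D : ℝ≥0} {ρ₁ : ℝ} (hρ₁ : 0 < ρ₁)
    (hD : ∀ x ∈ S.μ.support, ∀ ρ : ℝ, 0 < ρ → ρ < ρ₁ →
      S.μ (Metric.ball x (4 * ρ)) ≤ D * S.μ (Metric.ball x ρ))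
    {f : (ι → A) × M → ℝ} (hf : Measurable f) {K : ℝ} (hK : ∀ z, |f z| ≤ K) (ω : ι → A) :
    ∀ᵐ x ∂S.μ, Tendsto (fun h => S.mollify f h (ω, x)) (𝓝[>] 0) (𝓝 (f (ω, x))) := by
  have hfi : Integrable (fun y => f (ω, y)) S.μ :=
    Integrable.of_bound (hf.comp measurable_prodMk_left).aestronglyMeasurable K
      (Eventually.of_forall fun y => hK _)
  filter_upwards [ae_tendsto_ball_integral_sub hρ₁ hD hfi, S.μ.support_mem_ae] with x hx hxs
  have h2 : Tendsto (fun h : ℝ => 2 * h) (𝓝[>] 0) (𝓝[>] 0) := by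
    refine tendsto_nhdsWithin_iff.2 ⟨?_, ?_⟩
    · have : Tendsto (fun h : ℝ => 2 * h) (𝓝 0) (𝓝 (2 * 0)) := tendsto_id.const_mul 2
      rw [mul_zero] at this
      exact this.mono_left nhdsWithin_le_nhds
    · filter_upwards [self_mem_nhdsWithin] with h hh
      have : (0 : ℝ) < h := hh
      exact mem_Ioi.2 (by positivity)
  have hlim := (hx.comp h2).const_mul (D : ℝ)
  rw [mul_zero] at hlim
  rw [tendsto_iff_dist_tendsto_zero]
  refine squeeze_zero' (Eventually.of_forall fun _ => dist_nonneg) ?_ hlim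
  filter_upwards [Ioo_mem_nhdsGT hρ₁] with h hh
  obtain ⟨hh0, hh1⟩ := hh
  have hB : MeasurableSet (Metric.ball x (2 * h)) := Metric.isOpen_ball.measurableSet
  set c := ∫ y, bump x h h y ∂S.μ with hc
  have hpos : 0 < S.μ.real (Metric.ball x h) := μ_ball_pos hxs hh0
  have hpos2 : 0 < S.μ.real (Metric.ball x (2 * h)) := μ_ball_pos hxs (by positivity)
  have hcb : S.μ.real (Metric.ball x h) ≤ c := measureReal_ball_le_integral_bump x h hh0
  have hc0 : 0 < c := hpos.trans_le hcb
  have hdoub : S.μ.real (Metric.ball x (2 * h)) ≤ D * c := by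
    have h3 := ENNReal.toReal_mono (ENNReal.mul_ne_top ENNReal.coe_ne_top (measure_ne_top _ _))
      (hD x hxs h hh0 hh1)
    rw [ENNReal.toReal_mul, ENNReal.coe_toReal] at h3
    calc S.μ.real (Metric.ball x (2 * h)) ≤ S.μ.real (Metric.ball x (4 * h)) :=
          measureReal_mono (Metric.ball_subset_ball (by linarith))
      _ ≤ D * S.μ.real (Metric.ball x h) := h3
      _ ≤ D * c := by gcongr
  have hi1 := integrable_bump_mul (S := S) hf hK ω x h hh0
  have hi2 : Integrable (fun y => bump x h h y * f (ω, x)) S.μ :=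
    (integrable_bump x h hh0).mul_const _
  have hi3 : Integrable (fun y => |f (ω, y) - f (ω, x)|) S.μ := (hfi.sub (integrable_const _)).abs
  set I := ∫ y in Metric.ball x (2 * h), |f (ω, y) - f (ω, x)| ∂S.μ with hI
  have hI0 : 0 ≤ I := integral_nonneg fun y => abs_nonneg _
  have h4 : S.mollify f h (ω, x) - f (ω, x)
      = (∫ y, (bump x h h y * f (ω, y) - bump x h h y * f (ω, x)) ∂S.μ) / c := by
    rw [integral_sub hi1 hi2, integral_mul_const, mollify, ← hc]
    field_simp
  have h5 : |∫ y, (bump x h h y * f (ω, y) - bump x h h y * f (ω, x)) ∂S.μ| ≤ I := by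
    rw [hI, ← integral_indicator hB]
    refine abs_integral_le_integral_abs.trans (integral_mono (hi1.sub hi2).abs (hi3.indicator hB)
      fun y => ?_)
    simp only
    rw [← mul_sub, abs_mul, abs_of_nonneg (bump_nonneg _ _ _ _)]
    by_cases hy : y ∈ Metric.ball x (2 * h)
    · rw [indicator_of_mem hy]
      exact mul_le_of_le_one_left (abs_nonneg _) (bump_le_one _ _ _ _)
    · rw [indicator_of_notMem hy, bump_eq_zero hh0 (by rw [Metric.mem_ball] at hy; linarith),
        zero_mul]
  rw [Real.dist_eq, h4, abs_div, abs_of_pos hc0]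
  simp only [Function.comp_apply]
  rw [div_le_iff₀ hc0]
  calc _ ≤ I := h5
    _ = S.μ.real (Metric.ball x (2 * h)) * (I / S.μ.real (Metric.ball x (2 * h))) := by field_simp
    _ ≤ D * c * (I / S.μ.real (Metric.ball x (2 * h))) := by gcongr
    _ = _ := by ring

theorem measurePreserving_shift_prod :
    MeasurePreserving (Prod.map shift id) (S.ν.prod S.μ) (S.ν.prod S.μ) :=
  S.inv_ν.prod (MeasurePreserving.id _)

theorem tendsto_integral_birkhoffAverage_mollify {lam δ : ℕ → ℝ} (hI : S.AnnealedDecay lam)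
    (hVI : S.Contraction δ) (hlam : Tendsto lam atTop (𝓝 0)) (hδ : Tendsto δ atTop (𝓝 0))
    {K : ℝ≥0} {C ρ₀ ξ : ℝ} (hreg : ∀ᵐ ω ∂S.ν, S.RegularAt lam K C ρ₀ ξ ω)
    {f : (ι → A) × M → ℝ} (hf : Measurable f) (hf0 : ∀ z, 0 ≤ f z) {b : ℝ} (hb : ∀ z, |f z| ≤ b)
    (hfd : ∀ᵐ ω ∂S.ν, S.μf ω = S.μ.withDensity fun y => ENNReal.ofReal (f (ω, y)))
    {x : M} (hx : x ∈ S.μ.support) {h : ℝ} (hh : 0 < h) :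
    Tendsto (fun n : ℕ => ∫ ω, |birkhoffAverage ℝ shift (fun ω => S.mollify f h (ω, x)) n ω - 1|
      ∂S.ν) atTop (𝓝 0) := by
  set Y : (ι → A) → ℝ := fun ω => S.mollify f h (ω, x) with hY
  have hYm : Measurable Y := (measurable_mollify hf h).comp measurable_prodMk_right
  have hYb : ∀ ω, |Y ω| ≤ b := fun ω => abs_mollify_le hf hb hh _
  set c := ∫ y, bump x h h y ∂S.μ with hc
  have hc0 : 0 < c := (μ_ball_pos hx hh).trans_le (measureReal_ball_le_integral_bump x h hh)
  set X : (ι → A) → ℝ := fun ω => ∫ y, bump x h h y ∂(S.μf ω) with hX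
  have hYX : ∀ᵐ ω ∂S.ν, Y ω = X ω / c := by
    filter_upwards [hfd] with ω hω
    rw [hX, hY]
    simp only [mollify, integral_eq_of_density hf hf0 hω]
    rw [← hc]
  have hmean : ∫ ω, Y ω ∂S.ν = 1 := by
    rw [integral_congr_ae hYX, integral_div, hX, ← integral_μ_eq (integrable_bump x h hh), ← hc,
      div_self hc0.ne']
  have hcov : Tendsto (fun k : ℕ => ∫ ω, Y ω * Y (shift^[k] ω) ∂S.ν) atTop
      (𝓝 ((∫ ω, Y ω ∂S.ν) ^ 2)) := by
    have h1 := (tendsto_integral_fibre_average_mul hI hVI hlam hδ hreg (lipschitzWith_bump x h hh)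
      (b := 1) (fun y => by
        rw [abs_of_nonneg (bump_nonneg _ _ _ _)]; exact bump_le_one _ _ _ _)).div_const (c ^ 2)
    have h2 : ∀ k : ℕ, ∫ ω, Y ω * Y (shift^[k] ω) ∂S.ν
        = (∫ ω, X ω * X (shift^[k] ω) ∂S.ν) / c ^ 2 := by
      intro k
      rw [← integral_div]
      refine integral_congr_ae ?_
      filter_upwards [S.ae_shift_iterate hYX] with ω hω
      have h3 : Y ω = X ω / c := hω 0
      rw [h3, hω k]
      field_simp
    simp only [h2]
    rw [hmean, one_pow]
    rwa [← hc, div_self (pow_ne_zero 2 hc0.ne')] at h1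
  have h1 := tendsto_integral_sq_birkhoffAverage S.inv_ν hYm hYb hcov
  rw [hmean] at h1
  exact tendsto_integral_abs_of_sq
    (fun n => (measurable_birkhoffAverage measurable_shift hYm n).sub_const 1)
    (fun n ω => abs_birkhoffAverage_sub_le hYb 1 n ω) h1

/-- The ergodic averages of the density of the fibre measures converge to one in mean. -/
theorem tendsto_integral_birkhoffAverage_density {lam δ : ℕ → ℝ} (hI : S.AnnealedDecay lam)
    (hVI : S.Contraction δ) (hlam : Tendsto lam atTop (𝓝 0)) (hδ : Tendsto δ atTop (𝓝 0))
    {K : ℝ≥0} {C ρ₀ ξ : ℝ} (hreg : ∀ᵐ ω ∂S.ν, S.RegularAt lam K C ρ₀ ξ ω)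
    {D : ℝ≥0} {ρ₁ : ℝ} (hρ₁ : 0 < ρ₁)
    (hD : ∀ x ∈ S.μ.support, ∀ ρ : ℝ, 0 < ρ → ρ < ρ₁ →
      S.μ (Metric.ball x (4 * ρ)) ≤ D * S.μ (Metric.ball x ρ))
    {f : (ι → A) × M → ℝ} (hf : Measurable f) (hf0 : ∀ z, 0 ≤ f z) {b : ℝ} (hb : ∀ z, |f z| ≤ b)
    (hfd : ∀ᵐ ω ∂S.ν, S.μf ω = S.μ.withDensity fun y => ENNReal.ofReal (f (ω, y))) :
    Tendsto (fun n : ℕ => ∫ z, |birkhoffAverage ℝ (Prod.map shift id) f n z - 1| ∂(S.ν.prod S.μ))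
      atTop (𝓝 0) := by
  set P := S.ν.prod S.μ with hP
  have hSP : MeasurePreserving (Prod.map shift id) P P := measurePreserving_shift_prod
  have hbi : ∀ {g : (ι → A) × M → ℝ} {c : ℝ}, Measurable g → (∀ z, |g z| ≤ c) → Integrable g P :=
    fun hg hc => Integrable.of_bound hg.aestronglyMeasurable _ (Eventually.of_forall hc)
  have hmd : ∀ h, Measurable fun z => |f z - S.mollify f h z| := fun h =>
    (hf.sub (measurable_mollify hf h)).abs
  have hbd : ∀ h, 0 < h → ∀ z, |f z - S.mollify f h z| ≤ b + b := fun h hh z =>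
    (abs_sub _ _).trans (add_le_add (hb z) (abs_mollify_le hf hb hh z))
  have hmoll : Tendsto (fun h => ∫ z, |f z - S.mollify f h z| ∂P) (𝓝[>] 0) (𝓝 0) := by
    have h1 : Tendsto (fun h => ∫ ω, ∫ x, |f (ω, x) - S.mollify f h (ω, x)| ∂S.μ ∂S.ν) (𝓝[>] 0)
        (𝓝 (∫ _, 0 ∂S.ν)) := by
      refine tendsto_integral_filter_of_dominated_convergence (fun _ => b + b)
        (Eventually.of_forall fun h =>
          ((hmd h).stronglyMeasurable.integral_prod_right').aestronglyMeasurable) ?_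
        (integrable_const _) (Eventually.of_forall fun ω => ?_)
      · filter_upwards [self_mem_nhdsWithin] with h hh
        refine Eventually.of_forall fun ω => ?_
        have := norm_integral_le_of_norm_le_const (μ := S.μ)
          (f := fun x => |f (ω, x) - S.mollify f h (ω, x)|) (C := b + b)
          (Eventually.of_forall fun x => by
            rw [Real.norm_eq_abs, abs_abs]; exact hbd h hh _)
        simpa using this
      · have h2 : Tendsto (fun h => ∫ x, |f (ω, x) - S.mollify f h (ω, x)| ∂S.μ) (𝓝[>] 0)
            (𝓝 (∫ _, 0 ∂S.μ)) := by
          refine tendsto_integral_filter_of_dominated_convergence (fun _ => b + b)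
            (Eventually.of_forall fun h =>
              ((hmd h).comp measurable_prodMk_left).aestronglyMeasurable) ?_
            (integrable_const _) ?_
          · filter_upwards [self_mem_nhdsWithin] with h hh
            exact Eventually.of_forall fun x => by
              rw [Real.norm_eq_abs, abs_abs]; exact hbd h hh _
          · filter_upwards [ae_tendsto_mollify hρ₁ hD hf hb ω] with x hx
            have := (tendsto_const_nhds (x := f (ω, x))).sub hx |>.abs
            rwa [sub_self, abs_zero] at this
        rwa [integral_zero] at h2
    rw [integral_zero] at h1
    refine h1.congr' ?_
    filter_upwards [self_mem_nhdsWithin] with h hh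
    rw [hP, integral_prod _ (hbi (hmd h) fun z => by rw [abs_abs]; exact hbd h hh z)]
  rw [Metric.tendsto_atTop]
  intro ε hε
  obtain ⟨h, hh1, hh⟩ := ((hmoll.eventually_lt_const (show (0 : ℝ) < ε / 2 by positivity)).and
    self_mem_nhdsWithin).exists
  have hh0 : 0 < h := hh
  set g := S.mollify f h with hg
  have hgm : Measurable g := measurable_mollify hf h
  have hgb : ∀ z, |g z| ≤ b := abs_mollify_le hf hb hh0
  have hAm : ∀ {u : (ι → A) × M → ℝ} (n), Measurable u →
      Measurable (birkhoffAverage ℝ (Prod.map shift id) u n) := fun n hu =>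
    measurable_birkhoffAverage hSP.measurable hu n
  have hg1 : Tendsto (fun n : ℕ => ∫ z, |birkhoffAverage ℝ (Prod.map shift id) g n z - 1| ∂P)
      atTop (𝓝 0) := by
    have h1 : Tendsto (fun n : ℕ => ∫ x, ∫ ω,
        |birkhoffAverage ℝ (Prod.map shift id) g n (ω, x) - 1| ∂S.ν ∂S.μ) atTop
        (𝓝 (∫ _, 0 ∂S.μ)) := by
      refine tendsto_integral_of_dominated_convergence (fun _ => b + |1|) (fun n => ?_)
        (integrable_const _) (fun n => Eventually.of_forall fun x => ?_) ?_
      · have h2 : Measurable fun z => |birkhoffAverage ℝ (Prod.map shift id) g n z - 1| :=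
          ((hAm n hgm).sub_const 1).abs
        exact (h2.stronglyMeasurable.integral_prod_left').aestronglyMeasurable
      · have := norm_integral_le_of_norm_le_const (μ := S.ν)
          (f := fun ω => |birkhoffAverage ℝ (Prod.map shift id) g n (ω, x) - 1|) (C := b + |1|)
          (Eventually.of_forall fun ω => by
            rw [Real.norm_eq_abs, abs_abs]; exact abs_birkhoffAverage_sub_le hgb 1 n _)
        simpa using this
      · filter_upwards [S.μ.support_mem_ae] with x hx
        simp only [birkhoffAverage_shift_prod]
        exact tendsto_integral_birkhoffAverage_mollify hI hVI hlam hδ hreg hf hf0 hb hfd hx hh0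
    rw [integral_zero] at h1
    refine h1.congr fun n => ?_
    rw [hP, integral_prod_symm _ (hbi ((hAm n hgm).sub_const 1).abs fun z => by
      rw [abs_abs]; exact abs_birkhoffAverage_sub_le hgb 1 n z)]
  obtain ⟨N, hN⟩ := eventually_atTop.1
    (hg1.eventually_lt_const (show (0 : ℝ) < ε / 2 by positivity))
  refine ⟨N, fun n hn => ?_⟩
  rw [Real.dist_eq, sub_zero, abs_of_nonneg (integral_nonneg fun z => abs_nonneg _)]
  have hfg : Integrable (fun z => f z - g z) P := hbi (hf.sub hgm) (hbd h hh0)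
  have h3 := integral_abs_birkhoffAverage_le hSP hfg n
  have hi2 : Integrable (fun z => |birkhoffAverage ℝ (Prod.map shift id) (fun z => f z - g z) n z|)
      P := hbi (hAm n (hf.sub hgm)).abs fun z => by
    rw [abs_abs]; exact abs_birkhoffAverage_le (hbd h hh0) n z
  have hi3 : Integrable (fun z => |birkhoffAverage ℝ (Prod.map shift id) g n z - 1|) P :=
    hbi ((hAm n hgm).sub_const 1).abs fun z => by
      rw [abs_abs]; exact abs_birkhoffAverage_sub_le hgb 1 n z
  calc ∫ z, |birkhoffAverage ℝ (Prod.map shift id) f n z - 1| ∂P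
      ≤ ∫ z, (|birkhoffAverage ℝ (Prod.map shift id) (fun z => f z - g z) n z|
        + |birkhoffAverage ℝ (Prod.map shift id) g n z - 1|) ∂P := by
        refine integral_mono (hbi ((hAm n hf).sub_const 1).abs fun z => by
          rw [abs_abs]; exact abs_birkhoffAverage_sub_le hb 1 n z) (hi2.add hi3) fun z => ?_
        have h4 : birkhoffAverage ℝ (Prod.map shift id) (fun z => f z - g z) n z
            = birkhoffAverage ℝ (Prod.map shift id) f n z
              - birkhoffAverage ℝ (Prod.map shift id) g n z := by
          simp only [birkhoffAverage, birkhoffSum, Finset.sum_sub_distrib, smul_sub]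
        simp only [h4]
        exact abs_sub_le _ _ _
    _ = _ := integral_add hi2 hi3
    _ < ε / 2 + ε / 2 := add_lt_add (h3.trans_lt hh1) (hN n hn)
    _ = ε := add_halves ε

end System

theorem birkhoffSum_indicator_le {X : Type*} (S : X → X) (E : Set X) (N : ℕ) (x : X) :
    birkhoffSum S (E.indicator fun _ => (1 : ℝ)) N x ≤ N * maxFrequency S E x := by
  rcases N with _ | N
  · simp
  have h := birkhoffAverage_le_maxFrequency S E N x
  rwa [birkhoffAverage, smul_eq_mul, inv_mul_le_iff₀ (by positivity)] at h

theorem abs_birkhoffSum_sub_le_tailDeviation {X : Type*} {S : X → X} {f : X → ℝ} {K : ℝ}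
    (hK : ∀ x, |f x| ≤ K) (c : ℝ) {n N : ℕ} (h : n ≤ N) (x : X) :
    |birkhoffSum S f N x - N * c| ≤ N * tailDeviation S f c n x := by
  rcases Nat.eq_zero_or_pos N with rfl | hN
  · simp
  have hN' : (0 : ℝ) < N := by exact_mod_cast hN
  have h1 : birkhoffSum S f N x - N * c = N * (birkhoffAverage ℝ S f N x - c) := by
    rw [birkhoffAverage, smul_eq_mul]; field_simp
  rw [h1, abs_mul, abs_of_pos hN']
  exact mul_le_mul_of_nonneg_left (le_tailDeviation hK c h x) hN'.le

section Integrability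

variable {ι A M : Type*} [AddMonoidWithOne ι] [MeasurableSpace A] [MeasurableSpace M]
    {m : Measure M} [IsFiniteMeasure m]

theorem integrable_maxFrequency {E : Set ((ι → A) × M)} (hE : MeasurableSet E) (ω : ι → A) :
    Integrable (fun y => maxFrequency (Prod.map shift id) E (ω, y)) m := by
  have h : Measurable (maxFrequency (Prod.map shift id) E) :=
    measurable_maxFrequency (measurable_shift.prodMap measurable_id) hE
  refine Integrable.of_bound (h.comp measurable_prodMk_left).aestronglyMeasurable
    1 (Eventually.of_forall fun y => ?_)
  rw [Real.norm_eq_abs, abs_of_nonneg (maxFrequency_nonneg _ _ _)]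
  exact maxFrequency_le_one _ _ _

theorem integrable_tailDeviation {f : (ι → A) × M → ℝ} (hf : Measurable f) {b : ℝ}
    (hb : ∀ z, |f z| ≤ b) (c : ℝ) (n : ℕ) (ω : ι → A) :
    Integrable (fun y => tailDeviation (Prod.map shift id) f c n (ω, y)) m := by
  have h : Measurable (tailDeviation (Prod.map shift id) f c n) :=
    measurable_tailDeviation (measurable_shift.prodMap measurable_id) hf c n
  refine Integrable.of_bound (h.comp measurable_prodMk_left).aestronglyMeasurable
    (b + |c|) (Eventually.of_forall fun y => ?_)
  rw [Real.norm_eq_abs, abs_of_nonneg (tailDeviation_nonneg hb c n _)]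
  exact tailDeviation_le hb c n _

end Integrability

namespace System

variable {ι A M U : Type*} [AddMonoidWithOne ι] [MeasurableSpace A]
    [MetricSpace M] [CompactSpace M] [MeasurableSpace M] [BorelSpace M]
    [MeasurableSpace U] {S : System ι A M U}

/-- In small balls about `x` the frequency of close returns is small. -/
def RareReturnsAt (S : System ι A M U) (a : ℝ) (ω : ι → A) (x : M) : Prop :=
  ∀ ε : ℝ, 0 < ε → ∃ n, ∀ᶠ ρ : ℝ in 𝓝[>] 0,
    ∫ y in Metric.ball x ρ, maxFrequency (Prod.map shift id) (S.closeReturns a n) (ω, y) ∂S.μ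
      ≤ ε * S.μ.real (Metric.ball x ρ)

/-- In small balls about `x` the averages of the density `f` are close to one. -/
def EquidistributedAt (S : System ι A M U) (f : (ι → A) × M → ℝ) (ω : ι → A) (x : M) : Prop :=
  ∀ ε : ℝ, 0 < ε → ∃ n, ∀ᶠ ρ : ℝ in 𝓝[>] 0,
    ∫ y in Metric.ball x ρ, tailDeviation (Prod.map shift id) f 1 n (ω, y) ∂S.μ
      ≤ ε * S.μ.real (Metric.ball x ρ)

theorem ae_rareReturnsAt {D : ℝ≥0} {ρ₁ : ℝ} (hρ₁ : 0 < ρ₁)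
    (hD : ∀ x ∈ S.μ.support, ∀ ρ : ℝ, 0 < ρ → ρ < ρ₁ →
      S.μ (Metric.ball x (4 * ρ)) ≤ D * S.μ (Metric.ball x ρ)) {a : ℝ}
    (hnull : ∀ᵐ ω ∂S.ν, S.μ (Prod.mk ω ⁻¹' ⋂ n, S.closeReturns a n) = 0) :
    ∀ᵐ ω ∂S.ν, ∀ᵐ x ∂S.μ, S.RareReturnsAt a ω x := by
  have hm : ∀ n, MeasurableSet (S.closeReturns a n) := measurableSet_closeReturns a
  have hP : (S.ν.prod S.μ) (⋂ n, S.closeReturns a n) = 0 :=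
    (Measure.measure_prod_null (MeasurableSet.iInter hm)).2 hnull
  have hlim := ae_tendsto_maxFrequency measurePreserving_shift_prod hm (antitone_closeReturns a) hP
  filter_upwards [Measure.ae_ae_of_ae_prod hlim] with ω hω
  refine ae_exists_setIntegral_ball_le hρ₁ hD (fun n => integrable_maxFrequency (hm n) ω) hω

theorem ae_equidistributedAt {D : ℝ≥0} {ρ₁ : ℝ} (hρ₁ : 0 < ρ₁)
    (hD : ∀ x ∈ S.μ.support, ∀ ρ : ℝ, 0 < ρ → ρ < ρ₁ →
      S.μ (Metric.ball x (4 * ρ)) ≤ D * S.μ (Metric.ball x ρ))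
    {f : (ι → A) × M → ℝ} (hf : Measurable f) {b : ℝ} (hb : ∀ z, |f z| ≤ b)
    (hlim : Tendsto (fun n : ℕ => ∫ z, |birkhoffAverage ℝ (Prod.map shift id) f n z - 1|
      ∂(S.ν.prod S.μ)) atTop (𝓝 0)) :
    ∀ᵐ ω ∂S.ν, ∀ᵐ x ∂S.μ, S.EquidistributedAt f ω x := by
  have h1 := ae_tendsto_birkhoffAverage measurePreserving_shift_prod hf hb 1 hlim
  filter_upwards [Measure.ae_ae_of_ae_prod h1] with ω hω
  refine ae_exists_setIntegral_ball_le hρ₁ hD (fun n => integrable_tailDeviation hf hb 1 n ω) ?_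
  filter_upwards [hω] with x hx
  exact tendsto_tailDeviation hb hx

theorem integrable_setIndicator {E : Set ((ι → A) × M)} (hE : MeasurableSet E) (ω : ι → A)
    (B : Set M) :
    Integrable (fun y => E.indicator (fun _ => (1 : ℝ)) (ω, y)) (S.μ.restrict B) :=
  Integrable.of_bound ((measurable_const.indicator hE).comp
    measurable_prodMk_left).aestronglyMeasurable 1
    (Eventually.of_forall fun _ => abs_indicator_one_le _ _)

theorem measureReal_inter_section {E : Set ((ι → A) × M)} (hE : MeasurableSet E) (ω : ι → A)
    (B : Set M) :
    S.μ.real (B ∩ Prod.mk ω ⁻¹' E) = ∫ y in B, E.indicator (fun _ => (1 : ℝ)) (ω, y) ∂S.μ := by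
  have h : ∀ y, E.indicator (fun _ => (1 : ℝ)) (ω, y)
      = (Prod.mk ω ⁻¹' E).indicator (fun _ => (1 : ℝ)) y := fun y => rfl
  simp only [h]
  rw [integral_indicator (measurable_prodMk_left hE)]
  simp [measureReal_restrict_apply (measurable_prodMk_left hE), inter_comm]

/-- The number of hits expected up to the time `t / μ(B)` tends to `t`. -/
theorem EquidistributedAt.tendsto_sum {f : (ι → A) × M → ℝ} (hf : Measurable f)
    (hf0 : ∀ z, 0 ≤ f z) {b : ℝ} (hb : ∀ z, |f z| ≤ b) {ω : ι → A} {x : M}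
    (h : S.EquidistributedAt f ω x) (hx : x ∈ S.μ.support)
    (hfd : ∀ k : ℕ, S.μf (shift^[k] ω)
      = S.μ.withDensity fun y => ENNReal.ofReal (f (shift^[k] ω, y)))
    (hsmall : Tendsto (fun ρ => S.μ.real (Metric.ball x ρ)) (𝓝[>] 0) (𝓝 0)) {t : ℝ} (ht : 0 < t) :
    Tendsto (fun ρ => ∑ k ∈ Finset.range ⌊t / S.μ.real (Metric.ball x ρ)⌋₊,
      (S.μf (shift^[k] ω)).real (Metric.ball x ρ)) (𝓝[>] 0) (𝓝 t) := by
  rw [Metric.tendsto_nhds]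
  intro ε hε
  obtain ⟨n, hn⟩ := h (ε / (2 * t)) (by positivity)
  have hn1 : 0 < min (ε / 2) (t / (n + 1)) := by positivity
  filter_upwards [hn, hsmall.eventually_lt_const hn1, self_mem_nhdsWithin] with ρ h1 h2 hρ
  have hρ0 : (0 : ℝ) < ρ := hρ
  obtain ⟨h2, h3⟩ := lt_min_iff.1 h2
  set B := Metric.ball x ρ with hB
  have hBm : MeasurableSet B := Metric.isOpen_ball.measurableSet
  set m := S.μ.real B with hm
  have hm0 : 0 < m := μ_ball_pos hx hρ0
  set N := ⌊t / m⌋₊ with hN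
  have hN1 : (N : ℝ) * m ≤ t := by
    rw [← le_div_iff₀ hm0]; exact Nat.floor_le (by positivity)
  have hN2 : t - m ≤ N * m := by
    have := Nat.lt_floor_add_one (t / m)
    rw [div_lt_iff₀ hm0] at this
    linarith
  have hnN : n ≤ N := by
    refine Nat.le_floor ?_
    rw [le_div_iff₀ hm0]
    rw [lt_div_iff₀ (by positivity)] at h3
    nlinarith
  have hfi : ∀ k : ℕ, Integrable (fun y => f (shift^[k] ω, y)) (S.μ.restrict B) := fun k =>
    Integrable.of_bound (hf.comp measurable_prodMk_left).aestronglyMeasurable b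
      (Eventually.of_forall fun y => hb _)
  have hsum : ∑ k ∈ Finset.range N, (S.μf (shift^[k] ω)).real B
      = ∫ y in B, birkhoffSum (Prod.map shift id) f N (ω, y) ∂S.μ := by
    simp only [birkhoffSum, Prod.map_iterate, Function.iterate_id, Prod.map_apply, id_eq]
    rw [integral_finsetSum _ fun k _ => hfi k]
    exact Finset.sum_congr rfl fun k _ => measureReal_eq_of_density hf hf0 (hfd k) hBm
  have hbs : Integrable (fun y => birkhoffSum (Prod.map shift id) f N (ω, y)) (S.μ.restrict B) := by
    simp only [birkhoffSum, Prod.map_iterate, Function.iterate_id, Prod.map_apply, id_eq]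
    exact integrable_finsetSum _ fun k _ => hfi k
  have htd : Integrable (fun y => tailDeviation (Prod.map shift id) f 1 n (ω, y))
      (S.μ.restrict B) := integrable_tailDeviation hf hb 1 n ω
  have hdev : |∑ k ∈ Finset.range N, (S.μf (shift^[k] ω)).real B - N * m| ≤ ε / 2 := by
    have e1 : ∑ k ∈ Finset.range N, (S.μf (shift^[k] ω)).real B - N * m
        = ∫ y in B, (birkhoffSum (Prod.map shift id) f N (ω, y) - N * 1) ∂S.μ := by
      rw [hsum, integral_sub hbs (integrable_const _)]
      simp [mul_comm, hm]
    rw [e1]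
    calc _ ≤ ∫ y in B, |birkhoffSum (Prod.map shift id) f N (ω, y) - N * 1| ∂S.μ :=
          abs_integral_le_integral_abs
      _ ≤ ∫ y in B, N * tailDeviation (Prod.map shift id) f 1 n (ω, y) ∂S.μ :=
          integral_mono (hbs.sub (integrable_const _)).abs (htd.const_mul _) fun y =>
            abs_birkhoffSum_sub_le_tailDeviation hb 1 hnN _
      _ = N * ∫ y in B, tailDeviation (Prod.map shift id) f 1 n (ω, y) ∂S.μ := by
          rw [integral_const_mul]
      _ ≤ N * (ε / (2 * t) * m) := by gcongr
      _ = ε / (2 * t) * (N * m) := by ring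
      _ ≤ ε / (2 * t) * t := by gcongr
      _ = ε / 2 := by field_simp
  rw [Real.dist_eq]
  rw [abs_le] at hdev
  rw [abs_lt]
  constructor <;> linarith [hdev.1, hdev.2]

/-- The decorrelation errors sum up to little. -/
theorem RareReturnsAt.exists_eventually_sum_le {a : ℝ} {ω : ι → A} {x : M}
    (h : S.RareReturnsAt a ω x) (hx : x ∈ S.μ.support) {t : ℝ} (ht : 0 < t) {ε : ℝ} (hε : 0 < ε) :
    ∃ n, ∀ᶠ ρ : ℝ in 𝓝[>] 0,
      S.μ.real (Metric.ball x ρ ∩ Prod.mk ω ⁻¹' S.closeReturns a n)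
        ≤ ε * S.μ.real (Metric.ball x ρ) ∧
      ∑ k ∈ Finset.range ⌊t / S.μ.real (Metric.ball x ρ)⌋₊,
        S.μ.real (Metric.ball x ρ ∩ Prod.mk (shift^[k] ω) ⁻¹' S.closeReturns a n) ≤ ε * t := by
  obtain ⟨n, hn⟩ := h ε hε
  refine ⟨n, ?_⟩
  filter_upwards [hn, self_mem_nhdsWithin] with ρ h1 hρ
  have hρ0 : (0 : ℝ) < ρ := hρ
  set B := Metric.ball x ρ with hB
  set m := S.μ.real B with hm
  have hm0 : 0 < m := μ_ball_pos hx hρ0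
  set N := ⌊t / m⌋₊ with hN
  have hN1 : (N : ℝ) * m ≤ t := by
    rw [← le_div_iff₀ hm0]; exact Nat.floor_le (by positivity)
  set E := S.closeReturns a n with hE
  have hEm : MeasurableSet E := measurableSet_closeReturns a n
  have hmf : Integrable (fun y => maxFrequency (Prod.map shift id) E (ω, y))
      (S.μ.restrict B) := integrable_maxFrequency hEm ω
  constructor
  · rw [measureReal_inter_section hEm]
    exact (integral_mono (integrable_setIndicator hEm ω B) hmf fun y =>
      indicator_le_maxFrequency _ _ _).trans h1
  · simp only [measureReal_inter_section hEm]
    rw [← integral_finsetSum _ fun k _ => integrable_setIndicator hEm _ B]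
    calc _ ≤ ∫ y in B, N * maxFrequency (Prod.map shift id) E (ω, y) ∂S.μ := by
          refine integral_mono (integrable_finsetSum _ fun k _ => integrable_setIndicator hEm _ B)
            (hmf.const_mul _) fun y => ?_
          have := birkhoffSum_indicator_le (Prod.map shift id) E N (ω, y)
          simp only [birkhoffSum, Prod.map_iterate, Function.iterate_id, Prod.map_apply,
            id_eq] at this
          exact this
      _ = N * ∫ y in B, maxFrequency (Prod.map shift id) E (ω, y) ∂S.μ := integral_const_mul _ _
      _ ≤ N * (ε * m) := by gcongr
      _ = ε * (N * m) := by ring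
      _ ≤ ε * t := by gcongr

/-- The decorrelation bound used at a point `x`. -/
def DecorrelatesAt (S : System ι A M U) (v : ℝ) (ω : ι → A) (x : M) : Prop :=
  ∀ ε : ℝ, 0 < ε → ∀ᶠ ρ : ℝ in 𝓝[>] 0, ∀ k n : ℕ,
    |(S.μf (shift^[k] ω)).real (Metric.ball x ρ ∩ S.avoid (shift^[k] ω) (Metric.ball x ρ) 0 n)
        - (S.μf (shift^[k] ω)).real (Metric.ball x ρ)
          * (S.μf (shift^[k] ω)).real (S.avoid (shift^[k] ω) (Metric.ball x ρ) 0 n)|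
      ≤ (S.μf (shift^[k] ω)).real (Metric.ball x ρ ∩ S.visit (shift^[k] ω)
          (fun _ => Metric.ball x ρ) 0 (⌈ρ ^ (-v)⌉₊ + ⌈ρ ^ (-v)⌉₊))
        + ε * S.μ.real (Metric.ball x ρ)

theorem DecorrelatesAt.eventually_le {a v : ℝ} (ha : 0 < a) (hav : v * a < 1) (hv : 0 < v)
    {ω : ι → A} {x : M} (h : S.DecorrelatesAt v ω x) {K : ℝ≥0}
    (hK : ∀ k E, (S.μf (shift^[k] ω)).real E ≤ K * S.μ.real E) (i : ℕ) {ε : ℝ} (hε : 0 < ε) :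
    ∀ᶠ ρ : ℝ in 𝓝[>] 0, ∀ k n : ℕ,
    |(S.μf (shift^[k] ω)).real (Metric.ball x ρ ∩ S.avoid (shift^[k] ω) (Metric.ball x ρ) 0 n)
        - (S.μf (shift^[k] ω)).real (Metric.ball x ρ)
          * (S.μf (shift^[k] ω)).real (S.avoid (shift^[k] ω) (Metric.ball x ρ) 0 n)|
      ≤ K * S.μ.real (Metric.ball x ρ ∩ Prod.mk (shift^[k] ω) ⁻¹' S.closeReturns a i)
        + ε * S.μ.real (Metric.ball x ρ) := by
  filter_upwards [h ε hε, inter_visit_subset_closeReturns (S := S) ha hav hv i] with ρ h1 h2 k n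
  refine (h1 k n).trans (add_le_add ?_ le_rfl)
  refine (measureReal_mono ?_).trans (hK k _)
  exact subset_inter inter_subset_left (h2 x (shift^[k] ω))

/-- The limit law for the hitting times. -/
theorem tendsto_measureReal_avoid {a v : ℝ} (ha : 0 < a) (hav : v * a < 1) (hv : 0 < v)
    {f : (ι → A) × M → ℝ} (hf : Measurable f) (hf0 : ∀ z, 0 ≤ f z) {b : ℝ} (hb : ∀ z, |f z| ≤ b)
    {ω : ι → A} {x : M} (hx : x ∈ S.μ.support) (hinv : S.InvariantAlong ω)
    (hdec : S.DecorrelatesAt v ω x) {K : ℝ≥0}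
    (hK : ∀ k E, (S.μf (shift^[k] ω)).real E ≤ K * S.μ.real E)
    (hret : S.RareReturnsAt a (shift ω) x) (heq : S.EquidistributedAt f (shift ω) x)
    (hfd : ∀ k : ℕ, S.μf (shift^[k] ω)
      = S.μ.withDensity fun y => ENNReal.ofReal (f (shift^[k] ω, y)))
    (hsmall : Tendsto (fun ρ => S.μ.real (Metric.ball x ρ)) (𝓝[>] 0) (𝓝 0)) {t : ℝ} (ht : 0 < t) :
    Tendsto (fun ρ => (S.μf ω).real
      (S.avoid ω (Metric.ball x ρ) 0 ⌊t / S.μ.real (Metric.ball x ρ)⌋₊)) (𝓝[>] 0)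
      (𝓝 (Real.exp (-t))) := by
  have hsh : ∀ k, shift^[k] (shift ω) = shift^[k + 1] ω := fun k => rfl
  have hsum := heq.tendsto_sum hf hf0 hb hx (fun k => hfd (k + 1)) hsmall ht
  have hexp := (Real.continuous_exp.tendsto (-t)).comp hsum.neg
  suffices hdiff : Tendsto (fun ρ => (S.μf ω).real
      (S.avoid ω (Metric.ball x ρ) 0 ⌊t / S.μ.real (Metric.ball x ρ)⌋₊)
        - Real.exp (-∑ k ∈ Finset.range ⌊t / S.μ.real (Metric.ball x ρ)⌋₊,
          (S.μf (shift^[k] (shift ω))).real (Metric.ball x ρ))) (𝓝[>] 0) (𝓝 0) by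
    have := hdiff.add hexp
    simp only [Function.comp_apply, sub_add_cancel, zero_add] at this
    exact this
  rw [Metric.tendsto_nhds]
  intro ε hε
  set η := ε / (2 * ((K + 1) * t)) with hη
  have hη0 : 0 < η := by positivity
  obtain ⟨i, hi⟩ := hret.exists_eventually_sum_le hx ht hη0
  have hsq : Tendsto (fun ρ => (K : ℝ) ^ 2 * t * S.μ.real (Metric.ball x ρ)) (𝓝[>] 0) (𝓝 0) := by
    have := hsmall.const_mul ((K : ℝ) ^ 2 * t)
    rwa [mul_zero] at this
  filter_upwards [hi, hdec.eventually_le ha hav hv hK i hη0,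
    hsq.eventually_lt_const (show (0 : ℝ) < ε / 2 by positivity), self_mem_nhdsWithin]
    with ρ h1 h2 h3 hρ
  have hρ0 : (0 : ℝ) < ρ := hρ
  have h1 := h1.2
  set B := Metric.ball x ρ with hB
  have hBm : MeasurableSet B := Metric.isOpen_ball.measurableSet
  set m := S.μ.real B with hm
  have hm0 : 0 < m := μ_ball_pos hx hρ0
  set N := ⌊t / m⌋₊ with hN
  have hN1 : (N : ℝ) * m ≤ t := by
    rw [← le_div_iff₀ hm0]; exact Nat.floor_le (by positivity)
  have hmain := hinv.abs_avoid_sub_exp_le hBm (N := N)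
    (e := fun ω' => K * S.μ.real (B ∩ Prod.mk ω' ⁻¹' S.closeReturns a i) + η * m)
    fun k n => h2 (k + 1) n
  rw [Real.dist_eq, sub_zero]
  refine hmain.trans_lt ?_
  have hsqk : ∀ k : ℕ, (S.μf (shift^[k + 1] ω)).real B ^ 2 ≤ (K * m) ^ 2 := fun k => by
    have := hK (k + 1) B
    gcongr
  calc _ ≤ ∑ k ∈ Finset.range N, (K * S.μ.real (B ∩ Prod.mk (shift^[k + 1] ω) ⁻¹'
          S.closeReturns a i) + η * m + (K * m) ^ 2) :=
        Finset.sum_le_sum fun k _ => add_le_add le_rfl (hsqk k)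
    _ = K * ∑ k ∈ Finset.range N, S.μ.real (B ∩ Prod.mk (shift^[k + 1] ω) ⁻¹'
          S.closeReturns a i) + η * (N * m) + K ^ 2 * (N * m) * m := by
        rw [Finset.sum_add_distrib, Finset.sum_add_distrib, Finset.mul_sum]
        simp only [Finset.sum_const, Finset.card_range, nsmul_eq_mul]
        ring
    _ ≤ K * (η * t) + η * t + K ^ 2 * t * m := by
        have h1' : ∑ k ∈ Finset.range N, S.μ.real (B ∩ Prod.mk (shift^[k + 1] ω) ⁻¹'
          S.closeReturns a i) ≤ η * t := h1
        gcongr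
    _ < ε / 2 + ε / 2 := by
        have : K * (η * t) + η * t = ε / 2 := by rw [hη]; field_simp
        rw [this]
        linarith
    _ = ε := add_halves ε

/-- The limit law for the return times. -/
theorem tendsto_cond_measureReal_avoid {a v : ℝ} (ha : 0 < a) (hav : v * a < 1) (hv : 0 < v)
    {ω : ι → A} {x : M} (hx : x ∈ S.μ.support)
    (hdec : S.DecorrelatesAt v ω x) {K K' : ℝ≥0}
    (hK : ∀ k E, (S.μf (shift^[k] ω)).real E ≤ K * S.μ.real E)
    (hK' : ∀ E, S.μ.real E ≤ K' * (S.μf ω).real E)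
    (hret : S.RareReturnsAt a ω x) {N : ℝ → ℕ} {l : ℝ}
    (hhit : Tendsto (fun ρ => (S.μf ω).real (S.avoid ω (Metric.ball x ρ) 0 (N ρ))) (𝓝[>] 0)
      (𝓝 l)) :
    Tendsto (fun ρ => ((S.μf ω)[|Metric.ball x ρ]).real (S.avoid ω (Metric.ball x ρ) 0 (N ρ)))
      (𝓝[>] 0) (𝓝 l) := by
  suffices hdiff : Tendsto (fun ρ => ((S.μf ω)[|Metric.ball x ρ]).real
      (S.avoid ω (Metric.ball x ρ) 0 (N ρ))
        - (S.μf ω).real (S.avoid ω (Metric.ball x ρ) 0 (N ρ))) (𝓝[>] 0) (𝓝 0) by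
    have := hdiff.add hhit
    simpa only [sub_add_cancel, zero_add] using this
  rw [Metric.tendsto_nhds]
  intro ε hε
  set η := ε / (2 * ((K + 1) * (K' + 1))) with hη
  have hη0 : 0 < η := by positivity
  obtain ⟨i, hi⟩ := hret.exists_eventually_sum_le hx one_pos hη0
  filter_upwards [hi, hdec.eventually_le ha hav hv hK i hη0, self_mem_nhdsWithin] with ρ h1 h2 hρ
  have hρ0 : (0 : ℝ) < ρ := hρ
  have h1 := h1.1
  have h2 := h2 0 (N ρ)
  simp only [Function.iterate_zero, id_eq] at h2
  set B := Metric.ball x ρ with hB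
  have hBm : MeasurableSet B := Metric.isOpen_ball.measurableSet
  set m := S.μ.real B with hm
  set m₀ := (S.μf ω).real B with hm₀
  have hm0 : 0 < m := μ_ball_pos hx hρ0
  have hmm : m ≤ K' * m₀ := hK' B
  have hm₀0 : 0 < m₀ := by
    by_contra hneg
    have : m₀ = 0 := le_antisymm (not_lt.1 hneg) measureReal_nonneg
    rw [this, mul_zero] at hmm
    linarith
  set E := S.avoid ω B 0 (N ρ) with hE
  have hcond : ((S.μf ω)[|B]).real E = (S.μf ω).real (B ∩ E) / m₀ := by
    rw [measureReal_def, cond_apply hBm, ENNReal.toReal_mul, ENNReal.toReal_inv, inv_mul_eq_div]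
    rfl
  have h3 : (S.μf ω).real (B ∩ E) / m₀ - (S.μf ω).real E
      = ((S.μf ω).real (B ∩ E) - m₀ * (S.μf ω).real E) / m₀ := by field_simp
  rw [Real.dist_eq, sub_zero, hcond, h3, abs_div, abs_of_pos hm₀0, div_lt_iff₀ hm₀0]
  calc _ ≤ K * S.μ.real (B ∩ Prod.mk ω ⁻¹' S.closeReturns a i) + η * m := h2
    _ ≤ K * (η * m) + η * m := by gcongr
    _ = (K + 1) * η * m := by ring
    _ ≤ (K + 1) * η * ((K' + 1) * m₀) := by
        gcongr
        exact hmm.trans (by gcongr; linarith)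
    _ = ε / 2 * m₀ := by rw [hη]; field_simp
    _ < ε * m₀ := by
        have : ε / 2 < ε := by linarith
        gcongr

theorem lateHits_eq_avoid {ω : ι → A} {x : M} (hx : x ∈ S.μ.support) {ρ t : ℝ} (hρ : 0 < ρ)
    (ht : 0 < t) : S.lateHits ω x ρ t
      = S.avoid ω (Metric.ball x ρ) 0 ⌊t / S.μ.real (Metric.ball x ρ)⌋₊ := by
  set B := Metric.ball x ρ with hB
  have hm0 : 0 < S.μ.real B := μ_ball_pos hx hρ
  have hdiv : ENNReal.ofReal t / S.μ B = ENNReal.ofReal (t / S.μ.real B) := by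
    rw [ENNReal.ofReal_div_of_pos hm0, measureReal_def, ENNReal.ofReal_toReal (measure_ne_top _ _)]
  ext y
  simp only [lateHits, avoid, mem_ofPred_eq, ← hB, hdiv]
  constructor
  · intro h j hj hjN hjB
    have h1 : hittingTime S.T ω B y ≤ (j : ℕ∞) := iInf₂_le j ⟨hj, hjB⟩
    have h2 : ((hittingTime S.T ω B y : ℕ∞) : ℝ≥0∞) ≤ ((j : ℕ∞) : ℝ≥0∞) :=
      ENat.toENNReal_le.2 h1
    rw [ENat.toENNReal_coe, ← ENNReal.ofReal_natCast] at h2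
    have h3 : (j : ℝ) ≤ t / S.μ.real B := (Nat.le_floor_iff (by positivity)).1 hjN
    exact absurd (h.trans_le h2) (not_lt.2 (ENNReal.ofReal_le_ofReal h3))
  · intro h
    have h1 : ((⌊t / S.μ.real B⌋₊ + 1 : ℕ) : ℕ∞) ≤ hittingTime S.T ω B y := by
      refine le_iInf₂ fun j hj => ?_
      rw [Nat.cast_le]
      by_contra hlt
      exact h j hj.1 (by omega) hj.2
    have h2 : ((⌊t / S.μ.real B⌋₊ + 1 : ℕ) : ℝ≥0∞) ≤ ((hittingTime S.T ω B y : ℕ∞) : ℝ≥0∞) := by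
      have := ENat.toENNReal_le.2 h1
      rwa [ENat.toENNReal_coe] at this
    refine lt_of_lt_of_le ?_ h2
    rw [← ENNReal.ofReal_natCast, ENNReal.ofReal_lt_ofReal_iff (by positivity)]
    push_cast
    exact Nat.lt_floor_add_one _

end System

theorem PolyDecay.tendsto_zero {f : ℕ → ℝ} {q : ℝ} (h : PolyDecay f q) (hq : 0 < q) :
    Tendsto f atTop (𝓝 0) := by
  have h1 := tendsto_const_mul_natCast_rpow_neg 1 hq
  simp only [one_mul] at h1
  exact IsBigO.trans_tendsto h h1

/-- Each of the three rate assumptions yields exponents for which the limit laws hold. -/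
theorem exists_decay_exponents {lam δ : ℕ → ℝ} {d₁ u₀ κ κ' ξ : ℝ} (hd₁ : 0 < d₁) (hu₀ : 0 < u₀)
    (hκ' : 0 ≤ κ') (hκ : 1 < κ) (hδ : PolyDecay δ κ) (hξ : 0 < ξ)
    (hrate :
      (∃ p : ℝ, 1 < p ∧ PolyDecay lam p ∧ 1 < κ * ξ ∧
        max (d₁ * ξ / (κ * ξ - 1)) ((ξ / ξ + d₁) * (1 / p)) < min 1 u₀ ∧
        1 < κ * u₀ - 2 - κ') ∨
      (SuperPolyDecay δ ∧ ∃ p : ℝ, 0 < p ∧ PolyDecay lam p ∧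
        (ξ / ξ + d₁) * (1 / p) < min 1 u₀) ∨
      (SuperPolyDecay δ ∧ SuperPolyDecay lam)) :
    ∃ p s : ℝ, 0 < p ∧ 0 < s ∧ PolyDecay lam p ∧ PolyDecay δ s ∧ 1 + d₁ < p * u₀ ∧
      1 < s * ξ ∧ 1 + κ' < s * u₀ := by
  rw [div_self hξ.ne'] at hrate
  have hp' : ∀ p : ℝ, 0 < p → (1 + d₁) * (1 / p) < min 1 u₀ → 1 + d₁ < p * u₀ := by
    intro p hp h
    have h1 := h.trans_le (min_le_right _ _)
    rw [mul_one_div, div_lt_iff₀ hp] at h1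
    linarith
  have hs : ∃ s : ℝ, 0 < s ∧ 1 < s * ξ ∧ 1 + κ' < s * u₀ := by
    refine ⟨(2 + κ') / u₀ + 2 / ξ, by positivity, ?_, ?_⟩
    · have h1 : ((2 + κ') / u₀ + 2 / ξ) * ξ = (2 + κ') / u₀ * ξ + 2 := by field_simp
      have : 0 ≤ (2 + κ') / u₀ * ξ := by positivity
      linarith
    · have h1 : ((2 + κ') / u₀ + 2 / ξ) * u₀ = 2 + κ' + 2 / ξ * u₀ := by field_simp
      have : 0 ≤ 2 / ξ * u₀ := by positivity
      linarith
  rcases hrate with ⟨p, hp, hlam, hκξ, hmax, hκu⟩ | ⟨hδ', p, hp, hlam, h⟩ | ⟨hδ', hlam⟩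
  · exact ⟨p, κ, by linarith, by linarith, hlam, hδ,
      hp' p (by linarith) ((le_max_right _ _).trans_lt hmax), hκξ, by linarith⟩
  · obtain ⟨s, hs0, hs1, hs2⟩ := hs
    exact ⟨p, s, hp, hs0, hlam, hδ' s, hp' p hp h, hs1, hs2⟩
  · obtain ⟨s, hs0, hs1, hs2⟩ := hs
    refine ⟨(2 + d₁) / u₀, s, by positivity, hs0, hlam _, hδ' s, ?_, hs1, hs2⟩
    rw [div_mul_cancel₀ _ hu₀.ne']
    linarith

theorem exists_scale_exponents {p κ d₁ u₀ ξ : ℝ} (hp : 0 < p) (hκ : 0 < κ) (hu₀ : 0 < u₀)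
    (hud : u₀ ≤ d₁) (hpu : 1 + d₁ < p * u₀) (hκξ : 1 < κ * ξ) (hκu : 1 < κ * u₀) (hξ : 0 < ξ) :
    ∃ v q a : ℝ, 0 < v ∧ v < u₀ ∧ 1 + d₁ < p * v ∧ 1 < v * κ ∧ 1 < q ∧ q < κ * ξ ∧
      ξ < v * (κ * ξ - q) + u₀ ∧ 0 < a ∧ 1 < a * u₀ ∧ a + 1 < p ∧ a < κ ∧ v * a < 1 := by
  have hlow : max ((1 + d₁) / p) (max (1 / κ) ((ξ - u₀) / (κ * ξ - 1))) < u₀ := by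
    refine max_lt ?_ (max_lt ?_ ?_)
    · rw [div_lt_iff₀ hp]; linarith
    · rw [div_lt_iff₀ hκ]; linarith
    · rw [div_lt_iff₀ (by linarith)]
      nlinarith [mul_lt_mul_of_pos_right hκu hξ]
  obtain ⟨v, hv, hvu⟩ := exists_between hlow
  obtain ⟨hv1, hv'⟩ := max_lt_iff.1 hv
  obtain ⟨hv2, hv3⟩ := max_lt_iff.1 hv'
  have hv0 : 0 < v := lt_trans (by positivity) hv2
  rw [div_lt_iff₀ hp] at hv1
  rw [div_lt_iff₀ hκ] at hv2
  rw [div_lt_iff₀ (by linarith)] at hv3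
  have hqq : 1 < min (κ * ξ) (κ * ξ - (ξ - u₀) / v) := by
    refine lt_min hκξ ?_
    have : (ξ - u₀) / v < κ * ξ - 1 := by rw [div_lt_iff₀ hv0]; linarith
    linarith
  obtain ⟨q, hq1, hq⟩ := exists_between hqq
  obtain ⟨hq2, hq3⟩ := lt_min_iff.1 hq
  have hq4 : (ξ - u₀) / v < κ * ξ - q := by linarith
  rw [div_lt_iff₀ hv0] at hq4
  have haa : 1 / u₀ < min (p - 1) (min κ (1 / v)) := by
    refine lt_min ?_ (lt_min ?_ ?_)
    · rw [div_lt_iff₀ hu₀]; linarith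
    · rw [div_lt_iff₀ hu₀]; linarith
    · exact one_div_lt_one_div_of_lt hv0 hvu
  obtain ⟨a, ha1, ha⟩ := exists_between haa
  obtain ⟨ha2, ha'⟩ := lt_min_iff.1 ha
  obtain ⟨ha3, ha4⟩ := lt_min_iff.1 ha'
  have ha0 : 0 < a := lt_trans (by positivity) ha1
  rw [div_lt_iff₀ hu₀] at ha1
  rw [lt_div_iff₀ hv0] at ha4
  exact ⟨v, q, a, hv0, hvu, by linarith, hv2, hq1, hq2, by linarith, ha0, ha1, by linarith, ha3,
    by linarith⟩

end RandomMaps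

open RandomMaps in
theorem theorem1 {ι A M U : Type*} [AddMonoidWithOne ι] [MeasurableSpace A]
    [MetricSpace M] [CompactSpace M] [MeasurableSpace M] [BorelSpace M] [MeasurableSpace U]
    (S : System ι A M U) (hcyl : S.CylinderStructure)
    (lam δ Θ : ℕ → ℝ) (d₀ d₁ u₀ κ κ' ξ β : ℝ)
    (hI : S.AnnealedDecay lam)
    (hII : S.QuenchedDecay lam)
    (hd₀ : 0 < d₀) (hd₁ : d₀ < d₁) (hIII : S.DimensionBounds d₀ d₁)
    (hu₀ : 0 < u₀) (hIV : S.LeafBound u₀)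
    (hκ' : 0 ≤ κ') (hΘmono : Monotone Θ) (hΘ : PolyDecay Θ (-κ')) (hV : S.Distortion Θ)
    (hκ : 1 < κ) (hδ : PolyDecay δ κ) (hVI : S.Contraction δ)
    (hβ : 0 < β) (hξ : β ≤ ξ) (hVII : S.AnnulusCondition ξ β)
    (hVIII : S.Comparable)
    (hrate :
      (∃ p : ℝ, 1 < p ∧ PolyDecay lam p ∧ 1 < κ * ξ ∧
        max (d₁ * β / (κ * ξ - 1)) ((β / ξ + d₁) * (1 / p)) < min 1 u₀ ∧
        1 < κ * u₀ - 2 - κ') ∨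
      (SuperPolyDecay δ ∧ ∃ p : ℝ, 0 < p ∧ PolyDecay lam p ∧
        (β / ξ + d₁) * (1 / p) < min 1 u₀) ∨
      (SuperPolyDecay δ ∧ SuperPolyDecay lam)) :
    (∀ᵐ ω ∂S.ν, ∀ᵐ x ∂(S.μf ω), ∀ t : ℝ, 0 < t →
      Tendsto (fun ρ : ℝ => (S.μf ω).real (S.lateHits ω x ρ t)) (𝓝[>] 0) (𝓝 (Real.exp (-t)))) ∧
    (S.RandomAnnulusCondition →
      ∀ᵐ ω ∂S.ν, ∀ᵐ x ∂(S.μf ω), ∀ t : ℝ, 0 < t →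
        Tendsto (fun ρ : ℝ => ((S.μf ω)[|Metric.ball x ρ]).real (S.lateHits ω x ρ t))
          (𝓝[>] 0) (𝓝 (Real.exp (-t)))) := by
  obtain rfl : ξ = β := hVII.exponents_eq hξ hd₀ hIII
  obtain ⟨D, ρ₁, -, hρ₁, hD⟩ := hVII.doubling hβ hξ
  obtain ⟨K, -, hKlow, hKup⟩ := hVIII.domination hρ₁ hD
  obtain ⟨C₂, ρ₂, hC₂, hρ₂, hball⟩ := hIV.ball_le hKlow
  have hud : u₀ ≤ d₁ := hIII.exponent_le hρ₂ hball
  obtain ⟨p, s, hp, hs, hlam, hδs, hpu, hsξ, hsu⟩ :=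
    exists_decay_exponents (hd₀.trans hd₁) hu₀ hκ' hκ hδ hβ hrate
  obtain ⟨v, q, a, hv, hvu, hpv, hvs, hq, hqs, hvq, ha, hau, hap, has, hva⟩ :=
    exists_scale_exponents hp hs hu₀ hud hpu hsξ (by linarith) hβ
  obtain ⟨C, ρ₀, hC, hρ₀, hreg⟩ := System.ae_regularAt hII hKup hVII
  obtain ⟨Cδ, hCδ, hδb⟩ := hδs.exists_bound
  obtain ⟨Cl, hCl, hlamb⟩ := hlam.exists_bound
  obtain ⟨ρ₃, hρ₃, hdim⟩ := hIII
  obtain ⟨C₃, ρ₄, hC₃, hρ₄, hclose⟩ :=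
    System.close_return_le hVI hρ₁ hD hρ₂ hball lam K C ρ₀ ξ
  obtain ⟨f, hf, hf0, hfK, hfd⟩ := System.exists_density hKup
  have hfb : ∀ z, |f z| ≤ K := fun z => by rw [abs_of_nonneg (hf0 z)]; exact hfK z
  have hnull : ∀ᵐ ω ∂S.ν, S.μ (Prod.mk ω ⁻¹' ⋂ n, S.closeReturns a n) = 0 := by
    filter_upwards [hreg] with ω hω
    exact hω.measure_iInter_closeReturns hKlow
      (fun j hj => System.measure_periodic_eq_zero hcyl hIV hΘ hV hs hδs hVI (by linarith) hKlow
        hω.good hj)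
      hC₃ hρ₄ (hclose ω hω) hδb hCl hlamb hCδ ha hau hap has
  have hrare := System.ae_rareReturnsAt hρ₁ hD hnull
  have hequi := System.ae_equidistributedAt hρ₁ hD hf hfb
    (System.tendsto_integral_birkhoffAverage_density hI hVI (hlam.tendsto_zero hp)
      (hδs.tendsto_zero hs) hreg hρ₁ hD hf hf0 hfb hfd)
  have hsmall : ∀ x, Tendsto (fun ρ => S.μ.real (Metric.ball x ρ)) (𝓝[>] 0) (𝓝 0) := by
    intro x
    rw [Metric.tendsto_nhds]
    intro ε hε
    filter_upwards [eventually_const_mul_rpow_le C₂ hu₀ (half_pos hε), Ioo_mem_nhdsGT hρ₂]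
      with ρ h1 h2
    rw [Real.dist_eq, sub_zero, abs_of_nonneg measureReal_nonneg]
    have := hball x ρ h2.1 h2.2
    linarith
  have hdec : ∀ ω, S.RegularAt lam K C ρ₀ ξ ω → ∀ x ∈ S.μ.support, S.DecorrelatesAt v ω x := by
    intro ω hω x hx ε hε
    filter_upwards [System.eventually_abs_inter_avoid_sub_le hVI hC hρ₀ hβ hCδ hδb hCl hlamb hρ₁ hD
      hC₂ hρ₂ hball hρ₃ (fun x hx ρ h0 h1 => (hdim x hx ρ h0 h1).1) hv hvu hp hpv hs hvs hq hqs hvq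
      hε (K := K)] with ρ h k n
    exact h x hx _ (hω.shift_iterate k) n
  have key : ∀ᵐ ω ∂S.ν, ∀ᵐ x ∂(S.μf ω), ∀ t : ℝ, 0 < t →
      Tendsto (fun ρ : ℝ => (S.μf ω).real (S.lateHits ω x ρ t)) (𝓝[>] 0) (𝓝 (Real.exp (-t))) ∧
      Tendsto (fun ρ : ℝ => ((S.μf ω)[|Metric.ball x ρ]).real (S.lateHits ω x ρ t))
          (𝓝[>] 0) (𝓝 (Real.exp (-t))) := by
    filter_upwards [hreg, S.ae_shift_iterate hrare, S.ae_shift_iterate hequi,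
      S.ae_shift_iterate hfd] with ω hω hra heq hde
    have hac : S.μf ω ≪ S.μ := Measure.AbsolutelyContinuous.mk fun E _ hE =>
      le_antisymm ((hω.dom 0 E).trans (by rw [hE, mul_zero])) zero_le
    refine hac.ae_le ?_
    filter_upwards [hra 0, hra 1, heq 1, S.μ.support_mem_ae] with x hx0 hx1 hx2 hxs t ht
    have hK : ∀ k E, (S.μf (shift^[k] ω)).real E ≤ K * S.μ.real E := fun k E =>
      (hω.shift_iterate k).dom_real E
    have hK' : ∀ E, S.μ.real E ≤ K * (S.μf ω).real E := fun E => by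
      have := ENNReal.toReal_mono (ENNReal.mul_ne_top ENNReal.coe_ne_top (measure_ne_top _ _))
        (hKlow ω hω.good E)
      rwa [ENNReal.toReal_mul, ENNReal.coe_toReal] at this
    have hhit := System.tendsto_measureReal_avoid ha hva hv hf hf0 hfb hxs hω.inv
      (hdec ω hω x hxs) hK hx1 hx2 hde (hsmall x) ht
    have hret := System.tendsto_cond_measureReal_avoid ha hva hv hxs (hdec ω hω x hxs) hK hK' hx0
      hhit
    constructor
    · refine hhit.congr' ?_
      filter_upwards [self_mem_nhdsWithin] with ρ hρ
      rw [System.lateHits_eq_avoid hxs hρ ht]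
    · refine hret.congr' ?_
      filter_upwards [self_mem_nhdsWithin] with ρ hρ
      rw [System.lateHits_eq_avoid hxs hρ ht]
  refine ⟨?_, fun _ => ?_⟩
  · filter_upwards [key] with ω hω
    filter_upwards [hω] with x hx t ht using (hx t ht).1
  · filter_upwards [key] with ω hω
    filter_upwards [hω] with x hx t ht using (hx t ht).2
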